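/- All graphs are finite and simple. For a graph $G=(V,E)$, let $\mathrm{SSP}(G)\subseteq\mathbb{R}^V$ be the stable set polytope of $G$, that is, the convex hull of the incidence vectors of the stable sets of $G$ (sets of pairwise non-adjacent vertices). Let $\mathrm{HSTAB}(G)$ be the set of all $x\in\mathbb{R}^V$ such that - $x_v\ge 0$ for every vertex $v$ of $G$, - $\sum_{v\in K}x_v\le 1$ for every clique $K$ of $G$, and - $\sum_{v\in V(C)}x_v\le \frac{|V(C)|-1}{2}$ for every odd cycle $C$ of $G$. The graph $G$ is called h-perfect if $\mathrm{SSP}(G)=\mathrm{HSTAB}(G)$. Write $\omega(G)$ for the clique number and $\chi(G)$ for the chromatic number of $G$. **Theorem.** Every h-perfect graph $G$ is $(\omega(G)+199050)$-colourable. Consequently the class of h-perfect graphs is linearly $\chi$-bounded: there are constants $a,b\in\mathbb{N}$ such that $\chi(H)\le a\,\omega(H)+b$ for every induced subgraph $H$ of every h-perfect graph. -/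

import Mathlib

universe u

namespace SimpleGraph

variable {V : Type*}

/-- The stable set polytope: the convex hull in `ℝ^V` of the incidence vectors of stable sets. -/
def stableSetPolytope (G : SimpleGraph V) : Set (V → ℝ) :=
  convexHull ℝ {x | ∃ S : Set V, G.IsIndepSet S ∧ x = S.indicator 1}

open Classical in
/-- The set `HSTAB(G)` of vectors satisfying the nonnegativity, clique and odd cycle inequalities.
For a cycle `c` the vertex set is `c.support.toFinset`, and it has `c.length` elements. -/
def hstab (G : SimpleGraph V) : Set (V → ℝ) :=
  {x | (∀ v, 0 ≤ x v) ∧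
    (∀ K : Finset V, G.IsClique (K : Set V) → ∑ v ∈ K, x v ≤ 1) ∧
    (∀ (w : V) (c : G.Walk w w), c.IsCycle → Odd c.length →
      ∑ v ∈ c.support.toFinset, x v ≤ ((c.length : ℝ) - 1) / 2)}

/-- A graph is h-perfect if its stable set polytope equals `HSTAB(G)`. -/
def IsHPerfect (G : SimpleGraph V) : Prop :=
  G.stableSetPolytope = G.hstab

/-- `f` is a χ-bounding function for the class `C` of finite graphs: `χ(H) ≤ f(ω(H))` for every
induced subgraph `H` of a graph in `C`. -/
def IsChiBoundingFunction (C : ∀ V : Type u, SimpleGraph V → Prop) (f : ℕ → ℕ) : Prop :=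
  ∀ (V : Type u) [Finite V] (G : SimpleGraph V), C V G →
    ∀ s : Set V, (G.induce s).chromaticNumber ≤ (f (G.induce s).cliqueNum : ℕ∞)

/-- The class `C` of finite graphs has a linear χ-bounding function. -/
def IsLinearlyChiBounded (C : ∀ V : Type u, SimpleGraph V → Prop) : Prop :=
  ∃ a b : ℕ, IsChiBoundingFunction C (fun n => a * n + b)

end SimpleGraph

/-! ### Tight stable sets, and the slack of walks. -/

namespace SimpleGraph

variable {V : Type*}

/-! Only the inclusion of HSTAB in SSP is used. A point x of HSTAB is then a convex combination of
stable sets, and each of those sets that has positive weight satisfies with equality every valid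
inequality that is tight at x. So every feasible point yields a stable set with prescribed
tightness, and the proof is a sequence of well-chosen feasible points.

Constant points give two reductions. If ω ≥ 3, the vector 1/ω is feasible and tight on the maximum
cliques, so some stable set meets all of them (`exists_indepSet_cliqueFree`); deleting it lowers ω
for one colour. The hypothesis passes to induced subgraphs, so this leads to triangle-free graphs.
There, if closed odd walks have length at least g, the vector (g - 1)/(2g) gives a stable set
meeting all those of length g. Four deletions raise the odd girth from 5 to 13
(`TPerfect.exists_indepSet_oddGirth`). With the bound 2276 for odd girth 13
(`TPerfect.col_of_oddGirth`) the result is ω + 2280.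

The main tool at large odd girth is a forbidden configuration, `TPerfect.no_three_contacts`. A hub
is a connected induced bipartite graph with sides A and D. Put 1/n on D, 1 - 1/n on A and (n -
1)/(2n) on an odd hole of length n that A does not see. The resulting stable set contains D and is
tight on the hole, so it misses every hole vertex seen by D. Three such contacts with odd arcs
between them force slack at least 3 where tightness allows 1. The same weights on a shortest odd
closed walk show that a set of vertices seeing D but not A is bipartite (`TPerfect.col_two_of_hub`).

Suppose a component X of a breadth-first level needs more than 1138 colours. Then X contains three
nested lollipops, each a path ending at an odd hole with a connected set of large chromatic number
attached further round the hole (`exists_gadget`, `exists_next_gadget`). Few colours suffice for the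
vertices whose parents see a lollipop (`IsFloor.col_lolli`, based on `TPerfect.col_of_segment`), so
parents can be chosen that avoid the lollipops. Three such parents are joined below X by a tripod,
which completes a frame. One of them, the foot p of the leg, sees the vertex at position 3 of the
middle hole. Applied to holes through the tripod and all three lollipops, the three-contact
principle shows that p sees neither the path leading to the middle hole nor the one leaving its
head. Then the tripod and the outer lollipops form a hub touching the middle hole at positions 0, 3
and q, which is again forbidden (`IsFrame.contradiction`). -/

open Classical in
/-- The polytope selects, for a point `x` with `0 < x d`, a stable set through `d` that is tight
for every valid inequality that is tight at `x`. -/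
theorem exists_tight_indepSet {G : SimpleGraph V} {x : V → ℝ} (hx : x ∈ G.stableSetPolytope)
    {d : V} (hd : 0 < x d) :
    ∃ S : Set V, G.IsIndepSet S ∧ d ∈ S ∧ ∀ (l : (V → ℝ) →ₗ[ℝ] ℝ) (b : ℝ),
      (∀ S' : Set V, G.IsIndepSet S' → l (S'.indicator 1) ≤ b) → l x = b →
        l (S.indicator 1) = b := by
  unfold stableSetPolytope at hx
  rw [convexHull_eq] at hx
  obtain ⟨ι, t, w, z, hw0, hw1, hz, rfl⟩ := hx
  rw [Finset.centerMass_eq_of_sum_1 _ _ hw1] at hd ⊢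
  have key : ∃ i ∈ t, 0 < w i * z i d := by
    by_contra hcon
    push Not at hcon
    have : (∑ i ∈ t, w i • z i) d ≤ 0 := by
      simp only [Finset.sum_apply, Pi.smul_apply, smul_eq_mul]
      exact Finset.sum_nonpos hcon
    linarith
  obtain ⟨i, hi, hpos⟩ := key
  obtain ⟨S, hS, hzS⟩ := hz i hi
  have hwi : 0 < w i := by
    rcases (hw0 i hi).lt_or_eq with h | h
    · exact h
    · rw [← h] at hpos; simp at hpos
  refine ⟨S, hS, ?_, ?_⟩
  · by_contra hd'
    rw [hzS] at hpos
    simp [hd'] at hpos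
  · intro l b hb hl
    have hle : ∀ j ∈ t, l (z j) ≤ b := by
      intro j hj
      obtain ⟨S', hS', h'⟩ := hz j hj
      rw [h']; exact hb S' hS'
    rw [← hzS]
    -- One summand of positive weight with strict inequality would make the whole average strict.
    by_contra hne
    have hlt : l (z i) < b := lt_of_le_of_ne (hle i hi) hne
    have h1 : l (∑ j ∈ t, w j • z j) < ∑ j ∈ t, w j * b := by
      rw [map_sum]
      simp only [map_smul, smul_eq_mul]
      apply Finset.sum_lt_sum
      · intro j hj
        exact mul_le_mul_of_nonneg_left (hle j hj) (hw0 j hj)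
      · exact ⟨i, hi, mul_lt_mul_of_pos_left hlt hwi⟩
    rw [← Finset.sum_mul, hw1, one_mul] at h1
    linarith

/-- The total slack of the edge inequalities `x u + x v ≤ 1` along a walk. -/
def walkSlack {G : SimpleGraph V} (x : V → ℝ) : ∀ {u v : V}, G.Walk u v → ℝ
  | _, _, .nil => 0
  | u, _, .cons (v := v) _ p => (1 - x u - x v) + walkSlack x p

section walkSlack
variable {G : SimpleGraph V} {x : V → ℝ}

@[simp] theorem walkSlack_nil (u : V) : walkSlack x (Walk.nil : G.Walk u u) = 0 := rfl

@[simp] theorem walkSlack_cons {u v w : V} (h : G.Adj u v) (p : G.Walk v w) :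
    walkSlack x (Walk.cons h p) = (1 - x u - x v) + walkSlack x p := rfl

@[simp] theorem walkSlack_append {u v w : V} (p : G.Walk u v) (q : G.Walk v w) :
    walkSlack x (p.append q) = walkSlack x p + walkSlack x q := by
  induction p with
  | nil => simp
  | cons h p ih => simp [ih]; ring

/-- Edge slacks are nonnegative, so their total dominates every alternating sum along the walk.
Alternating sums telescope to an expression in the two ends, whose form depends on the parity. -/
theorem walkSlack_bounds (hx : ∀ u v, G.Adj u v → x u + x v ≤ 1) {u v : V} (p : G.Walk u v) :
    (Odd p.length → 1 - x u - x v ≤ walkSlack x p ∧ x u + x v - 1 ≤ walkSlack x p) ∧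
      (Even p.length → x v - x u ≤ walkSlack x p ∧ x u - x v ≤ walkSlack x p) := by
  induction p with
  | nil => simp
  | cons h p ih =>
    have := hx _ _ h
    simp only [walkSlack_cons, Walk.length_cons]
    constructor
    · intro ho
      have := (ih.2 (by rw [Nat.odd_add_one, Nat.not_odd_iff_even] at ho; exact ho))
      constructor <;> linarith [this.1, this.2]
    · intro ho
      have := ih.1 (by rw [Nat.even_add_one, Nat.not_even_iff_odd] at ho; exact ho)
      constructor <;> linarith [this.1, this.2]

/-- Rotate the closed walk to start at `v`: it is an odd walk both of whose ends have weight 0. -/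
theorem one_le_walkSlack_of_zero (hx : ∀ u v, G.Adj u v → x u + x v ≤ 1) {u v : V}
    (p : G.Walk u u) (hp : Odd p.length) (hv : v ∈ p.support) (h0 : x v = 0) :
    1 ≤ walkSlack x p := by
  obtain ⟨q, r, rfl⟩ := Walk.mem_support_iff_exists_append.1 hv
  have := (walkSlack_bounds hx (r.append q)).1 (by
    rw [Walk.length_append] at hp ⊢; rwa [add_comm]) |>.1
  rw [h0] at this
  simp only [walkSlack_append] at this ⊢
  linarith

/-- The coordinate functional at `v`. -/
def coordMap (v : V) : (V → ℝ) →ₗ[ℝ] ℝ where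
  toFun x := x v
  map_add' _ _ := rfl
  map_smul' _ _ := rfl

@[simp] theorem coordMap_apply (v : V) (y : V → ℝ) : coordMap v y = y v := rfl

/-- The linear part of the slack. -/
def walkSum {G : SimpleGraph V} : ∀ {u v : V}, G.Walk u v → ((V → ℝ) →ₗ[ℝ] ℝ)
  | _, _, .nil => 0
  | u, _, .cons (v := v) _ p => coordMap u + coordMap v + walkSum p

theorem walkSlack_eq {u v : V} (p : G.Walk u v) :
    walkSlack x p = p.length - walkSum p x := by
  induction p with
  | nil => simp [walkSum]
  | cons h p ih => simp [ih, walkSum]; ring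

/-- The edge and odd closed walk inequalities. -/
structure TStab (G : SimpleGraph V) (x : V → ℝ) : Prop where
  nonneg : ∀ v, 0 ≤ x v
  le_one : ∀ v, x v ≤ 1
  edge : ∀ u v, G.Adj u v → x u + x v ≤ 1
  odd : ∀ (v : V) (p : G.Walk v v), Odd p.length → 1 ≤ walkSlack x p

/-- Selection property of t-perfect graphs. -/
def TPerfect (G : SimpleGraph V) : Prop :=
  ∀ x : V → ℝ, G.TStab x → ∀ d, 0 < x d → ∃ S : Set V, G.IsIndepSet S ∧ d ∈ S ∧
    (∀ u v, G.Adj u v → x u + x v = 1 → u ∈ S ∨ v ∈ S) ∧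
    ∀ (v : V) (p : G.Walk v v), Odd p.length → walkSlack x p = 1 →
      walkSlack (S.indicator 1) p = 1

theorem indicator_edge {S : Set V} (hS : G.IsIndepSet S) {u v : V} (h : G.Adj u v) :
    S.indicator (1 : V → ℝ) u + S.indicator 1 v ≤ 1 := by
  classical
  by_cases hu : u ∈ S <;> by_cases hv : v ∈ S <;> simp [hu, hv]
  exact absurd h (hS hu hv h.ne)

/-- An odd walk has a first edge, and one end of that edge lies outside the stable set, hence has
weight 0. -/
theorem one_le_walkSlack_indicator {S : Set V} (hS : G.IsIndepSet S) {v : V} (p : G.Walk v v)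
    (hp : Odd p.length) : 1 ≤ walkSlack (S.indicator 1) p := by
  classical
  cases p with
  | nil => simp at hp
  | cons h p =>
    rename_i w
    by_cases hv : v ∈ S
    · have hw : w ∉ S := fun hw => hS hv hw h.ne h
      exact one_le_walkSlack_of_zero (v := w) (fun _ _ => indicator_edge hS) _ hp (by simp)
        (by simp [hw])
    · exact one_le_walkSlack_of_zero (v := v) (fun _ _ => indicator_edge hS) _ hp (by simp)
        (by simp [hv])

theorem walkSum_apply {u v : V} (p : G.Walk u v) :
    walkSum p x = 2 * (p.support.tail.map x).sum + x u - x v := by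
  induction p with
  | nil => simp [walkSum]
  | cons h p ih =>
    rename_i a b c
    have hs : (p.support.map x).sum = x b + (p.support.tail.map x).sum := by
      conv_lhs => rw [← Walk.cons_tail_support]
      rw [List.map_cons, List.sum_cons]
    rw [Walk.support_cons, List.tail_cons, hs]
    simp only [walkSum, LinearMap.add_apply, coordMap_apply, ih]; ring

-- Slack at least 1 is therefore the odd cycle inequality, and closed walks may replace cycles
-- throughout.
open Classical in
theorem walkSlack_cycle {v : V} {c : G.Walk v v} (hc : c.IsCycle) :
    walkSlack x c = c.length - 2 * ∑ v ∈ c.support.toFinset, x v := by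
  rw [walkSlack_eq, walkSum_apply]
  have h2 : (c.support.toFinset) = c.support.tail.toFinset := by
    rw [← Walk.cons_tail_support c]
    ext a
    simp only [List.toFinset_cons, Finset.mem_insert, List.mem_toFinset, List.tail_cons]
    constructor
    · rintro (rfl | h)
      · exact Walk.end_mem_tail_support hc.not_nil
      · exact h
    · exact Or.inr
  rw [h2, List.sum_toFinset _ hc.support_nodup]
  ring

-- Without triangles the clique inequalities reduce to upper bounds and edge inequalities. From here
-- on the triangle-free case needs only the selection property, no longer the polytopes.
open Classical in
theorem tperfect_of_hstab_subset {G : SimpleGraph V} (hG : G.hstab ⊆ G.stableSetPolytope)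
    (h3 : G.CliqueFree 3) : G.TPerfect := by
  intro x hx d hd
  have hmem : x ∈ G.stableSetPolytope := by
    apply hG
    refine ⟨hx.nonneg, ?_, ?_⟩
    · intro K hK
      have hcard : K.card < 3 := by
        by_contra hcon
        obtain ⟨K', hK', hc⟩ := Finset.exists_subset_card_eq (not_lt.1 hcon)
        exact h3 K' ⟨hK.subset (by exact_mod_cast hK'), hc⟩
      have : K.card = 0 ∨ K.card = 1 ∨ K.card = 2 := by omega
      rcases this with h | h | h
      · rw [Finset.card_eq_zero] at h; simp [h]
      · obtain ⟨a, rfl⟩ := Finset.card_eq_one.1 h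
        simpa using hx.le_one a
      · obtain ⟨a, b, hab, rfl⟩ := Finset.card_eq_two.1 h
        rw [Finset.sum_pair hab]
        exact hx.edge a b (hK (by simp) (by simp) hab)
    · intro w c hc ho
      have h1 := hx.odd w c ho
      rw [walkSlack_cycle hc] at h1
      linarith
  obtain ⟨S, hS, hdS, hl⟩ := exists_tight_indepSet hmem hd
  refine ⟨S, hS, hdS, ?_, ?_⟩
  · intro u v huv ht
    have := hl (coordMap u + coordMap v) 1
      (fun S' hS' => by simpa using indicator_edge hS' huv) (by simpa using ht)
    by_contra hcon
    push Not at hcon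
    simp [hcon.1, hcon.2] at this
  · intro v p hp ht
    have := hl (walkSum p) (p.length - 1) (fun S' hS' => by
      have := one_le_walkSlack_indicator hS' p hp
      rw [walkSlack_eq] at this; linarith) (by rw [walkSlack_eq] at ht; linarith)
    rw [walkSlack_eq, this]; ring

end walkSlack

/-! ### Hubs and weightings on a hub with a rim. -/

section hub
variable {G : SimpleGraph V}

/-- Any two vertices of `s` are joined by a walk inside `s`. -/
def ConnIn (G : SimpleGraph V) (s : Set V) : Prop :=
  ∀ a ∈ s, ∀ b ∈ s, ∃ p : G.Walk a b, ∀ v ∈ p.support, v ∈ s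

/-- No edges between `s` and `t`. -/
def Anti (G : SimpleGraph V) (s t : Set V) : Prop := ∀ a ∈ s, ∀ b ∈ t, ¬ G.Adj a b

theorem Anti.symm {s t : Set V} (h : G.Anti s t) : G.Anti t s := fun a ha b hb hab =>
  h b hb a ha hab.symm

theorem Anti.mono {s t s' t' : Set V} (h : G.Anti s t) (hs : s' ⊆ s) (ht : t' ⊆ t) :
    G.Anti s' t' := fun a ha b hb => h a (hs ha) b (ht hb)

/-- `(A, D)` is an induced connected bipartite subgraph. -/
structure IsHub (G : SimpleGraph V) (A D : Set V) : Prop where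
  disj : Disjoint A D
  antiA : G.Anti A A
  antiD : G.Anti D D
  conn : G.ConnIn (A ∪ D)

open Classical in
/-- The number of edges of a walk that avoid `H`. -/
noncomputable def rimLen (H : Set V) : ∀ {u v : V}, G.Walk u v → ℕ
  | _, _, .nil => 0
  | u, _, .cons (v := v) _ p => (if u ∈ H ∨ v ∈ H then 0 else 1) + rimLen H p

@[simp] theorem rimLen_nil (H : Set V) (u : V) : rimLen H (Walk.nil : G.Walk u u) = 0 := rfl

theorem rimLen_append (H : Set V) {u v w : V} (p : G.Walk u v) (q : G.Walk v w) :
    rimLen H (p.append q) = rimLen H p + rimLen H q := by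
  induction p with
  | nil => simp
  | cons h p ih => simp [rimLen, ih]; ring

theorem rimLen_empty {u v : V} (p : G.Walk u v) : rimLen ∅ p = p.length := by
  induction p with
  | nil => simp
  | cons h p ih => simp [rimLen, ih]; ring

/-- Each hub edge has exactly one end in `S`, so membership in `S` alternates along walks exactly as
the two sides do. -/
theorem ConnIn.subset_of_alternating {A D S : Set V} (hub : G.IsHub A D) (hS : G.IsIndepSet S)
    {d : V} (hd : d ∈ D) (hdS : d ∈ S)
    (ht : ∀ u ∈ A ∪ D, ∀ v ∈ A ∪ D, G.Adj u v → u ∈ S ∨ v ∈ S) : D ⊆ S := by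
  have key : ∀ (u v : V) (p : G.Walk u v), (∀ w ∈ p.support, w ∈ A ∪ D) →
      ((u ∈ D → u ∈ S) ∧ (u ∈ A → u ∉ S)) → ((v ∈ D → v ∈ S) ∧ (v ∈ A → v ∉ S)) := by
    intro u v p
    induction p with
    | nil => exact fun _ h => h
    | cons h p ih =>
      rename_i a b c
      intro hp hu
      have ha : a ∈ A ∪ D := hp a (by simp)
      have hb : b ∈ A ∪ D := hp b (by simp)
      refine ih (fun w hw => hp w (by simp [hw])) ⟨fun hbD => ?_, fun hbA hbS => ?_⟩
      · rcases ha with haA | haD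
        · exact (ht a (.inl haA) b hb h).resolve_left (hu.2 haA)
        · exact absurd h (hub.antiD a haD b hbD)
      · rcases ha with haA | haD
        · exact absurd h (hub.antiA a haA b hbA)
        · exact hS (hu.1 haD) hbS h.ne h
  intro v hv
  obtain ⟨p, hp⟩ := hub.conn d (.inr hd) v (.inr hv)
  exact (key d v p hp ⟨fun _ => hdS, fun hA => absurd hd (Set.disjoint_left.1 hub.disj hA)⟩).1 hv

open Classical in
/-- A hub `(A, D)` together with a rim `C` (with `H` the vertices at which the rim is contracted)
whose odd closed walks have length at least `n`: there is a stable set containing `D` that is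
tight on all rim walks of length `n`. -/
theorem TPerfect.exists_rim_set (hG : G.TPerfect) {A D C H : Set V} (hub : G.IsHub A D)
    (hD : D.Nonempty) (hdisj : Disjoint (A ∪ D) (C ∪ H)) (hCH : Disjoint C H)
    (hH : G.Anti H H) (hA : G.Anti A (C ∪ H)) (hDH : G.Anti D H) {n : ℕ} (hn : 3 ≤ n)
    (hlen : ∀ (v : V) (p : G.Walk v v), (∀ w ∈ p.support, w ∈ C ∪ H) → Odd (rimLen H p) →
      n ≤ rimLen H p) :
    ∃ S : Set V, G.IsIndepSet S ∧ D ⊆ S ∧ ∀ (v : V) (p : G.Walk v v),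
      (∀ w ∈ p.support, w ∈ C ∪ H) → Odd p.length → rimLen H p = n →
        walkSlack (S.indicator 1) p = 1 := by
  have hn0 : (0 : ℝ) < n := by positivity
  have hn3 : (3 : ℝ) ≤ n := by exact_mod_cast hn
  have hDA : ∀ v, v ∈ D → v ∉ A := fun v h h' => Set.disjoint_left.1 hub.disj h' h
  have hCD : ∀ v, v ∈ D → v ∉ C := fun v h h' => Set.disjoint_left.1 hdisj (.inr h) (.inl h')
  have hCA : ∀ v, v ∈ A → v ∉ C := fun v h h' => Set.disjoint_left.1 hdisj (.inl h) (.inl h')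
  have hHD : ∀ v, v ∈ D → v ∉ H := fun v h h' => Set.disjoint_left.1 hdisj (.inr h) (.inr h')
  have hHA : ∀ v, v ∈ A → v ∉ H := fun v h h' => Set.disjoint_left.1 hdisj (.inl h) (.inr h')
  have hHC : ∀ v, v ∈ C → v ∉ H := fun v h h' => Set.disjoint_left.1 hCH h h'
  -- With these weights edges between A and D and edges between C and H are tight. An edge inside C
  -- has slack 1/n, a contact edge between C and D has slack α, and 1/n + 2α = 1.
  set α : ℝ := (n - 1) / (2 * n) with hα
  have hinv0 : (0 : ℝ) < 1 / n := by positivity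
  have hinv : (1 : ℝ) / n ≤ 1 / 3 := one_div_le_one_div_of_le (by norm_num) hn3
  have hα' : α = 1 / 2 - 1 / n / 2 := by rw [hα]; field_simp
  set x : V → ℝ := fun v => if v ∈ C then α else if v ∈ D then 1 / n else
    if v ∈ A then 1 - 1 / n else if v ∈ H then 1 - α else 0 with hx
  have xC : ∀ v ∈ C, x v = α := fun v h => by simp [hx, h]
  have xD : ∀ v ∈ D, x v = 1 / n := fun v h => by simp [hx, h, hCD v h]
  have xA : ∀ v ∈ A, x v = 1 - 1 / n := fun v h => by
    have : v ∉ D := fun h' => hDA v h' h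
    simp [hx, h, hCA v h, this]
  have xH : ∀ v ∈ H, x v = 1 - α := fun v h => by
    have h1 : v ∉ D := fun h' => hHD v h' h
    have h2 : v ∉ A := fun h' => hHA v h' h
    have h3 : v ∉ C := fun h' => hHC v h' h
    simp [hx, h, h1, h2, h3]
  have x0 : ∀ v, v ∉ C → v ∉ D → v ∉ A → v ∉ H → x v = 0 := fun v h1 h2 h3 h4 => by
    simp [hx, h1, h2, h3, h4]
  have cases5 : ∀ v, v ∈ C ∨ v ∈ D ∨ v ∈ A ∨ v ∈ H ∨ x v = 0 := by
    intro v
    by_cases h1 : v ∈ C; · exact .inl h1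
    by_cases h2 : v ∈ D; · exact .inr (.inl h2)
    by_cases h3 : v ∈ A; · exact .inr (.inr (.inl h3))
    by_cases h4 : v ∈ H; · exact .inr (.inr (.inr (.inl h4)))
    exact .inr (.inr (.inr (.inr (x0 v h1 h2 h3 h4))))
  have xnn : ∀ v, 0 ≤ x v ∧ x v ≤ 1 := by
    intro v
    rcases cases5 v with h | h | h | h | h
    · rw [xC v h]; constructor <;> linarith
    · rw [xD v h]; constructor <;> linarith
    · rw [xA v h]; constructor <;> linarith
    · rw [xH v h]; constructor <;> linarith
    · rw [h]; norm_num
  have xe : ∀ u v, G.Adj u v → x u + x v ≤ 1 := by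
    intro u v h
    rcases cases5 u with hu | hu | hu | hu | hu <;> rcases cases5 v with hv | hv | hv | hv | hv <;>
      first
      | (rw [hu]; linarith [(xnn v).2])
      | (rw [hv]; linarith [(xnn u).2])
      | exact absurd h (hub.antiA u hu v hv)
      | exact absurd h (hub.antiD u hu v hv)
      | exact absurd h (hH u hu v hv)
      | exact absurd h (hA u hu v (.inl hv))
      | exact absurd h (hA u hu v (.inr hv))
      | exact absurd h.symm (hA v hv u (.inl hu))
      | exact absurd h.symm (hA v hv u (.inr hu))
      | exact absurd h (hDH u hu v hv)
      | exact absurd h.symm (hDH v hv u hu)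
      | (rw [xC u hu, xC v hv]; linarith)
      | (rw [xC u hu, xD v hv]; linarith)
      | (rw [xD u hu, xC v hv]; linarith)
      | (rw [xA u hu, xD v hv]; linarith)
      | (rw [xD u hu, xA v hv]; linarith)
      | (rw [xC u hu, xH v hv]; linarith)
      | (rw [xH u hu, xC v hv]; linarith)
  have rimSlack : ∀ (u v : V) (p : G.Walk u v), (∀ w ∈ p.support, w ∈ C ∪ H) →
      walkSlack x p = rimLen H p / n := by
    intro u v p
    induction p with
    | nil => simp
    | cons h p ih =>
      rename_i a b c
      intro hp
      have ha := hp a (by simp)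
      have hb := hp b (by simp)
      rw [walkSlack_cons, ih (fun w hw => hp w (by simp [hw])), rimLen]
      rcases ha with ha | ha <;> rcases hb with hb | hb
      · rw [xC a ha, xC b hb]; simp [hHC a ha, hHC b hb, hα']; ring
      · rw [xC a ha, xH b hb]; simp [hb]
      · rw [xH a ha, xC b hb]; simp [ha]
      · exact absurd h (hH a ha b hb)
  -- Here r counts edges inside C and q counts contact edges. All edges except those inside C cross
  -- the boundary of C ∪ A, and precisely the contact edges cross the boundary of C ∪ H. This gives
  -- the two parity statements.
  have count : ∀ (u v : V) (p : G.Walk u v), (∀ w ∈ p.support, x w ≠ 0) → ∃ r q : ℕ,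
      walkSlack x p = r * (1 / n) + q * α ∧
      (p.length + r + (if u ∈ C ∪ A then 1 else 0) + (if v ∈ C ∪ A then 1 else 0)) % 2 = 0 ∧
      (q + (if u ∈ C ∪ H then 1 else 0) + (if v ∈ C ∪ H then 1 else 0)) % 2 = 0 ∧
      (q = 0 → u ∈ C ∪ H → (∀ w ∈ p.support, w ∈ C ∪ H) ∧ r = rimLen H p) ∧
      (q = 0 → u ∉ C ∪ H → r = 0) := by
    intro u v p
    induction p with
    | nil =>
      rename_i a
      intro _
      refine ⟨0, 0, by simp, ?_, ?_, ?_, ?_⟩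
      · split_ifs <;> simp
      · split_ifs <;> simp
      · intro _ h; simpa using h
      · simp
    | cons h p ih =>
      rename_i a b c
      intro hp
      obtain ⟨r, q, h1, h2, h3, h4, h5⟩ := ih (fun w hw => hp w (by simp [hw]))
      have ha := hp a (by simp)
      have hb := hp b (by simp)
      have hsup : ∀ P : V → Prop, P a → (∀ w ∈ p.support, P w) →
          ∀ w ∈ (Walk.cons h p).support, P w := by
        intro P h1 h2 w hw
        rw [Walk.support_cons, List.mem_cons] at hw
        rcases hw with rfl | hw
        · exact h1
        · exact h2 w hw
      simp only [walkSlack_cons, Walk.length_cons, h1, rimLen]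
      rcases cases5 a with ha' | ha' | ha' | ha' | ha'
      rotate_right
      · exact absurd ha' ha
      all_goals rcases cases5 b with hb' | hb' | hb' | hb' | hb'
      all_goals try exact absurd hb' hb
      all_goals try first
        | exact absurd h (hub.antiA a ha' b hb')
        | exact absurd h (hub.antiD a ha' b hb')
        | exact absurd h (hH a ha' b hb')
        | exact absurd h (hA a ha' b (.inl hb'))
        | exact absurd h (hA a ha' b (.inr hb'))
        | exact absurd h.symm (hA b hb' a (.inl ha'))
        | exact absurd h.symm (hA b hb' a (.inr ha'))
        | exact absurd h (hDH a ha' b hb')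
        | exact absurd h.symm (hDH b hb' a ha')
      · -- rim edge
        rw [if_pos (Set.mem_union_left A hb')] at h2
        rw [if_pos (Set.mem_union_left H hb')] at h3
        rw [if_pos (Set.mem_union_left A ha'), if_pos (Set.mem_union_left H ha')]
        refine ⟨r + 1, q, ?_, by omega, h3, ?_, ?_⟩
        · rw [xC a ha', xC b hb', hα']; push_cast; ring
        · intro hq _
          obtain ⟨h6, h7⟩ := h4 hq (.inl hb')
          exact ⟨hsup _ (.inl ha') h6, by simp [hHC a ha', hHC b hb', h7, add_comm]⟩
        · exact fun _ h => absurd (Or.inl ha') h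
      · -- contact edge, leaving the rim
        have e1 : b ∉ C ∪ A := by simp [hCD b hb', hDA b hb']
        have e2 : b ∉ C ∪ H := by simp [hCD b hb', hHD b hb']
        rw [if_neg e1] at h2
        rw [if_neg e2] at h3
        rw [if_pos (Set.mem_union_left A ha'), if_pos (Set.mem_union_left H ha')]
        refine ⟨r, q + 1, ?_, by omega, by omega, by omega, by omega⟩
        rw [xC a ha', xD b hb', hα']; push_cast; ring
      · have e1 : b ∉ C := fun h' => hHC b h' hb'
        have e2 : b ∉ C ∪ A := by
          simp only [Set.mem_union, not_or]; exact ⟨e1, fun h' => hHA b h' hb'⟩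
        rw [if_neg e2] at h2
        rw [if_pos (Set.mem_union_right C hb')] at h3
        rw [if_pos (Set.mem_union_left A ha'), if_pos (Set.mem_union_left H ha')]
        refine ⟨r, q, ?_, by omega, h3, ?_, ?_⟩
        · rw [xC a ha', xH b hb']; ring
        · intro hq _
          obtain ⟨h6, h7⟩ := h4 hq (.inr hb')
          exact ⟨hsup _ (.inl ha') h6, by simp [hb', h7]⟩
        · exact fun _ h => absurd (Or.inl ha') h
      · have e1 : a ∉ C ∪ A := by simp [hCD a ha', hDA a ha']
        have e2 : a ∉ C ∪ H := by simp [hCD a ha', hHD a ha']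
        rw [if_pos (Set.mem_union_left A hb')] at h2
        rw [if_pos (Set.mem_union_left H hb')] at h3
        rw [if_neg e1, if_neg e2]
        refine ⟨r, q + 1, ?_, by omega, by omega, by omega, by omega⟩
        rw [xC b hb', xD a ha', hα']; push_cast; ring
      · have e1 : a ∉ C ∪ A := by simp [hCD a ha', hDA a ha']
        have e2 : a ∉ C ∪ H := by simp [hCD a ha', hHD a ha']
        have e3 : b ∉ C ∪ H := by simp [hCA b hb', hHA b hb']
        rw [if_pos (Set.mem_union_right C hb')] at h2
        rw [if_neg e3] at h3
        rw [if_neg e1, if_neg e2]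
        refine ⟨r, q, ?_, by omega, by omega, fun _ h' => absurd h' e2, fun hq _ => h5 hq e3⟩
        rw [xA b hb', xD a ha']; ring
      · have e1 : b ∉ C ∪ A := by simp [hCD b hb', hDA b hb']
        have e2 : b ∉ C ∪ H := by simp [hCD b hb', hHD b hb']
        have e3 : a ∉ C ∪ H := by simp [hCA a ha', hHA a ha']
        rw [if_neg e1] at h2
        rw [if_neg e2] at h3
        rw [if_pos (Set.mem_union_right C ha'), if_neg e3]
        refine ⟨r, q, ?_, by omega, by omega, fun _ h' => absurd h' e3, fun hq _ => h5 hq e2⟩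
        rw [xA a ha', xD b hb']; ring
      · have e1 : a ∉ C := fun h' => hHC a h' ha'
        have e2 : a ∉ C ∪ A := by
          simp only [Set.mem_union, not_or]; exact ⟨e1, fun h' => hHA a h' ha'⟩
        rw [if_pos (Set.mem_union_left A hb')] at h2
        rw [if_pos (Set.mem_union_left H hb')] at h3
        rw [if_neg e2, if_pos (Set.mem_union_right C ha')]
        refine ⟨r, q, ?_, by omega, h3, ?_, ?_⟩
        · rw [xC b hb', xH a ha']; ring
        · intro hq _
          obtain ⟨h6, h7⟩ := h4 hq (.inl hb')
          exact ⟨hsup _ (.inr ha') h6, by simp [ha', h7]⟩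
        · exact fun _ h => absurd (Or.inr ha') h
  have hts : G.TStab x := by
    refine ⟨fun v => (xnn v).1, fun v => (xnn v).2, xe, ?_⟩
    intro v p hp
    by_cases hz : ∃ w ∈ p.support, x w = 0
    · obtain ⟨w, hw, hw0⟩ := hz
      exact one_le_walkSlack_of_zero xe p hp hw hw0
    push Not at hz
    obtain ⟨r, q, h1, h2, h3, h4, h5⟩ := count v v p hz
    have hp2 := Nat.odd_iff.1 hp
    have hr : r % 2 = 1 := by split_ifs at h2 <;> omega
    have hq : q % 2 = 0 := by split_ifs at h3 <;> omega
    rw [h1]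
    have hr1 : (1 : ℝ) ≤ r := by exact_mod_cast (by omega : 1 ≤ r)
    have hrn : 1 / (n : ℝ) ≤ r * (1 / n) := by nlinarith
    -- Now r is odd and q is even. Without contact edges the walk stays on the rim, because inside
    -- the hub r would be 0, and then r ≥ n. With q ≥ 2 the slack is at least 1/n + 2α = 1.
    rcases Nat.eq_zero_or_pos q with hq0 | hq0
    · by_cases hv : v ∈ C ∪ H
      · obtain ⟨h6, h7⟩ := h4 hq0 hv
        have := hlen v p h6 (by rw [← h7, Nat.odd_iff]; exact hr)
        rw [← h7] at this
        have h8 : (n : ℝ) ≤ r := by exact_mod_cast this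
        rw [hq0]
        have : (n : ℝ) * (1 / n) = 1 := by field_simp
        nlinarith
      · have := h5 hq0 hv; omega
    · have : (2 : ℝ) ≤ q := by exact_mod_cast (by omega : 2 ≤ q)
      have : 2 * α ≤ q * α := by nlinarith
      linarith
  obtain ⟨d, hd⟩ := hD
  obtain ⟨S, hS, hdS, hed, hod⟩ := hG x hts d (by rw [xD d hd]; exact hinv0)
  refine ⟨S, hS, ?_, ?_⟩
  · refine ConnIn.subset_of_alternating hub hS hd hdS ?_
    intro u hu v hv huv
    apply hed u v huv
    rcases hu with hu | hu <;> rcases hv with hv | hv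
    · exact absurd huv (hub.antiA u hu v hv)
    · rw [xA u hu, xD v hv]; ring
    · rw [xD u hu, xA v hv]; ring
    · exact absurd huv (hub.antiD u hu v hv)
  · intro v p hp ho hr
    apply hod v p ho
    rw [rimSlack v v p hp, hr]
    field_simp

end hub

/-! ### Holes, winding numbers and the three-contact obstruction. -/

section hole
variable {G : SimpleGraph V}

/-- Odd closed walks on a rim wind around. -/
theorem le_rimLen_of_index {C H : Set V} {n : ℕ} (idx : V → ℤ)
    (hC : ∀ a ∈ C, ∀ b ∈ C, G.Adj a b →
      (n : ℤ) ∣ idx b - idx a - 1 ∨ (n : ℤ) ∣ idx b - idx a + 1)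
    (hH : ∀ a ∈ C, ∀ b ∈ H, G.Adj a b → (n : ℤ) ∣ idx b - idx a)
    (hCH : Disjoint C H) (hHH : G.Anti H H)
    (v : V) (p : G.Walk v v) (hp : ∀ w ∈ p.support, w ∈ C ∪ H) (ho : Odd (rimLen H p)) :
    n ≤ rimLen H p := by
  -- The integer k is the net number of steps round the rim and has the parity of the rim length.
  -- For an odd closed walk it is nonzero and divisible by n, hence at least n in absolute value.
  have key : ∀ (u v : V) (p : G.Walk u v), (∀ w ∈ p.support, w ∈ C ∪ H) →
      ∃ k : ℤ, (n : ℤ) ∣ idx v - idx u - k ∧ |k| ≤ rimLen H p ∧ (k - rimLen H p) % 2 = 0 := by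
    intro u v p
    induction p with
    | nil => exact fun _ => ⟨0, by simp⟩
    | cons h p ih =>
      rename_i a b c
      intro hp
      obtain ⟨k, h1, h2, h3⟩ := ih (fun w hw => hp w (by simp [hw]))
      rw [abs_le] at h2
      have ha := hp a (by simp)
      have hb := hp b (by simp)
      rw [rimLen]
      by_cases hab : a ∈ H ∨ b ∈ H
      · have h0 : (n : ℤ) ∣ idx b - idx a := by
          rcases ha with ha | ha <;> rcases hb with hb | hb
          · rcases hab with h' | h'
            · exact absurd h' (Set.disjoint_left.1 hCH ha)
            · exact absurd h' (Set.disjoint_left.1 hCH hb)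
          · exact hH a ha b hb h
          · exact (dvd_sub_comm).1 (hH b hb a ha h.symm)
          · exact absurd h (hHH a ha b hb)
        refine ⟨k, ?_, ?_, ?_⟩
        · obtain ⟨y, h0⟩ := h0
          obtain ⟨z, h1⟩ := h1
          exact ⟨y + z, by linear_combination h0 + h1⟩
        · rw [abs_le]; simp [hab]; omega
        · simp [hab]; omega
      · push Not at hab
        have h0 := hC a (ha.resolve_right hab.1) b (hb.resolve_right hab.2) h
        simp only [hab, or_self, if_false]
        rcases h0 with h0 | h0
        · refine ⟨k + 1, ?_, ?_, ?_⟩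
          · obtain ⟨y, h0⟩ := h0
            obtain ⟨z, h1⟩ := h1
            exact ⟨y + z, by linear_combination h0 + h1⟩
          · rw [abs_le]; push_cast; omega
          · push_cast; omega
        · refine ⟨k - 1, ?_, ?_, ?_⟩
          · obtain ⟨y, h0⟩ := h0
            obtain ⟨z, h1⟩ := h1
            exact ⟨y + z, by linear_combination h0 + h1⟩
          · rw [abs_le]; push_cast; omega
          · push_cast; omega
  obtain ⟨k, h1, h2, h3⟩ := key v v p hp
  rw [sub_self, zero_sub, dvd_neg] at h1
  have h4 := Nat.odd_iff.1 ho
  have hk : k ≠ 0 := by rintro rfl; omega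
  have := Int.le_of_dvd (abs_pos.2 hk) ((dvd_abs _ _).2 h1)
  omega

/-- An induced path `f 0, …, f m`. -/
structure IsIndPath (G : SimpleGraph V) (f : ℕ → V) (m : ℕ) : Prop where
  inj : ∀ i j, i ≤ m → j ≤ m → f i = f j → i = j
  adj : ∀ i, i < m → G.Adj (f i) (f (i + 1))
  ind : ∀ i j, i < j → j ≤ m → G.Adj (f i) (f j) → j = i + 1

/-- An induced cycle `h 0, …, h (n - 1)`. -/
structure IsHole (G : SimpleGraph V) (h : ℕ → V) (n : ℕ) : Prop where
  three : 3 ≤ n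
  inj : ∀ i j, i < n → j < n → h i = h j → i = j
  adj : ∀ i, i + 1 < n → G.Adj (h i) (h (i + 1))
  close : G.Adj (h (n - 1)) (h 0)
  ind : ∀ i j, i < j → j < n → G.Adj (h i) (h j) → j = i + 1 ∨ (i = 0 ∧ j = n - 1)

/-- The last clause reads off the rim length from any potential `μ` that grows by one along the
edges avoiding `H` and stays constant along the others. -/
theorem exists_walk_of_seq {f : ℕ → V} {a b : ℕ} (hab : a ≤ b)
    (h : ∀ i, a ≤ i → i < b → G.Adj (f i) (f (i + 1))) :
    ∃ p : G.Walk (f a) (f b), p.length = b - a ∧ (∀ w ∈ p.support, ∃ i, a ≤ i ∧ i ≤ b ∧ w = f i) ∧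
      ∀ (H : Set V) (μ : ℕ → ℕ), (∀ i, a ≤ i → i < b → (f i ∈ H ∨ f (i + 1) ∈ H → μ (i + 1) = μ i) ∧
        (¬ (f i ∈ H ∨ f (i + 1) ∈ H) → μ (i + 1) = μ i + 1)) → μ a + rimLen H p = μ b := by
  induction b, hab using Nat.le_induction with
  | base => exact ⟨.nil, by simp, by simpa using ⟨a, le_rfl, le_rfl, rfl⟩, by simp⟩
  | succ b hab ih =>
    obtain ⟨p, h1, h2, h3⟩ := ih (fun i hi hi' => h i hi (by omega))
    refine ⟨p.append (.cons (h b hab (by omega)) .nil), ?_, ?_, ?_⟩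
    · simp [h1]; omega
    · intro w hw
      rw [Walk.mem_support_append_iff] at hw
      rcases hw with hw | hw
      · obtain ⟨i, hi, hi', rfl⟩ := h2 w hw; exact ⟨i, hi, by omega, rfl⟩
      · simp only [Walk.support_cons, Walk.support_nil, List.mem_cons, List.not_mem_nil,
          or_false] at hw
        rcases hw with rfl | rfl
        · exact ⟨b, hab, by omega, rfl⟩
        · exact ⟨b + 1, by omega, le_rfl, rfl⟩
    · intro H μ hμ
      have e1 := h3 H μ (fun i hi hi' => hμ i hi (by omega))
      have e2 := hμ b hab (by omega)
      rw [rimLen_append, rimLen]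
      by_cases hb : f b ∈ H ∨ f (b + 1) ∈ H
      · rw [if_pos hb]; simp [e2.1 hb]; omega
      · rw [if_neg hb]; simp [e2.2 hb]; omega

open Classical in
/-- Position on a rim contracted at the indices in `I`. -/
noncomputable def rimIdx (I : Set ℕ) : ℕ → ℕ
  | 0 => 0
  | k + 1 => rimIdx I k + (if k ∈ I ∨ k + 1 ∈ I then 0 else 1)

theorem rimIdx_succ_of_mem {I : Set ℕ} {k : ℕ} (h : k ∈ I ∨ k + 1 ∈ I) :
    rimIdx I (k + 1) = rimIdx I k := by simp [rimIdx, h]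

theorem rimIdx_succ_of_not {I : Set ℕ} {k : ℕ} (h : ¬ (k ∈ I ∨ k + 1 ∈ I)) :
    rimIdx I (k + 1) = rimIdx I k + 1 := by simp [rimIdx, h]

open Classical in
/-- A hole and a hub cannot have three contacts with odd arcs between them. At the indices in `I`
the hole is contracted, and the contact is through the pendant vertex `pv i`. -/
theorem TPerfect.no_three_contacts (hG : G.TPerfect) {h : ℕ → V} {n : ℕ} (hh : G.IsHole h n)
    {A D : Set V} (hub : G.IsHub A D) (I : Set ℕ) (pv : ℕ → V)
    (hI0 : 0 ∉ I) (hIn : ∀ i ∈ I, i < n) (hI1 : ∀ i ∈ I, i + 1 ∉ I) (hI2 : ∀ i ∈ I, i + 2 ∉ I)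
    (hI3 : 3 ≤ rimIdx I n)
    (hrim : ∀ i < n, h i ∉ A ∪ D) (hA : ∀ i < n, ∀ x ∈ A, ¬ G.Adj x (h i))
    (hDI : ∀ i ∈ I, ∀ x ∈ D, ¬ G.Adj x (h i))
    (hpv : ∀ i ∈ I, pv i ∉ A ∪ D) (hpvr : ∀ i ∈ I, ∀ j < n, pv i ≠ h j)
    (hpvi : ∀ i ∈ I, ∀ j ∈ I, pv i = pv j → i = j)
    (hpvA : ∀ i ∈ I, ∀ x ∈ A, ¬ G.Adj x (pv i)) (hpvadj : ∀ i ∈ I, G.Adj (pv i) (h i))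
    (hpvn : ∀ i ∈ I, ∀ j < n, G.Adj (pv i) (h j) → j = i ∨ j = i + 2)
    (hpvp : ∀ i ∈ I, ∀ j ∈ I, ¬ G.Adj (pv i) (pv j))
    {a b c : ℕ} (hab : a < b) (hbc : b < c) (hc : c < n)
    (con : ∀ i, i = a ∨ i = b ∨ i = c → ∃ x ∈ D, G.Adj x (if i ∈ I then pv i else h i))
    (o1 : (b - a + (if a ∈ I then 1 else 0) + (if b ∈ I then 1 else 0)) % 2 = 1)
    (o2 : (c - b + (if b ∈ I then 1 else 0) + (if c ∈ I then 1 else 0)) % 2 = 1)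
    (o3 : (n - c + a + (if c ∈ I then 1 else 0) + (if a ∈ I then 1 else 0)) % 2 = 1) : False := by
  have hn := hh.three
  -- Contracted hole vertices form H, while pendant vertices are put into C. A pendant is joined to
  -- its contracted vertex by a tight edge, so it occupies the same position on the rim.
  set H : Set V := {x | ∃ i ∈ I, x = h i} with hHdef
  set C : Set V := {x | (∃ i, i ∉ I ∧ i < n ∧ x = h i) ∨ ∃ i ∈ I, x = pv i} with hCdef
  have memH : ∀ i < n, (h i ∈ H ↔ i ∈ I) := by
    intro i hi
    constructor
    · rintro ⟨j, hj, he⟩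
      rwa [hh.inj i j hi (hIn j hj) he]
    · exact fun hi => ⟨i, hi, rfl⟩
  have pvH : ∀ i ∈ I, pv i ∉ H := by
    rintro i hi ⟨j, hj, he⟩
    exact hpvr i hi j (hIn j hj) he
  have rimMem : ∀ i < n, h i ∈ C ∪ H := by
    intro i hi
    by_cases hiI : i ∈ I
    · exact .inr ⟨i, hiI, rfl⟩
    · exact .inl (.inl ⟨i, hiI, hi, rfl⟩)
  have hCH : Disjoint C H := by
    rw [Set.disjoint_left]
    rintro x (⟨i, hi, hin, rfl⟩ | ⟨i, hi, rfl⟩) hx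
    · exact hi ((memH i hin).1 hx)
    · exact pvH i hi hx
  have noI : ∀ i j, i ∈ I → j ∈ I → i < j → ¬ G.Adj (h i) (h j) := by
    intro i j hi hj hij hadj
    rcases hh.ind i j hij (hIn j hj) hadj with h1 | ⟨h1, h2⟩
    · exact hI1 i hi (h1 ▸ hj)
    · exact hI0 (h1 ▸ hi)
  have hHH : G.Anti H H := by
    rintro x ⟨i, hi, rfl⟩ y ⟨j, hj, rfl⟩ hadj
    rcases lt_trichotomy i j with hij | rfl | hij
    · exact noI i j hi hj hij hadj
    · exact hadj.ne rfl
    · exact noI j i hj hi hij hadj.symm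
  -- the index function
  have hidx : ∃ idx : V → ℤ, (∀ i < n, idx (h i) = rimIdx I i) ∧
      ∀ i ∈ I, idx (pv i) = rimIdx I i := by
    refine ⟨fun x => if hx : ∃ i, i < n ∧ x = h i then rimIdx I hx.choose else
      if hx : ∃ i ∈ I, x = pv i then rimIdx I hx.choose else 0, ?_, ?_⟩
    · intro i hi
      have hx : ∃ j, j < n ∧ h i = h j := ⟨i, hi, rfl⟩
      have := hh.inj i _ hi hx.choose_spec.1 hx.choose_spec.2
      simp only [dif_pos hx, ← this]
    · intro i hi
      have hx : ¬ ∃ j, j < n ∧ pv i = h j := by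
        rintro ⟨j, hj, he⟩; exact hpvr i hi j hj he
      have hx' : ∃ j ∈ I, pv i = pv j := ⟨i, hi, rfl⟩
      have := hpvi i hi _ hx'.choose_spec.1 hx'.choose_spec.2
      simp only [dif_neg hx, dif_pos hx', ← this]
  obtain ⟨idx, hidx1, hidx2⟩ := hidx
  set N := rimIdx I n with hN
  -- steps along the rim
  have hlast : (n - 1 ∈ I → rimIdx I (n - 1) = N) ∧ (n - 1 ∉ I → rimIdx I (n - 1) + 1 = N) := by
    obtain ⟨m, rfl⟩ : ∃ m, n = m + 1 := ⟨n - 1, by omega⟩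
    have hm : m + 1 ∉ I := fun h' => by have := hIn _ h'; omega
    simp only [Nat.add_sub_cancel, hN]
    exact ⟨fun hmI => (rimIdx_succ_of_mem (.inl hmI)).symm,
      fun hmI => (rimIdx_succ_of_not (by tauto)).symm⟩
  have stepC : ∀ i j, i < j → j < n → i ∉ I → j ∉ I → G.Adj (h i) (h j) →
      ((N : ℤ) ∣ (rimIdx I j : ℤ) - rimIdx I i - 1) ∨ ((N : ℤ) ∣ (rimIdx I j : ℤ) - rimIdx I i + 1) := by
    intro i j hij hj hiI hjI hadj
    rcases hh.ind i j hij hj hadj with rfl | ⟨rfl, rfl⟩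
    · left
      rw [rimIdx_succ_of_not (by tauto)]
      push_cast; ring_nf; exact dvd_zero _
    · right
      have := hlast.2 hjI
      simp only [rimIdx]
      rw [← this]; push_cast; ring_nf; exact dvd_refl _
  have stepC' : ∀ i j, i < n → j < n → i ∉ I → j ∉ I → G.Adj (h i) (h j) →
      ((N : ℤ) ∣ (rimIdx I j : ℤ) - rimIdx I i - 1) ∨ ((N : ℤ) ∣ (rimIdx I j : ℤ) - rimIdx I i + 1) := by
    intro i j hi hj hiI hjI hadj
    rcases lt_trichotomy i j with hij | rfl | hij
    · exact stepC i j hij hj hiI hjI hadj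
    · exact absurd rfl hadj.ne
    · rcases stepC j i hij hi hjI hiI hadj.symm with h1 | h1
      · obtain ⟨y, h1⟩ := h1
        exact .inr ⟨-y, by linear_combination -h1⟩
      · obtain ⟨y, h1⟩ := h1
        exact .inl ⟨-y, by linear_combination -h1⟩
  have stepH : ∀ i j, i < n → j ∈ I → G.Adj (h i) (h j) →
      (N : ℤ) ∣ (rimIdx I j : ℤ) - rimIdx I i := by
    intro i j hi hjI hadj
    rcases lt_trichotomy i j with hij | rfl | hij
    · rcases hh.ind i j hij (hIn j hjI) hadj with rfl | ⟨rfl, rfl⟩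
      · rw [rimIdx_succ_of_mem (.inr hjI)]; simp
      · rw [hlast.1 hjI]; simp [rimIdx]
    · exact absurd rfl hadj.ne
    · rcases hh.ind j i hij hi hadj.symm with rfl | ⟨rfl, rfl⟩
      · rw [rimIdx_succ_of_mem (.inl hjI)]; simp
      · exact absurd hjI hI0
  -- Two places beyond a contracted vertex is a single rim step. This is why a pendant may also see
  -- `h (i + 2)` without spoiling the index.
  have step2 : ∀ i, i ∈ I → rimIdx I (i + 2) = rimIdx I i + 1 := by
    intro i hi
    rw [rimIdx_succ_of_not (by have := hI1 i hi; have := hI2 i hi; tauto),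
      rimIdx_succ_of_mem (.inl hi)]
  have hlen : ∀ (v : V) (p : G.Walk v v), (∀ w ∈ p.support, w ∈ C ∪ H) → Odd (rimLen H p) →
      N ≤ rimLen H p := by
    refine le_rimLen_of_index idx ?_ ?_ hCH hHH
    · rintro x (⟨i, hi, hin, rfl⟩ | ⟨i, hi, rfl⟩) y (⟨j, hj, hjn, rfl⟩ | ⟨j, hj, rfl⟩) hadj
      · rw [hidx1 i hin, hidx1 j hjn]; exact stepC' i j hin hjn hi hj hadj
      · rw [hidx1 i hin, hidx2 j hj]
        rcases hpvn j hj i hin hadj.symm with rfl | rfl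
        · exact absurd hj hi
        · right; rw [step2 j hj]; simp
      · rw [hidx2 i hi, hidx1 j hjn]
        rcases hpvn i hi j hjn hadj with rfl | rfl
        · exact absurd hi hj
        · left; rw [step2 i hi]; simp
      · exact absurd hadj (hpvp i hi j hj)
    · rintro x (⟨i, hi, hin, rfl⟩ | ⟨i, hi, rfl⟩) y ⟨j, hj, rfl⟩ hadj
      · rw [hidx1 i hin, hidx1 j (hIn j hj)]; exact stepH i j hin hj hadj
      · rw [hidx2 i hi, hidx1 j (hIn j hj)]
        rcases hpvn i hi j (hIn j hj) hadj with rfl | rfl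
        · simp
        · exact absurd hj (hI2 i hi)
  have hdisj : Disjoint (A ∪ D) (C ∪ H) := by
    rw [Set.disjoint_left]
    rintro x hx ((⟨i, hi, hin, rfl⟩ | ⟨i, hi, rfl⟩) | ⟨i, hi, rfl⟩)
    · exact hrim i hin hx
    · exact hpv i hi hx
    · exact hrim i (hIn i hi) hx
  have hACH : G.Anti A (C ∪ H) := by
    rintro x hx y ((⟨i, hi, hin, rfl⟩ | ⟨i, hi, rfl⟩) | ⟨i, hi, rfl⟩)
    · exact hA i hin x hx
    · exact hpvA i hi x hx
    · exact hA i (hIn i hi) x hx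
  have hDH : G.Anti D H := by
    rintro x hx y ⟨i, hi, rfl⟩; exact hDI i hi x hx
  obtain ⟨d0, hd0, -⟩ := con a (.inl rfl)
  obtain ⟨S, hS, hDS, hw⟩ := hG.exists_rim_set hub ⟨d0, hd0⟩ hdisj hCH hHH hACH hDH hI3 hlen
  -- rim walks
  have rimWalk : ∀ i j, i ≤ j → j < n → ∃ p : G.Walk (h i) (h j), p.length = j - i ∧
      (∀ w ∈ p.support, w ∈ C ∪ H) ∧ rimIdx I i + rimLen H p = rimIdx I j := by
    intro i j hij hj
    obtain ⟨p, h1, h2, h3⟩ := exists_walk_of_seq (f := h) hij (fun k hk hk' => hh.adj k (by omega))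
    refine ⟨p, h1, ?_, h3 H (rimIdx I) ?_⟩
    · intro w hw
      obtain ⟨k, hk, hk', rfl⟩ := h2 w hw
      exact rimMem k (by omega)
    · intro k hk hk'
      rw [memH k (by omega), memH (k + 1) (by omega)]
      exact ⟨rimIdx_succ_of_mem, rimIdx_succ_of_not⟩
  have wrapWalk : ∃ p : G.Walk (h c) (h a), p.length = n - c + a ∧
      (∀ w ∈ p.support, w ∈ C ∪ H) ∧ rimIdx I c + rimLen H p = N + rimIdx I a := by
    obtain ⟨p, h1, h2, h3⟩ := rimWalk c (n - 1) (by omega) (by omega)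
    obtain ⟨q, h4, h5, h6⟩ := rimWalk 0 a (by omega) (by omega)
    refine ⟨p.append (.cons hh.close q), ?_, ?_, ?_⟩
    · simp [h1, h4]; omega
    · intro w hw
      rw [Walk.mem_support_append_iff, Walk.support_cons, List.mem_cons] at hw
      rcases hw with hw | rfl | hw
      · exact h2 w hw
      · exact rimMem _ (by omega)
      · exact h5 w hw
    · rw [rimLen_append, rimLen, memH (n - 1) (by omega), memH 0 (by omega)]
      simp only [rimIdx] at h6
      by_cases hl : n - 1 ∈ I
      · have := hlast.1 hl
        simp [hl]; omega
      · have := hlast.2 hl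
        simp [hl, hI0]; omega
  -- walks between contacts
  have pvmem : ∀ i ∈ I, pv i ∈ C ∪ H := fun i hi => .inl (.inr ⟨i, hi, rfl⟩)
  -- Moving an end of an arc to a pendant vertex adds one edge and no rim length, so it flips the
  -- parity of the arc only.
  have ext : ∀ i j x y, i < n → j < n → (i ∈ I → x = pv i) → (i ∉ I → x = h i) →
      (j ∈ I → y = pv j) → (j ∉ I → y = h j) →
      ∀ p : G.Walk (h i) (h j), (∀ w ∈ p.support, w ∈ C ∪ H) →
      ∃ q : G.Walk x y,
        q.length = p.length + (if i ∈ I then 1 else 0) + (if j ∈ I then 1 else 0) ∧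
        (∀ w ∈ q.support, w ∈ C ∪ H) ∧ rimLen H q = rimLen H p := by
    intro i j x y hi hj x1 x2 y1 y2 p hp
    have s1 : ∃ q : G.Walk x (h j),
        q.length = p.length + (if i ∈ I then 1 else 0) ∧
        (∀ w ∈ q.support, w ∈ C ∪ H) ∧ rimLen H q = rimLen H p := by
      by_cases hiI : i ∈ I
      · obtain rfl := x1 hiI
        simp only [hiI, if_true]
        refine ⟨.cons (hpvadj i hiI) p, by simp, ?_, ?_⟩
        · intro w hw
          rw [Walk.support_cons, List.mem_cons] at hw
          rcases hw with rfl | hw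
          · exact pvmem i hiI
          · exact hp w hw
        · rw [rimLen, if_pos (.inr ((memH i hi).2 hiI))]; simp
      · obtain rfl := x2 hiI
        simp only [hiI, if_false]; exact ⟨p, by simp, hp, rfl⟩
    obtain ⟨q, h1, h2, h3⟩ := s1
    by_cases hjI : j ∈ I
    · obtain rfl := y1 hjI
      rw [if_pos hjI]
      refine ⟨q.append (.cons (hpvadj j hjI).symm .nil), by simp [h1], ?_, ?_⟩
      · intro w hw
        rw [Walk.mem_support_append_iff] at hw
        rcases hw with hw | hw
        · exact h2 w hw
        · simp only [Walk.support_cons, Walk.support_nil, List.mem_cons, List.not_mem_nil,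
            or_false] at hw
          rcases hw with rfl | rfl
          · exact rimMem j hj
          · exact pvmem j hjI
      · rw [rimLen_append, rimLen, if_pos (.inl ((memH j hj).2 hjI)), h3]; simp
    · obtain rfl := y2 hjI
      rw [if_neg hjI]; exact ⟨q, by simp [h1], h2, h3⟩
  obtain ⟨p1, l1, m1, r1⟩ := rimWalk a b hab.le (by omega)
  obtain ⟨p2, l2, m2, r2⟩ := rimWalk b c hbc.le (by omega)
  obtain ⟨p3, l3, m3, r3⟩ := wrapWalk
  obtain ⟨q1, l1', m1', r1'⟩ := ext a b (if a ∈ I then pv a else h a)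
    (if b ∈ I then pv b else h b) (by omega) (by omega) (fun e => if_pos e) (fun e => if_neg e)
    (fun e => if_pos e) (fun e => if_neg e) p1 m1
  obtain ⟨q2, l2', m2', r2'⟩ := ext b c (if b ∈ I then pv b else h b)
    (if c ∈ I then pv c else h c) (by omega) (by omega) (fun e => if_pos e) (fun e => if_neg e)
    (fun e => if_pos e) (fun e => if_neg e) p2 m2
  obtain ⟨q3, l3', m3', r3'⟩ := ext c a (if c ∈ I then pv c else h c)
    (if a ∈ I then pv a else h a) (by omega) (by omega) (fun e => if_pos e) (fun e => if_neg e)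
    (fun e => if_pos e) (fun e => if_neg e) p3 m3
  have k1 : Odd q1.length := by rw [Nat.odd_iff, l1', l1]; exact o1
  have k2 : Odd q2.length := by rw [Nat.odd_iff, l2', l2]; exact o2
  have k3 : Odd q3.length := by rw [Nat.odd_iff, l3', l3]; exact o3
  have fin := hw _ (q1.append (q2.append q3)) (by
      intro w hw
      rw [Walk.mem_support_append_iff, Walk.mem_support_append_iff] at hw
      rcases hw with hw | hw | hw
      · exact m1' w hw
      · exact m2' w hw
      · exact m3' w hw) (by
      rw [Walk.length_append, Walk.length_append]
      exact k1.add_even (k2.add_odd k3)) (by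
      rw [rimLen_append, rimLen_append]; omega)
  -- Contact vertices are neighbours of D ⊆ S and so lie outside S. Each odd arc between two of them
  -- then has slack at least 1, so the closed walk has slack at least 3, against 1 by tightness.
  have notS : ∀ i, i = a ∨ i = b ∨ i = c → (if i ∈ I then pv i else h i) ∉ S := by
    intro i hi hiS
    obtain ⟨x, hx, hadj⟩ := con i hi
    exact hS (hDS hx) hiS hadj.ne hadj
  have ed : ∀ u v, G.Adj u v → S.indicator (1 : V → ℝ) u + S.indicator 1 v ≤ 1 :=
    fun _ _ => indicator_edge hS
  have f1 := ((walkSlack_bounds ed q1).1 k1).1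
  have f2 := ((walkSlack_bounds ed q2).1 k2).1
  have f3 := ((walkSlack_bounds ed q3).1 k3).1
  rw [Set.indicator_of_notMem (notS a (.inl rfl)),
    Set.indicator_of_notMem (notS b (.inr (.inl rfl)))] at f1
  rw [Set.indicator_of_notMem (notS b (.inr (.inl rfl))),
    Set.indicator_of_notMem (notS c (.inr (.inr rfl)))] at f2
  rw [Set.indicator_of_notMem (notS c (.inr (.inr rfl))),
    Set.indicator_of_notMem (notS a (.inl rfl))] at f3
  rw [walkSlack_append, walkSlack_append] at fin
  linarith

end hole

/-! ### Colouring bounds for vertex sets, and the hub lemma. -/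

section col
variable {G : SimpleGraph V}

/-- The set `s` induces a `k`-colourable subgraph. -/
def Col (G : SimpleGraph V) (s : Set V) (k : ℕ) : Prop :=
  ∃ f : V → ℕ, (∀ v ∈ s, f v < k) ∧ ∀ a ∈ s, ∀ b ∈ s, G.Adj a b → f a ≠ f b

theorem Col.mono {s t : Set V} {k l : ℕ} (h : G.Col t k) (hs : s ⊆ t) (hk : k ≤ l) :
    G.Col s l := by
  obtain ⟨f, h1, h2⟩ := h
  exact ⟨f, fun v hv => (h1 v (hs hv)).trans_le hk, fun a ha b hb => h2 a (hs ha) b (hs hb)⟩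

open Classical in
theorem Col.union {s t : Set V} {k l : ℕ} (hs : G.Col s k) (ht : G.Col t l) :
    G.Col (s ∪ t) (k + l) := by
  obtain ⟨f, f1, f2⟩ := hs
  obtain ⟨g, g1, g2⟩ := ht
  refine ⟨fun v => if v ∈ s then f v else k + g v, ?_, ?_⟩
  · intro v hv
    by_cases hvs : v ∈ s
    · simp only [hvs, if_true]; have := f1 v hvs; omega
    · simp only [hvs, if_false]; have := g1 v (hv.resolve_left hvs); omega
  · intro a ha b hb hab
    by_cases has : a ∈ s <;> by_cases hbs : b ∈ s <;> simp only [has, hbs, if_true, if_false]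
    · exact f2 a has b hbs hab
    · have := f1 a has; omega
    · have := f1 b hbs; omega
    · have := g2 a (ha.resolve_left has) b (hb.resolve_left hbs) hab; omega

theorem Col.of_anti {s : Set V} (h : G.Anti s s) : G.Col s 1 :=
  ⟨fun _ => 0, by simp, fun a ha b hb hab => absurd hab (h a ha b hb)⟩

theorem col_empty (k : ℕ) : G.Col ∅ k := ⟨fun _ => 0, by simp, by simp⟩

/-- Reduce a colouring bound for `s` to one for `t`, where `s ∖ t` is covered. -/
theorem Col.of_diff {s t : Set V} {k l m : ℕ} (ht : G.Col t k) (hd : G.Col (s \ t) l)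
    (hm : k + l ≤ m) : G.Col s m :=
  (ht.union hd).mono (fun v hv => by by_cases h : v ∈ t <;> simp [h, hv]) hm

theorem not_col_diff {s t : Set V} {k l : ℕ} (hs : ¬ G.Col s (k + l)) (ht : G.Col t k) :
    ¬ G.Col (s \ t) l := fun h => hs (ht.of_diff h le_rfl)

theorem nonempty_of_not_col {s : Set V} {k : ℕ} (hs : ¬ G.Col s k) : s.Nonempty := by
  by_contra h
  rw [Set.not_nonempty_iff_eq_empty] at h
  exact hs (h ▸ col_empty k)

theorem exists_adj_of_not_col {s : Set V} {k : ℕ} (hk : 1 ≤ k) (hs : ¬ G.Col s k) :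
    ∃ a ∈ s, ∃ b ∈ s, G.Adj a b := by
  by_contra h
  push Not at h
  exact hs ((Col.of_anti (fun a ha b hb => h a ha b hb)).mono le_rfl hk)

theorem col_iff_colorable {s : Set V} {k : ℕ} : G.Col s k ↔ (G.induce s).Colorable k := by
  classical
  constructor
  · rintro ⟨f, h1, h2⟩
    exact ⟨Coloring.mk (fun v : s => (⟨f v, h1 v v.2⟩ : Fin k)) (by
      intro a b hab he
      exact h2 a a.2 b b.2 hab (by simpa using he))⟩
  · rintro ⟨c⟩
    refine ⟨fun v => if hv : v ∈ s then (c ⟨v, hv⟩ : ℕ) else 0, ?_, ?_⟩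
    · intro v hv; simp [hv]
    · intro a ha b hb hab he
      simp only [ha, hb, dif_pos] at he
      exact c.valid (show (G.induce s).Adj ⟨a, ha⟩ ⟨b, hb⟩ from hab) (Fin.ext he)

theorem col_two_of_even {s : Set V}
    (h : ∀ (v : V) (p : G.Walk v v), (∀ w ∈ p.support, w ∈ s) → Even p.length) : G.Col s 2 := by
  rw [col_iff_colorable, two_colorable_iff_forall_loop_even]
  intro u w
  have := h _ (w.map (Embedding.induce s).toHom) (by
    intro x hx
    rw [Walk.support_map, List.mem_map] at hx
    obtain ⟨y, -, rfl⟩ := hx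
    exact y.2)
  rwa [Walk.length_map] at this

/-- Neighbours of `s`. -/
def nbrs (G : SimpleGraph V) (s : Set V) : Set V := {v | ∃ a ∈ s, G.Adj a v}

theorem nbrs_mono {s t : Set V} (h : s ⊆ t) : G.nbrs s ⊆ G.nbrs t := by
  rintro v ⟨a, ha, hv⟩; exact ⟨a, h ha, hv⟩

/-- The hub lemma. -/
theorem TPerfect.col_two_of_hub (hG : G.TPerfect) {A D C : Set V} (hub : G.IsHub A D)
    (hdisj : Disjoint (A ∪ D) C) (hA : G.Anti A C) (hC : C ⊆ G.nbrs D) : G.Col C 2 := by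
  classical
  apply col_two_of_even
  by_contra hcon
  push Not at hcon
  obtain ⟨v₀, p₀, hp₀, ho₀⟩ := hcon
  rw [Nat.not_even_iff_odd] at ho₀
  -- A shortest odd closed walk in C serves as the rim, with nothing contracted; its minimality is
  -- the length condition on rims.
  have hex : ∃ n, ∃ (v : V) (p : G.Walk v v), (∀ w ∈ p.support, w ∈ C) ∧ Odd p.length ∧
      p.length = n := ⟨_, v₀, p₀, hp₀, ho₀, rfl⟩
  obtain ⟨v, p, hp, ho, hlen⟩ := Nat.find_spec hex
  set n := Nat.find hex with hn
  have hmin : ∀ (v : V) (p : G.Walk v v), (∀ w ∈ p.support, w ∈ C) → Odd p.length →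
      n ≤ p.length := fun v p h1 h2 => Nat.find_min' hex ⟨v, p, h1, h2, rfl⟩
  have hn3 : 3 ≤ n := by
    rw [← hlen]
    have h1 : p.length ≠ 1 := by
      intro h1
      exact (Walk.adj_of_length_eq_one h1).ne rfl
    have := Nat.odd_iff.1 ho
    omega
  have hD : D.Nonempty := by
    obtain ⟨d, hd, -⟩ := hC (hp v (by simp)); exact ⟨d, hd⟩
  obtain ⟨S, hS, hDS, hw⟩ := hG.exists_rim_set (C := C) (H := ∅) hub hD (by simpa using hdisj)
    (by simp) (by simp [Anti]) (by simpa using hA) (by simp [Anti]) hn3 (by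
      intro v p h1 h2
      rw [rimLen_empty] at h2 ⊢
      exact hmin v p (by simpa using h1) h2)
  have h1 := hw v p (by simpa using hp) ho (by rw [rimLen_empty, hlen])
  -- All of C lies outside S, so every edge of the walk has slack 1. Tightness would then give n =
  -- 1.
  have hCS : ∀ w ∈ C, w ∉ S := by
    intro w hw hwS
    obtain ⟨d, hd, hadj⟩ := hC hw
    exact hS (hDS hd) hwS hadj.ne hadj
  have key : ∀ (a b : V) (q : G.Walk a b), (∀ w ∈ q.support, w ∈ C) →
      walkSlack (S.indicator 1) q = q.length := by
    intro a b q
    induction q with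
    | nil => simp
    | cons h q ih =>
      intro hq
      rw [walkSlack_cons, ih (fun w hw => hq w (by simp [hw])),
        Set.indicator_of_notMem (hCS _ (hq _ (by simp))),
        Set.indicator_of_notMem (hCS _ (hq _ (by simp)))]
      simp; ring
  rw [key v v p hp, hlen] at h1
  have : n = 1 := by exact_mod_cast h1
  omega

theorem exists_split_of_col_two {s : Set V} (h : G.Col s 2) :
    ∃ s₁ s₂ : Set V, s = s₁ ∪ s₂ ∧ G.Anti s₁ s₁ ∧ G.Anti s₂ s₂ := by
  obtain ⟨f, h1, h2⟩ := h
  refine ⟨{v ∈ s | f v = 0}, {v ∈ s | f v = 1}, ?_, ?_, ?_⟩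
  · ext v
    simp only [Set.mem_union, Set.mem_ofPred_eq]
    constructor
    · intro hv; have := h1 v hv
      rcases (by omega : f v = 0 ∨ f v = 1) with h | h <;> simp [hv, h]
    · tauto
  · intro a ha b hb hab; exact h2 a ha.1 b hb.1 hab (ha.2.trans hb.2.symm)
  · intro a ha b hb hab; exact h2 a ha.1 b hb.1 hab (ha.2.trans hb.2.symm)

theorem ConnIn.attach {s t : Set V} (hs : G.ConnIn s) (ht : ∀ a ∈ t, ∃ b ∈ s, G.Adj b a) :
    G.ConnIn (s ∪ t) := by
  have key : ∀ a ∈ s ∪ t, ∃ b ∈ s, ∃ p : G.Walk a b, ∀ w ∈ p.support, w ∈ s ∪ t := by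
    rintro a (ha | ha)
    · exact ⟨a, ha, .nil, by simp [ha]⟩
    · obtain ⟨b, hb, hab⟩ := ht a ha
      exact ⟨b, hb, .cons hab.symm .nil, by simp [ha, hb]⟩
  intro a ha b hb
  obtain ⟨a', ha', p, hp⟩ := key a ha
  obtain ⟨b', hb', q, hq⟩ := key b hb
  obtain ⟨r, hr⟩ := hs a' ha' b' hb'
  refine ⟨p.append (r.append q.reverse), ?_⟩
  intro w hw
  simp only [Walk.mem_support_append_iff, Walk.support_reverse, List.mem_reverse] at hw
  rcases hw with hw | hw | hw
  · exact hp w hw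
  · exact .inl (hr w hw)
  · exact hq w hw

/-- Vertices seeing only the side `D` of a hub have few-coloured joint neighbourhoods. -/
theorem TPerfect.col_four_of_hub (hG : G.TPerfect) {A D R F : Set V} (hub : G.IsHub A D)
    (hRdisj : Disjoint (A ∪ D) R) (hRA : G.Anti A R) (hRD : R ⊆ G.nbrs D)
    (hF : G.Anti (A ∪ D) F) (hFdisj : Disjoint (A ∪ D) F) (hFR : Disjoint R F) :
    G.Col (F ∩ G.nbrs R) 4 := by
  have h2 := hG.col_two_of_hub hub hRdisj hRA hRD
  obtain ⟨S₁, S₂, rfl, hS₁, hS₂⟩ := exists_split_of_col_two h2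
  -- A stable part S of R can be added to the side A, because R sees only D. The set F then sees
  -- only the enlarged side, so the hub lemma applies with the two sides interchanged.
  have key : ∀ S ⊆ S₁ ∪ S₂, G.Anti S S → G.Col (F ∩ G.nbrs S) 2 := by
    intro S hS hSS
    have hSA : G.Anti S A := (hRA.mono le_rfl hS).symm
    have hub' : G.IsHub D (A ∪ S) := by
      refine ⟨?_, hub.antiD, ?_, ?_⟩
      · rw [Set.disjoint_union_right]
        exact ⟨hub.disj.symm, (hRdisj.mono (Set.subset_union_right) hS)⟩
      · rintro a (ha | ha) b (hb | hb)
        · exact hub.antiA a ha b hb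
        · exact hSA.symm a ha b hb
        · exact hSA a ha b hb
        · exact hSS a ha b hb
      · have := hub.conn.attach (t := S) (fun a ha => by
          obtain ⟨d, hd, hda⟩ := hRD (hS ha)
          exact ⟨d, .inr hd, hda⟩)
        rwa [show D ∪ (A ∪ S) = A ∪ D ∪ S by ext; simp; tauto]
    refine hG.col_two_of_hub hub' ?_ ?_ ?_
    · rw [Set.disjoint_left]
      rintro x (hx | hx | hx) hxF
      · exact Set.disjoint_left.1 hFdisj (.inr hx) hxF.1
      · exact Set.disjoint_left.1 hFdisj (.inl hx) hxF.1
      · exact Set.disjoint_left.1 hFR (hS hx) hxF.1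
    · exact hF.mono Set.subset_union_right Set.inter_subset_left
    · exact fun x hx => nbrs_mono Set.subset_union_right hx.2
  refine ((key S₁ Set.subset_union_left hS₁).union (key S₂ Set.subset_union_right hS₂)).mono ?_
    le_rfl
  rintro x ⟨hxF, a, ha | ha, hax⟩
  · exact .inl ⟨hxF, a, ha, hax⟩
  · exact .inr ⟨hxF, a, ha, hax⟩

end col

/-! ### Vertices attached to a segment of an odd hole. -/

section segment
variable {G : SimpleGraph V}

theorem IsIndPath.mono {f : ℕ → V} {m k : ℕ} (hf : G.IsIndPath f m) (hk : k ≤ m) :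
    G.IsIndPath f k :=
  ⟨fun i j hi hj => hf.inj i j (hi.trans hk) (hj.trans hk), fun i hi => hf.adj i (by omega),
    fun i j hij hj => hf.ind i j hij (by omega)⟩

theorem IsHole.indPath {h : ℕ → V} {n m : ℕ} (hh : G.IsHole h n) (hm : m + 2 ≤ n) :
    G.IsIndPath h m :=
  ⟨fun i j hi hj => hh.inj i j (by omega) (by omega), fun i hi => hh.adj i (by omega),
    fun i j hij hj hadj => (hh.ind i j hij (by omega) hadj).resolve_right (by omega)⟩

theorem IsIndPath.hub {f : ℕ → V} {m : ℕ} (hf : G.IsIndPath f m) (e : ℕ) :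
    G.IsHub {x | ∃ i ≤ m, i % 2 ≠ e % 2 ∧ x = f i} {x | ∃ i ≤ m, i % 2 = e % 2 ∧ x = f i} := by
  have anti : ∀ i j, i ≤ m → j ≤ m → i % 2 = j % 2 → ¬ G.Adj (f i) (f j) := by
    intro i j hi hj hp hadj
    rcases lt_trichotomy i j with hij | rfl | hij
    · have := hf.ind i j hij hj hadj; omega
    · exact hadj.ne rfl
    · have := hf.ind j i hij hi hadj.symm; omega
  refine ⟨?_, ?_, ?_, ?_⟩
  · rw [Set.disjoint_left]
    rintro x ⟨i, hi, hp, rfl⟩ ⟨j, hj, hq, he⟩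
    have := hf.inj i j hi hj he
    omega
  · rintro x ⟨i, hi, hp, rfl⟩ y ⟨j, hj, hq, rfl⟩
    exact anti i j hi hj (by omega)
  · rintro x ⟨i, hi, hp, rfl⟩ y ⟨j, hj, hq, rfl⟩
    exact anti i j hi hj (by omega)
  · have key : ∀ i j, i ≤ j → j ≤ m → ∃ p : G.Walk (f i) (f j), ∀ w ∈ p.support,
        w ∈ {x | ∃ i ≤ m, i % 2 ≠ e % 2 ∧ x = f i} ∪ {x | ∃ i ≤ m, i % 2 = e % 2 ∧ x = f i} := by
      intro i j hij hj
      obtain ⟨p, -, h2, -⟩ := exists_walk_of_seq (G := G) (f := f) hij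
        (fun k hk hk' => hf.adj k (by omega))
      refine ⟨p, fun w hw => ?_⟩
      obtain ⟨k, hk, hk', rfl⟩ := h2 w hw
      by_cases hp : k % 2 = e % 2
      · exact .inr ⟨k, by omega, hp, rfl⟩
      · exact .inl ⟨k, by omega, hp, rfl⟩
    have mem : ∀ x ∈ {x | ∃ i ≤ m, i % 2 ≠ e % 2 ∧ x = f i} ∪
        {x | ∃ i ≤ m, i % 2 = e % 2 ∧ x = f i}, ∃ i ≤ m, x = f i := by
      rintro x (⟨i, hi, -, rfl⟩ | ⟨i, hi, -, rfl⟩) <;> exact ⟨i, hi, rfl⟩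
    intro a ha b hb
    obtain ⟨i, hi, rfl⟩ := mem a ha
    obtain ⟨j, hj, rfl⟩ := mem b hb
    rcases le_total i j with hij | hij
    · exact key i j hij hj
    · obtain ⟨p, hp⟩ := key j i hij hi
      exact ⟨p.reverse, fun w hw => hp w (by simpa using hw)⟩

/-- Vertices that see an induced path only at positions of one parity. -/
theorem TPerfect.col_four_of_parity (hG : G.TPerfect) {f : ℕ → V} {m : ℕ} (hf : G.IsIndPath f m)
    {R F : Set V} (e : ℕ) (hF : ∀ i ≤ m, ∀ x ∈ F, ¬ G.Adj (f i) x) (hFf : ∀ i ≤ m, f i ∉ F)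
    (hRF : Disjoint R F) (hRf : ∀ i ≤ m, f i ∉ R)
    (hit : ∀ r ∈ R, ∃ i ≤ m, i % 2 = e % 2 ∧ G.Adj r (f i))
    (miss : ∀ r ∈ R, ∀ i ≤ m, i % 2 ≠ e % 2 → ¬ G.Adj r (f i)) : G.Col (F ∩ G.nbrs R) 4 := by
  refine hG.col_four_of_hub (hf.hub e) ?_ ?_ ?_ ?_ ?_ hRF
  · rw [Set.disjoint_left]
    rintro x (⟨i, hi, -, rfl⟩ | ⟨i, hi, -, rfl⟩) <;> exact hRf i hi
  · rintro x ⟨i, hi, hp, rfl⟩ r hr hadj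
    exact miss r hr i hi hp hadj.symm
  · intro r hr
    obtain ⟨i, hi, hp, hadj⟩ := hit r hr
    exact ⟨f i, ⟨i, hi, hp, rfl⟩, hadj.symm⟩
  · rintro x (⟨i, hi, -, rfl⟩ | ⟨i, hi, -, rfl⟩) <;> exact hF i hi
  · rw [Set.disjoint_left]
    rintro x (⟨i, hi, -, rfl⟩ | ⟨i, hi, -, rfl⟩) <;> exact hFf i hi

/-- Three contacts without contraction. -/
theorem TPerfect.no_three_hits (hG : G.TPerfect) {h : ℕ → V} {n : ℕ} (hh : G.IsHole h n)
    (hn : n % 2 = 1) {A D : Set V} (hub : G.IsHub A D) (hrim : ∀ i < n, h i ∉ A ∪ D)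
    (hA : ∀ i < n, ∀ x ∈ A, ¬ G.Adj x (h i)) {a b c : ℕ} (hab : a < b) (hbc : b < c) (hc : c < n)
    (o1 : (b - a) % 2 = 1) (o2 : (c - b) % 2 = 1)
    (ca : ∃ x ∈ D, G.Adj x (h a)) (cb : ∃ x ∈ D, G.Adj x (h b)) (cc : ∃ x ∈ D, G.Adj x (h c)) :
    False := by
  have hidx : ∀ k, rimIdx ∅ k = k := by
    intro k
    induction k with
    | zero => rfl
    | succ k ih => rw [rimIdx_succ_of_not (by simp), ih]
  refine hG.no_three_contacts hh hub ∅ h (by simp) (by simp) (by simp) (by simp)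
    (by rw [hidx]; exact hh.three) hrim hA (by simp) (by simp) (by simp) (by simp) (by simp)
    (by simp) (by simp) (by simp) hab hbc hc ?_ ?_ ?_ ?_
  · rintro i (rfl | rfl | rfl) <;> simpa
  · simpa using o1
  · simpa using o2
  · simp only [Set.mem_empty_iff_false, if_false]; omega

theorem isHub_singleton (r : V) : G.IsHub ∅ {r} :=
  ⟨by simp, by simp [Anti], by simp [Anti], by
    intro a ha b hb
    simp only [Set.empty_union, Set.mem_singleton_iff] at ha hb
    subst ha; subst hb
    exact ⟨.nil, by simp⟩⟩

theorem exists_min_of_nonempty {s : Set V} (hs : s.Nonempty) (w : V → ℕ) :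
    ∃ r ∈ s, ∀ r' ∈ s, w r ≤ w r' := by
  classical
  have hex : ∃ k, ∃ r ∈ s, w r = k := ⟨_, hs.some, hs.some_mem, rfl⟩
  obtain ⟨r, hr, hk⟩ := Nat.find_spec hex
  exact ⟨r, hr, fun r' hr' => hk ▸ Nat.find_min' hex ⟨r', hr', rfl⟩⟩

/-- Few colours suffice for the common neighbours of vertices that all see a fixed segment of an
odd hole. The relation `EL` stands for being linked by a hub that avoids the hole. -/
theorem TPerfect.col_of_segment (hG : G.TPerfect) {h : ℕ → V} {n m : ℕ} (hh : G.IsHole h n)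
    (hn : n % 2 = 1) (hm : m + 2 ≤ n) {R F : Set V}
    (hF : ∀ i ≤ m, ∀ x ∈ F, ¬ G.Adj (h i) x) (hFf : ∀ i ≤ m, h i ∉ F)
    (hRF : Disjoint R F) (hRf : ∀ i < n, h i ∉ R) (hit : ∀ r ∈ R, ∃ i ≤ m, G.Adj r (h i))
    (EL near : V → V → Prop)
    (hEL : ∀ r ∈ R, ∀ r' ∈ R, EL r r' → ∃ A D, G.IsHub A D ∧ r ∈ D ∧ r' ∈ D ∧
      (∀ i < n, h i ∉ A ∪ D) ∧ ∀ i < n, ∀ x ∈ A, ¬ G.Adj x (h i))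
    (triple : ∀ r₁ ∈ R, ∀ r₂ ∈ R, ∀ r₃ ∈ R, ¬ near r₁ r₂ → ¬ near r₁ r₃ → ¬ near r₂ r₃ →
      EL r₁ r₂ ∨ EL r₁ r₃ ∨ EL r₂ r₃)
    {κ : ℕ} (hnear : ∀ r ∈ R, G.Col (F ∩ G.nbrs {r' ∈ R | near r r'}) κ) :
    G.Col (F ∩ G.nbrs R) (24 + 4 * κ) := by
  classical
  have hp := hh.indPath hm
  -- a single vertex does not alternate twice
  have single : ∀ r ∈ R, ∀ a b c, a < b → b < c → c ≤ m → (b - a) % 2 = 1 → (c - b) % 2 = 1 →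
      G.Adj r (h a) → G.Adj r (h b) → G.Adj r (h c) → False := by
    intro r hr a b c hab hbc hc o1 o2 ha hb hc'
    refine hG.no_three_hits hh hn (isHub_singleton r) ?_ (by simp) hab hbc (by omega) o1 o2
      ⟨r, rfl, ha⟩ ⟨r, rfl, hb⟩ ⟨r, rfl, hc'⟩
    intro i hi hir
    simp only [Set.empty_union, Set.mem_singleton_iff] at hir
    exact hRf i hi (hir ▸ hr)
  -- vertices switching from parity `e` to the other one
  set Sw : ℕ → Set V := fun e => {r ∈ R | ∃ i j, i < j ∧ j ≤ m ∧ i % 2 = e % 2 ∧ j % 2 ≠ e % 2 ∧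
    G.Adj r (h i) ∧ G.Adj r (h j)} with hSw
  have four : ∀ (e : ℕ) (Q : Set V), Q ⊆ Sw e → Q.Nonempty → ∃ r₀ ∈ Q,
      G.Col (F ∩ G.nbrs {r ∈ Q | EL r₀ r}) 4 := by
    intro e Q hQ hQn
    -- Here `w r` is the first neighbour of r at a position of the wrong parity. Some neighbour of
    -- parity e precedes it, since otherwise r alone would have three alternating contacts.
    have hw : ∀ r, ∃ w, r ∈ Q → (w ≤ m ∧ w % 2 ≠ e % 2 ∧ G.Adj r (h w) ∧
        (∀ j ≤ m, j % 2 ≠ e % 2 → G.Adj r (h j) → w ≤ j) ∧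
        ∃ i < w, i % 2 = e % 2 ∧ G.Adj r (h i)) := by
      intro r
      by_cases hr : r ∈ Q
      · obtain ⟨hrR, i, j, hij, hj, hi1, hj1, hi2, hj2⟩ := hQ hr
        have hex : ∃ w, w ≤ m ∧ w % 2 ≠ e % 2 ∧ G.Adj r (h w) := ⟨j, hj, hj1, hj2⟩
        refine ⟨Nat.find hex, fun _ => ⟨(Nat.find_spec hex).1, (Nat.find_spec hex).2.1,
          (Nat.find_spec hex).2.2, fun j h1 h2 h3 => Nat.find_min' hex ⟨h1, h2, h3⟩, ?_⟩⟩
        refine ⟨i, ?_, hi1, hi2⟩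
        by_contra hcon
        obtain ⟨h1, h2, h3⟩ := Nat.find_spec hex
        have : Nat.find hex ≠ i := by intro h'; omega
        exact single r hrR _ i j (by omega) hij hj (by omega) (by omega) h3 hi2 hj2
      · exact ⟨0, fun h' => absurd h' hr⟩
    choose w hw using hw
    obtain ⟨r₀, hr₀, hmin⟩ := exists_min_of_nonempty hQn w
    refine ⟨r₀, hr₀, ?_⟩
    obtain ⟨h1, h2, h3, -, i₀, hi₀, hi₀', hi₀''⟩ := hw r₀ hr₀
    -- Before position `w r₀`, every vertex linked to r₀ has a neighbour of parity e and none of the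
    -- other parity, by minimality of `w r₀`. This initial segment is therefore a hub seen on one
    -- side only.
    refine hG.col_four_of_parity (hp.mono (by omega : w r₀ - 1 ≤ m)) e
      (fun i hi => hF i (by omega)) (fun i hi => hFf i (by omega))
      (hRF.mono_left fun r hr => (hQ hr.1).1) (fun i hi hr => hRf i (by omega) (hQ hr.1).1) ?_ ?_
    · rintro r ⟨hr, hEr⟩
      obtain ⟨k1, k2, k3, -, i, hi, hi', hi''⟩ := hw r hr
      by_cases hiw : i < w r₀
      · exact ⟨i, by omega, hi', hi''⟩
      -- Otherwise the hub linking r₀ and r has contacts at i₀ and `w r₀`, through r₀, and at a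
      -- later i, through r, with alternating parities.
      exfalso
      obtain ⟨A, D, hub, hr0D, hrD, hd1, hd2⟩ := hEL r₀ (hQ hr₀).1 r (hQ hr).1 hEr
      have : i ≠ w r₀ := by intro h'; omega
      exact hG.no_three_hits hh hn hub hd1 hd2 hi₀ (by omega : w r₀ < i) (by omega) (by omega)
        (by omega) ⟨r₀, hr0D, hi₀''⟩ ⟨r₀, hr0D, h3⟩ ⟨r, hrD, hi''⟩
    · rintro r ⟨hr, hEr⟩ i hi hie hadj
      have := (hw r hr).2.2.2.1 i (by omega) hie hadj
      have := hmin r hr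
      omega
  have switch : ∀ e, G.Col (F ∩ G.nbrs (Sw e)) (8 + 2 * κ) := by
    intro e
    by_cases h0 : (Sw e).Nonempty
    swap
    · rw [Set.not_nonempty_iff_eq_empty] at h0
      rw [h0]
      refine (col_empty _).mono ?_ le_rfl
      rintro x ⟨-, a, ha, -⟩; exact ha.elim
    obtain ⟨r₁, hr₁, hc1⟩ := four e _ le_rfl h0
    -- Two rounds of selection suffice. A vertex linked to neither r₁ nor r₂ and far from both would
    -- form with them a triple contradicting `triple`. Each round costs 4 + κ.
    set Q := {r ∈ Sw e | ¬ EL r₁ r ∧ ¬ near r₁ r} with hQ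
    have hcQ : G.Col (F ∩ G.nbrs Q) (4 + κ) := by
      by_cases h1 : Q.Nonempty
      swap
      · rw [Set.not_nonempty_iff_eq_empty] at h1
        rw [h1]
        refine (col_empty _).mono ?_ le_rfl
        rintro x ⟨-, a, ha, -⟩; exact ha.elim
      obtain ⟨r₂, hr₂, hc2⟩ := four e Q (fun r hr => hr.1) h1
      refine (hc2.union (hnear r₂ hr₂.1.1)).mono ?_ le_rfl
      rintro x ⟨hx, r, hr, hrx⟩
      by_cases h2 : EL r₂ r
      · exact .inl ⟨hx, r, ⟨hr, h2⟩, hrx⟩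
      by_cases h3 : near r₂ r
      · exact .inr ⟨hx, r, ⟨hr.1.1, h3⟩, hrx⟩
      rcases triple r₁ hr₁.1 r₂ hr₂.1.1 r hr.1.1 hr₂.2.2 hr.2.2 h3 with h4 | h4 | h4
      · exact absurd h4 hr₂.2.1
      · exact absurd h4 hr.2.1
      · exact absurd h4 h2
    refine ((hc1.union (hnear r₁ hr₁.1)).union hcQ).mono ?_ (by omega)
    rintro x ⟨hx, r, hr, hrx⟩
    by_cases h2 : EL r₁ r
    · exact .inl (.inl ⟨hx, r, ⟨hr, h2⟩, hrx⟩)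
    by_cases h3 : near r₁ r
    · exact .inl (.inr ⟨hx, r, ⟨hr.1, h3⟩, hrx⟩)
    exact .inr ⟨hx, r, ⟨hr, h2, h3⟩, hrx⟩
  set Pu : ℕ → Set V := fun e => {r ∈ R | (∃ i ≤ m, i % 2 = e % 2 ∧ G.Adj r (h i)) ∧
    ∀ i ≤ m, i % 2 ≠ e % 2 → ¬ G.Adj r (h i)} with hPu
  have pure : ∀ e, G.Col (F ∩ G.nbrs (Pu e)) 4 := fun e =>
    hG.col_four_of_parity hp e hF hFf (hRF.mono_left fun r hr => hr.1)
      (fun i hi hr => hRf i (by omega) hr.1) (fun r hr => hr.2.1) (fun r hr => hr.2.2)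
  -- Each of the two switching directions costs 8 + 2κ, and each of the two pure parities costs 4.
  refine (((switch 0).union (switch 1)).union ((pure 0).union (pure 1))).mono ?_ (by omega)
  rintro x ⟨hx, r, hr, hrx⟩
  by_cases h0 : r ∈ Sw 0
  · exact .inl (.inl ⟨hx, r, h0, hrx⟩)
  by_cases h1 : r ∈ Sw 1
  · exact .inl (.inr ⟨hx, r, h1, hrx⟩)
  obtain ⟨i, hi, hadj⟩ := hit r hr
  have nosw : ∀ j ≤ m, j % 2 ≠ i % 2 → ¬ G.Adj r (h j) := by
    intro j hj hji hadj'
    have main : ∀ a b, a < b → b ≤ m → a % 2 ≠ b % 2 → G.Adj r (h a) → G.Adj r (h b) → False := by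
      intro a b hab hb hne ha hb'
      rcases (by omega : a % 2 = 0 ∨ a % 2 = 1) with h2 | h2
      · exact h0 ⟨hr, a, b, hab, hb, by omega, by omega, ha, hb'⟩
      · exact h1 ⟨hr, a, b, hab, hb, by omega, by omega, ha, hb'⟩
    rcases lt_trichotomy i j with hij | rfl | hij
    · exact main i j hij hj (by omega) hadj hadj'
    · exact hji rfl
    · exact main j i hij hi (by omega) hadj' hadj
  rcases (by omega : i % 2 = 0 ∨ i % 2 = 1) with h2 | h2
  · exact .inr (.inl ⟨hx, r, ⟨hr, ⟨i, hi, by omega, hadj⟩, fun j hj h3 => nosw j hj (by omega)⟩, hrx⟩)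
  · exact .inr (.inr ⟨hx, r, ⟨hr, ⟨i, hi, by omega, hadj⟩, fun j hj h3 => nosw j hj (by omega)⟩, hrx⟩)

end segment

/-! ### Shortest paths, components, breadth-first search, odd girth. -/

section paths
variable {G : SimpleGraph V}

/-- A shortest path inside `Q` from `u` to the target set `T`. -/
theorem exists_indPath {Q T : Set V} {u : V}
    (hex : ∃ v ∈ T, ∃ p : G.Walk u v, ∀ w ∈ p.support, w ∈ Q) :
    ∃ (f : ℕ → V) (m : ℕ), G.IsIndPath f m ∧ f 0 = u ∧ f m ∈ T ∧ (∀ i ≤ m, f i ∈ Q) ∧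
      ∀ v ∈ T, ∀ p : G.Walk u v, (∀ w ∈ p.support, w ∈ Q) → m ≤ p.length := by
  classical
  have hex' : ∃ m, ∃ v ∈ T, ∃ p : G.Walk u v, (∀ w ∈ p.support, w ∈ Q) ∧ p.length = m := by
    obtain ⟨v, hv, p, hp⟩ := hex
    exact ⟨_, v, hv, p, hp, rfl⟩
  obtain ⟨v, hv, p, hp, hlen⟩ := Nat.find_spec hex'
  set m := Nat.find hex' with hm
  have hmin : ∀ v ∈ T, ∀ p : G.Walk u v, (∀ w ∈ p.support, w ∈ Q) → m ≤ p.length :=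
    fun v hv p hp => Nat.find_min' hex' ⟨v, hv, p, hp, rfl⟩
  have htake : ∀ i, ∀ w ∈ (p.take i).support, w ∈ Q := fun i w hw =>
    hp w ((p.isSubwalk_take i).support_subset hw)
  have hdrop : ∀ i, ∀ w ∈ (p.drop i).support, w ∈ Q := fun i w hw =>
    hp w ((p.isSubwalk_drop i).support_subset hw)
  refine ⟨p.getVert, m, ⟨?_, ?_, ?_⟩, by simp, ?_, ?_, hmin⟩
  · have key : ∀ i j, i < j → j ≤ m → p.getVert i ≠ p.getVert j := by
      intro i j hij hj he
      have := hmin v hv ((p.take i).append ((p.drop j).copy he.symm rfl)) (by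
        intro w hw
        rw [Walk.mem_support_append_iff, Walk.support_copy] at hw
        rcases hw with hw | hw
        · exact htake i w hw
        · exact hdrop j w hw)
      simp only [Walk.length_append, Walk.length_copy, Walk.take_length, Walk.drop_length] at this
      omega
    intro i j hi hj he
    rcases lt_trichotomy i j with hij | hij | hij
    · exact absurd he (key i j hij hj)
    · exact hij
    · exact absurd he.symm (key j i hij hi)
  · intro i hi
    exact p.adj_getVert_succ (by omega)
  · intro i j hij hj hadj
    have := hmin v hv ((p.take i).append (.cons hadj (p.drop j))) (by
      intro w hw
      rw [Walk.mem_support_append_iff, Walk.support_cons, List.mem_cons] at hw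
      rcases hw with hw | rfl | hw
      · exact htake i w hw
      · exact hp _ (p.getVert_mem_support i)
      · exact hdrop j w hw)
    simp only [Walk.length_append, Walk.length_cons, Walk.take_length, Walk.drop_length] at this
    omega
  · rw [← hlen, p.getVert_length]; exact hv
  · exact fun i _ => hp _ (p.getVert_mem_support i)

/-- The vertices reachable from `a` inside `s`. -/
def compIn (G : SimpleGraph V) (s : Set V) (a : V) : Set V :=
  {b | ∃ p : G.Walk a b, ∀ w ∈ p.support, w ∈ s}

theorem compIn_subset (s : Set V) (a : V) : G.compIn s a ⊆ s := by
  rintro b ⟨p, hp⟩; exact hp b (by simp)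

theorem mem_compIn_self {s : Set V} {a : V} (ha : a ∈ s) : a ∈ G.compIn s a :=
  ⟨.nil, by simpa using ha⟩

theorem compIn_closed {s : Set V} {a b c : V} (hb : b ∈ G.compIn s a) (hc : c ∈ s)
    (hbc : G.Adj b c) : c ∈ G.compIn s a := by
  obtain ⟨p, hp⟩ := hb
  refine ⟨p.append (.cons hbc .nil), fun w hw => ?_⟩
  rw [Walk.mem_support_append_iff] at hw
  rcases hw with hw | hw
  · exact hp w hw
  · simp only [Walk.support_cons, Walk.support_nil, List.mem_cons, List.not_mem_nil,
      or_false] at hw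
    rcases hw with rfl | rfl
    · exact hp _ (by simp)
    · exact hc

theorem compIn_eq_of_adj {s : Set V} {a b : V} (ha : a ∈ s) (hb : b ∈ s) (hab : G.Adj a b) :
    G.compIn s a = G.compIn s b := by
  have key : ∀ a b, a ∈ s → G.Adj a b → G.compIn s b ⊆ G.compIn s a := by
    rintro a b ha hab c ⟨p, hp⟩
    refine ⟨.cons hab p, fun w hw => ?_⟩
    rw [Walk.support_cons, List.mem_cons] at hw
    rcases hw with rfl | hw
    · exact ha
    · exact hp w hw
  exact (key b a hb hab.symm).antisymm (key a b ha hab)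

theorem compIn_support {s : Set V} {a b : V} (p : G.Walk a b) (hp : ∀ w ∈ p.support, w ∈ s) :
    ∀ w ∈ p.support, w ∈ G.compIn s a := by
  classical
  intro w hw
  exact ⟨p.takeUntil w hw, fun x hx => hp x (p.support_takeUntil_subset_support hw hx)⟩

theorem connIn_compIn (s : Set V) (a : V) : G.ConnIn (G.compIn s a) := by
  rintro b ⟨p, hp⟩ c ⟨q, hq⟩
  refine ⟨p.reverse.append q, fun w hw => ?_⟩
  rw [Walk.mem_support_append_iff, Walk.support_reverse, List.mem_reverse] at hw
  rcases hw with hw | hw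
  · exact compIn_support p hp w hw
  · exact compIn_support q hq w hw

/-- A set of large chromatic number has a component of large chromatic number. -/
theorem exists_component {s : Set V} {k : ℕ} (hs : ¬ G.Col s k) :
    ∃ c ⊆ s, G.ConnIn c ∧ (∀ a ∈ c, ∀ b ∈ s, G.Adj a b → b ∈ c) ∧ ¬ G.Col c k := by
  by_contra hcon
  push Not at hcon
  have h1 : ∀ a ∈ s, G.Col (G.compIn s a) k := fun a ha =>
    hcon _ (compIn_subset s a) (connIn_compIn s a) (fun b hb c hc => compIn_closed hb hc)
  have h2 : ∀ c : Set V, ∃ f : V → ℕ, G.Col c k → (∀ v ∈ c, f v < k) ∧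
      ∀ a ∈ c, ∀ b ∈ c, G.Adj a b → f a ≠ f b := by
    intro c
    by_cases hc : G.Col c k
    · obtain ⟨f, hf⟩ := hc; exact ⟨f, fun _ => hf⟩
    · exact ⟨fun _ => 0, fun h => absurd h hc⟩
  choose F hF using h2
  refine hs ⟨fun v => F (G.compIn s v) v, ?_, ?_⟩
  · exact fun v hv => (hF _ (h1 v hv)).1 v (mem_compIn_self hv)
  · intro a ha b hb hab
    have he := compIn_eq_of_adj ha hb hab
    simp only
    rw [← he]
    exact (hF _ (h1 a ha)).2 a (mem_compIn_self ha) b (he ▸ mem_compIn_self hb) hab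

/-- Breadth-first distance from `v` inside `s`. -/
structure IsBFS (G : SimpleGraph V) (s : Set V) (v : V) (d : V → ℕ) : Prop where
  root_mem : v ∈ s
  root : d v = 0
  eq_root : ∀ a ∈ s, d a = 0 → a = v
  lip : ∀ a ∈ s, ∀ b ∈ s, G.Adj a b → d a ≤ d b + 1
  parent : ∀ a ∈ s, d a ≠ 0 → ∃ b ∈ s, G.Adj a b ∧ d b + 1 = d a

theorem exists_isBFS {s : Set V} (hs : G.ConnIn s) {v : V} (hv : v ∈ s) :
    ∃ d, G.IsBFS s v d := by
  classical
  have hex : ∀ a, ∃ n, a ∈ s → (∃ p : G.Walk v a, (∀ w ∈ p.support, w ∈ s) ∧ p.length = n) ∧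
      ∀ p : G.Walk v a, (∀ w ∈ p.support, w ∈ s) → n ≤ p.length := by
    intro a
    by_cases ha : a ∈ s
    · obtain ⟨p, hp⟩ := hs v hv a ha
      have hex : ∃ n, ∃ p : G.Walk v a, (∀ w ∈ p.support, w ∈ s) ∧ p.length = n := ⟨_, p, hp, rfl⟩
      exact ⟨Nat.find hex, fun _ => ⟨Nat.find_spec hex, fun q hq => Nat.find_min' hex ⟨q, hq, rfl⟩⟩⟩
    · exact ⟨0, fun h => absurd h ha⟩
  choose d hd using hex
  have lip : ∀ a ∈ s, ∀ b ∈ s, G.Adj a b → d a ≤ d b + 1 := by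
    intro a ha b hb hab
    obtain ⟨⟨p, hp, hl⟩, -⟩ := hd b hb
    have := (hd a ha).2 (p.append (.cons hab.symm .nil)) (by
      intro w hw
      rw [Walk.mem_support_append_iff] at hw
      rcases hw with hw | hw
      · exact hp w hw
      · simp only [Walk.support_cons, Walk.support_nil, List.mem_cons, List.not_mem_nil,
          or_false] at hw
        rcases hw with rfl | rfl
        · exact hb
        · exact ha)
    simp at this; omega
  have zero : ∀ a ∈ s, d a = 0 → a = v := by
    intro a ha h0
    obtain ⟨⟨p, hp, hl⟩, -⟩ := hd a ha
    exact (Walk.eq_of_length_eq_zero (hl.trans h0)).symm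
  refine ⟨d, hv, ?_, zero, lip, ?_⟩
  · have := (hd v hv).2 .nil (by simpa using hv); simpa using this
  · intro a ha h0
    obtain ⟨⟨p, hp, hl⟩, -⟩ := hd a ha
    have hnn : 0 < p.reverse.length := by simp; omega
    cases hq : p.reverse with
    | nil => rw [hq] at hnn; simp at hnn
    | cons h q =>
      rename_i b
      have hqs : ∀ w ∈ q.support, w ∈ s := by
        intro w hw
        apply hp
        have : w ∈ p.reverse.support := by rw [hq]; simp [hw]
        simpa using this
      have hb : b ∈ s := hqs b (by simp)
      refine ⟨b, hb, h, ?_⟩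
      have h1 := (hd b hb).2 q.reverse (by simpa using hqs)
      have h2 := lip a ha b hb h
      have h3 : p.reverse.length = q.length + 1 := by rw [hq]; simp
      simp at h1 h3
      omega

/-- Every vertex at distance `t` has a descending path to the root. -/
theorem IsBFS.descent {s : Set V} {v : V} {d : V → ℕ} (hd : G.IsBFS s v d) {a : V} (ha : a ∈ s) :
    ∃ f : ℕ → V, f 0 = a ∧ ∀ i ≤ d a, f i ∈ s ∧ d (f i) + i = d a ∧
      (i < d a → G.Adj (f i) (f (i + 1))) := by
  have hp : ∀ b, ∃ c, b ∈ s → d b ≠ 0 → c ∈ s ∧ G.Adj b c ∧ d c + 1 = d b := by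
    intro b
    by_cases hb : b ∈ s ∧ d b ≠ 0
    · obtain ⟨c, h1, h2, h3⟩ := hd.parent b hb.1 hb.2; exact ⟨c, fun _ _ => ⟨h1, h2, h3⟩⟩
    · exact ⟨b, fun h1 h2 => absurd ⟨h1, h2⟩ hb⟩
  choose par hpar using hp
  have key : ∀ i ≤ d a, (par^[i] a) ∈ s ∧ d (par^[i] a) + i = d a := by
    intro i
    induction i with
    | zero => simp [ha]
    | succ i ih =>
      intro hi
      obtain ⟨h1, h2⟩ := ih (by omega)
      obtain ⟨h3, h4, h5⟩ := hpar _ h1 (by omega)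
      rw [Function.iterate_succ_apply']
      exact ⟨h3, by omega⟩
  refine ⟨fun i => par^[i] a, rfl, fun i hi => ⟨(key i hi).1, (key i hi).2, fun hi' => ?_⟩⟩
  simp only
  rw [Function.iterate_succ_apply']
  have := key i hi
  exact (hpar _ this.1 (by omega)).2.1

/-- Some level has at least half the chromatic number. -/
theorem exists_level {s : Set V} (d : V → ℕ) (hlip : ∀ a ∈ s, ∀ b ∈ s, G.Adj a b → d a ≤ d b + 1)
    {k : ℕ} (hs : ¬ G.Col s (2 * k)) : ∃ t, ¬ G.Col {a ∈ s | d a = t} k := by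
  by_contra hcon
  push Not at hcon
  choose f hf using hcon
  -- Edges join equal or consecutive levels, so even and odd levels can use two disjoint palettes of
  -- k colours.
  refine hs ⟨fun v => f (d v) v + k * (d v % 2), ?_, ?_⟩
  · intro v hv
    have := (hf (d v)).1 v ⟨hv, rfl⟩
    rcases Nat.mod_two_eq_zero_or_one (d v) with h | h <;> simp only [h] <;> omega
  · intro a ha b hb hab he
    simp only at he
    have h1 := hlip a ha b hb hab
    have h2 := hlip b hb a ha hab.symm
    by_cases hab' : d a = d b
    · rw [hab'] at he
      exact (hf (d b)).2 a ⟨ha, hab'⟩ b ⟨hb, rfl⟩ hab (by omega)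
    · have h3 := (hf (d a)).1 a ⟨ha, rfl⟩
      have h4 := (hf (d b)).1 b ⟨hb, rfl⟩
      rcases Nat.mod_two_eq_zero_or_one (d a) with h | h <;>
        rcases Nat.mod_two_eq_zero_or_one (d b) with h' | h' <;> simp only [h, h'] at he <;> omega

/-- The odd girth is at least `g`. -/
def OddGirthGE (G : SimpleGraph V) (g : ℕ) : Prop :=
  ∀ (v : V) (p : G.Walk v v), Odd p.length → g ≤ p.length

theorem OddGirthGE.mono {g g' : ℕ} (hg : G.OddGirthGE g) (h : g' ≤ g) : G.OddGirthGE g' :=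
  fun v p hp => h.trans (hg v p hp)

/-- End vertices of walks of length `t` from `v`. -/
def walkEnds (G : SimpleGraph V) (v : V) (t : ℕ) : Set V := {a | ∃ p : G.Walk v a, p.length = t}

/-- An edge between the ends of two walks of length `t` closes an odd walk of length 2t + 1. Hence
vertices at bounded distance from a point cost only a few colours. -/
theorem OddGirthGE.anti {g : ℕ} (hg : G.OddGirthGE g) (v : V) {t : ℕ} (ht : 2 * t + 1 < g) :
    G.Anti (G.walkEnds v t) (G.walkEnds v t) := by
  rintro a ⟨p, hp⟩ b ⟨q, hq⟩ hab
  have := hg v (p.append (.cons hab q.reverse)) (by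
    rw [Nat.odd_iff]; simp; omega)
  simp at this; omega

theorem OddGirthGE.col_walkEnds {g : ℕ} (hg : G.OddGirthGE g) (v : V) {t : ℕ} (ht : 2 * t + 1 < g) :
    G.Col (G.walkEnds v t) 1 := Col.of_anti (hg.anti v ht)

theorem IsBFS.mem_walkEnds {s : Set V} {v : V} {d : V → ℕ} (hd : G.IsBFS s v d) {a : V}
    (ha : a ∈ s) : a ∈ G.walkEnds v (d a) := by
  obtain ⟨f, h0, hf⟩ := hd.descent ha
  obtain ⟨p, hp, -⟩ := exists_walk_of_seq (G := G) (f := f) (Nat.zero_le (d a))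
    (fun i _ hi => (hf i (by omega)).2.2 hi)
  have hv : f (d a) = v := hd.eq_root _ (hf _ le_rfl).1 (by have := (hf _ le_rfl).2.1; omega)
  refine ⟨(p.reverse).copy hv h0, by simp [hp]⟩

theorem OddGirthGE.no_triangle {g : ℕ} (hg : G.OddGirthGE g) (h3 : 3 < g) {a b c : V}
    (hab : G.Adj a b) (hbc : G.Adj b c) (hca : G.Adj c a) : False := by
  have := hg a (.cons hab (.cons hbc (.cons hca .nil))) (by simp; decide)
  simp at this; omega

theorem OddGirthGE.no_pentagon {g : ℕ} (hg : G.OddGirthGE g) (h3 : 5 < g) {a b c d e : V}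
    (hab : G.Adj a b) (hbc : G.Adj b c) (hcd : G.Adj c d) (hde : G.Adj d e) (hea : G.Adj e a) :
    False := by
  have := hg a (.cons hab (.cons hbc (.cons hcd (.cons hde (.cons hea .nil))))) (by simp; decide)
  simp at this; omega

end paths

/-! ### Gluing induced paths and holes; tripods. -/

section pathops
variable {G : SimpleGraph V}

theorem IsIndPath.reverse {f : ℕ → V} {m : ℕ} (hf : G.IsIndPath f m) :
    G.IsIndPath (fun i => f (m - i)) m := by
  refine ⟨?_, ?_, ?_⟩
  · intro i j hi hj he
    have := hf.inj _ _ (by omega) (by omega) he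
    omega
  · intro i hi
    have := hf.adj (m - (i + 1)) (by omega)
    rw [show m - (i + 1) + 1 = m - i by omega] at this
    exact this.symm
  · intro i j hij hj hadj
    have := hf.ind (m - j) (m - i) (by omega) (by omega) hadj.symm
    omega

theorem IsIndPath.drop {f : ℕ → V} {m a : ℕ} (hf : G.IsIndPath f m) (ha : a ≤ m) :
    G.IsIndPath (fun i => f (a + i)) (m - a) := by
  refine ⟨?_, ?_, ?_⟩
  · intro i j hi hj he
    have := hf.inj _ _ (by omega) (by omega) he
    omega
  · intro i hi
    exact hf.adj (a + i) (by omega)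
  · intro i j hij hj hadj
    have := hf.ind (a + i) (a + j) (by omega) (by omega) hadj
    omega

/-- Prepend a vertex to a sequence. -/
def consSeq (x : V) (f : ℕ → V) (i : ℕ) : V := if i = 0 then x else f (i - 1)

@[simp] theorem consSeq_zero (x : V) (f : ℕ → V) : consSeq x f 0 = x := rfl

@[simp] theorem consSeq_succ (x : V) (f : ℕ → V) (i : ℕ) : consSeq x f (i + 1) = f i := by
  simp [consSeq]

theorem IsIndPath.cons {f : ℕ → V} {m : ℕ} (hf : G.IsIndPath f m) {x : V} (hx : G.Adj x (f 0))
    (hne : ∀ i ≤ m, x ≠ f i) (hnon : ∀ i ≤ m, 0 < i → ¬ G.Adj x (f i)) :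
    G.IsIndPath (consSeq x f) (m + 1) := by
  refine ⟨?_, ?_, ?_⟩
  · rintro (_ | i) (_ | j) hi hj he
    · rfl
    · exact absurd he (by simpa using hne j (by omega))
    · exact absurd he.symm (by simpa using hne i (by omega))
    · simp only [consSeq_succ] at he
      rw [hf.inj i j (by omega) (by omega) he]
  · rintro (_ | i) hi
    · simpa using hx
    · simpa using hf.adj i (by omega)
  · rintro (_ | i) (_ | j) hij hj hadj
    · omega
    · simp only [consSeq_zero, consSeq_succ] at hadj
      by_contra hcon
      exact hnon j (by omega) (by omega) hadj
    · omega
    · simp only [consSeq_succ] at hadj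
      rw [hf.ind i j (by omega) (by omega) hadj]

/-- Follow `f` up to `m`, then `g`. -/
def catSeq (f : ℕ → V) (m : ℕ) (g : ℕ → V) (i : ℕ) : V := if i ≤ m then f i else g (i - m)

theorem catSeq_left {f g : ℕ → V} {m i : ℕ} (hi : i ≤ m) : catSeq f m g i = f i := by
  simp [catSeq, hi]

theorem catSeq_right {f g : ℕ → V} {m i : ℕ} (hi : m ≤ i) (h : f m = g 0) :
    catSeq f m g i = g (i - m) := by
  rcases hi.eq_or_lt with rfl | hi
  · simp [catSeq, h]
  · simp [catSeq, not_le.2 hi]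

theorem catSeq_add {f g : ℕ → V} {m i : ℕ} (h : f m = g 0) : catSeq f m g (m + i) = g i := by
  rw [catSeq_right (by omega) h]; simp

theorem IsIndPath.cat {f g : ℕ → V} {m k : ℕ} (hf : G.IsIndPath f m) (hg : G.IsIndPath g k)
    (h : f m = g 0)
    (hne : ∀ i < m, ∀ j ≤ k, 0 < j → f i ≠ g j ∧ ¬ G.Adj (f i) (g j)) :
    G.IsIndPath (catSeq f m g) (m + k) := by
  have main : ∀ i j, i < j → j ≤ m + k → catSeq f m g i ≠ catSeq f m g j ∧
      (G.Adj (catSeq f m g i) (catSeq f m g j) → j = i + 1) := by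
    intro i j hij hj
    rcases le_or_gt j m with hjm | hjm
    · rw [catSeq_left hjm, catSeq_left (hij.le.trans hjm)]
      exact ⟨fun he => hij.ne (hf.inj i j (by omega) hjm he), hf.ind i j hij hjm⟩
    · rcases lt_or_ge i m with him | him
      · rw [catSeq_left him.le, catSeq_right hjm.le h]
        have := hne i him (j - m) (by omega) (by omega)
        exact ⟨this.1, fun h' => absurd h' this.2⟩
      · rw [catSeq_right him h, catSeq_right hjm.le h]
        refine ⟨fun he => ?_, fun hadj => ?_⟩
        · have := hg.inj _ _ (by omega) (by omega) he; omega
        · have := hg.ind (i - m) (j - m) (by omega) (by omega) hadj; omega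
  refine ⟨?_, ?_, fun i j hij hj => (main i j hij hj).2⟩
  · intro i j hi hj he
    rcases lt_trichotomy i j with hij | hij | hij
    · exact absurd he (main i j hij hj).1
    · exact hij
    · exact absurd he.symm (main j i hij hi).1
  · intro i hi
    rcases lt_or_ge i m with him | him
    · rw [catSeq_left him.le, catSeq_left him]; exact hf.adj i him
    · rw [catSeq_right him h, catSeq_right (by omega) h, show i + 1 - m = i - m + 1 by omega]
      exact hg.adj _ (by omega)

/-- Two induced paths with common ends and no other edges between them form a hole. -/
theorem IsHole.of_paths {f g : ℕ → V} {m k : ℕ} (hf : G.IsIndPath f m) (hg : G.IsIndPath g k)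
    (hm : 2 ≤ m) (hk : 2 ≤ k) (h : f m = g 0) (h' : g k = f 0)
    (hne : ∀ i < m, 0 < i → ∀ j < k, 0 < j → f i ≠ g j ∧ ¬ G.Adj (f i) (g j)) :
    G.IsHole (catSeq f m g) (m + k) := by
  have main : ∀ i j, i < j → j < m + k → catSeq f m g i ≠ catSeq f m g j ∧
      (G.Adj (catSeq f m g i) (catSeq f m g j) → j = i + 1 ∨ (i = 0 ∧ j = m + k - 1)) := by
    intro i j hij hj
    rcases le_or_gt j m with hjm | hjm
    · rw [catSeq_left hjm, catSeq_left (hij.le.trans hjm)]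
      exact ⟨fun he => hij.ne (hf.inj i j (by omega) hjm he), fun h => .inl (hf.ind i j hij hjm h)⟩
    · rcases lt_or_ge i m with him | him
      · rw [catSeq_left him.le, catSeq_right hjm.le h]
        rcases Nat.eq_zero_or_pos i with rfl | hi0
        · rw [← h']
          refine ⟨fun he => ?_, fun hadj => ?_⟩
          · have := hg.inj _ _ (by omega) (by omega) he; omega
          · have := hg.ind (j - m) k (by omega) (by omega) hadj.symm; omega
        · have := hne i him hi0 (j - m) (by omega) (by omega)
          exact ⟨this.1, fun h' => absurd h' this.2⟩
      · rw [catSeq_right him h, catSeq_right hjm.le h]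
        refine ⟨fun he => ?_, fun hadj => ?_⟩
        · have := hg.inj _ _ (by omega) (by omega) he; omega
        · have := hg.ind (i - m) (j - m) (by omega) (by omega) hadj; omega
  refine ⟨by omega, ?_, ?_, ?_, fun i j hij hj => (main i j hij hj).2⟩
  · intro i j hi hj he
    rcases lt_trichotomy i j with hij | hij | hij
    · exact absurd he (main i j hij hj).1
    · exact hij
    · exact absurd he.symm (main j i hij hi).1
  · intro i hi
    rcases lt_or_ge i m with him | him
    · rw [catSeq_left him.le, catSeq_left him]; exact hf.adj i him
    · rw [catSeq_right him h, catSeq_right (by omega) h, show i + 1 - m = i - m + 1 by omega]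
      exact hg.adj _ (by omega)
  · rw [catSeq_right (by omega) h, catSeq_left (Nat.zero_le _), ← h',
      show m + k - 1 - m = k - 1 by omega]
    have := hg.adj (k - 1) (by omega)
    rwa [show k - 1 + 1 = k by omega] at this

theorem IsHole.reverse {h : ℕ → V} {n : ℕ} (hh : G.IsHole h n) :
    G.IsHole (fun i => if i = 0 then h 0 else h (n - i)) n := by
  have h3 := hh.three
  have main : ∀ i j, i < j → j < n →
      (if i = 0 then h 0 else h (n - i)) ≠ (if j = 0 then h 0 else h (n - j)) ∧
      (G.Adj (if i = 0 then h 0 else h (n - i)) (if j = 0 then h 0 else h (n - j)) →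
        j = i + 1 ∨ (i = 0 ∧ j = n - 1)) := by
    intro i j hij hj
    rw [if_neg (by omega : j ≠ 0)]
    by_cases hi : i = 0
    · rw [if_pos hi]
      refine ⟨fun he => ?_, fun hadj => ?_⟩
      · have := hh.inj _ _ (by omega) (by omega) he; omega
      · have := hh.ind 0 (n - j) (by omega) (by omega) hadj; omega
    · rw [if_neg hi]
      refine ⟨fun he => ?_, fun hadj => ?_⟩
      · have := hh.inj _ _ (by omega) (by omega) he; omega
      · have := hh.ind (n - j) (n - i) (by omega) (by omega) hadj.symm; omega
  refine ⟨h3, ?_, ?_, ?_, fun i j hij hj => (main i j hij hj).2⟩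
  · intro i j hi hj he
    rcases lt_trichotomy i j with hij | hij | hij
    · exact absurd he (main i j hij hj).1
    · exact hij
    · exact absurd he.symm (main j i hij hi).1
  · intro i hi
    by_cases hi0 : i = 0
    · subst hi0; simpa using hh.close.symm
    · simp only [hi0, if_false, Nat.add_eq_zero_iff, one_ne_zero, and_false]
      have := hh.adj (n - (i + 1)) (by omega)
      rw [show n - (i + 1) + 1 = n - i by omega] at this
      exact this.symm
  · rw [if_neg (by omega), if_pos rfl, show n - (n - 1) = 1 by omega]
    exact (hh.adj 0 (by omega)).symm

/-- Rotate a hole. -/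
theorem IsHole.rotate {h : ℕ → V} {n a : ℕ} (hh : G.IsHole h n) (ha : a < n) :
    G.IsHole (fun i => if a + i < n then h (a + i) else h (a + i - n)) n := by
  have h3 := hh.three
  have main : ∀ i j, i < j → j < n →
      (if a + i < n then h (a + i) else h (a + i - n)) ≠
        (if a + j < n then h (a + j) else h (a + j - n)) ∧
      (G.Adj (if a + i < n then h (a + i) else h (a + i - n))
        (if a + j < n then h (a + j) else h (a + j - n)) → j = i + 1 ∨ (i = 0 ∧ j = n - 1)) := by
    intro i j hij hj
    by_cases h1 : a + i < n <;> by_cases h2 : a + j < n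
    · rw [if_pos h1, if_pos h2]
      refine ⟨fun he => ?_, fun hadj => ?_⟩
      · have := hh.inj _ _ (by omega) (by omega) he; omega
      · have := hh.ind (a + i) (a + j) (by omega) (by omega) hadj; omega
    · rw [if_pos h1, if_neg h2]
      refine ⟨fun he => ?_, fun hadj => ?_⟩
      · have := hh.inj _ _ (by omega) (by omega) he; omega
      · have := hh.ind (a + j - n) (a + i) (by omega) (by omega) hadj.symm; omega
    · omega
    · rw [if_neg h1, if_neg h2]
      refine ⟨fun he => ?_, fun hadj => ?_⟩
      · have := hh.inj _ _ (by omega) (by omega) he; omega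
      · have := hh.ind (a + i - n) (a + j - n) (by omega) (by omega) hadj; omega
  refine ⟨h3, ?_, ?_, ?_, fun i j hij hj => (main i j hij hj).2⟩
  · intro i j hi hj he
    rcases lt_trichotomy i j with hij | hij | hij
    · exact absurd he (main i j hij hj).1
    · exact hij
    · exact absurd he.symm (main j i hij hi).1
  · intro i hi
    by_cases h1 : a + (i + 1) < n
    · rw [if_pos h1, if_pos (by omega)]; exact hh.adj (a + i) (by omega)
    · rw [if_neg h1]
      by_cases h2 : a + i < n
      · rw [if_pos h2, show a + i = n - 1 by omega, show a + (i + 1) - n = 0 by omega]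
        exact hh.close
      · rw [if_neg h2, show a + (i + 1) - n = a + i - n + 1 by omega]
        exact hh.adj _ (by omega)
  · by_cases h1 : a = 0
    · subst h1
      rw [if_pos (by omega), if_pos (by omega)]
      simpa using hh.close
    · rw [if_neg (by omega), if_pos (by omega), show a + (n - 1) - n = a - 1 by omega]
      have := hh.adj (a - 1) (by omega)
      rwa [show a - 1 + 1 = a by omega] at this

theorem IsHole.oddGirth_le {h : ℕ → V} {n g : ℕ} (hh : G.IsHole h n) (hg : G.OddGirthGE g)
    (hn : n % 2 = 1) : g ≤ n := by
  have h3 := hh.three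
  obtain ⟨p, hp, -⟩ := exists_walk_of_seq (G := G) (f := h) (Nat.zero_le (n - 1))
    (fun i _ hi => hh.adj i (by omega))
  have := hg _ (p.append (.cons hh.close .nil)) (by rw [Nat.odd_iff]; simp [hp]; omega)
  simp [hp] at this; omega

/-- Three pairwise non-adjacent vertices, each with exactly one neighbour in a connected set `Y`:
a path between the first two and a leg from the third. -/
theorem exists_tripod {g₀ : ℕ} (hg : G.OddGirthGE g₀) (h3 : 3 < g₀) {Y : Set V} (hY : G.ConnIn Y)
    {r l : Fin 3 → V} (hl : ∀ i, l i ∈ Y) (hr : ∀ i, r i ∉ Y) (hrl : ∀ i, G.Adj (r i) (l i))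
    (hrY : ∀ i, ∀ y ∈ Y, G.Adj (r i) y → y = l i) (hrr : ∀ i j, ¬ G.Adj (r i) (r j))
    (hne : ∀ i j, i ≠ j → r i ≠ r j) :
    ∃ (f : ℕ → V) (m : ℕ) (g : ℕ → V) (k a : ℕ), G.IsIndPath f m ∧ f 0 = r 0 ∧ f m = r 1 ∧
      (∀ i < m, 0 < i → f i ∈ Y) ∧ G.IsIndPath g k ∧ g 0 = r 2 ∧ (∀ i ≤ k, 0 < i → g i ∈ Y) ∧
      (∀ i ≤ k, ∀ j ≤ m, g i ≠ f j) ∧ (∀ i < k, ∀ j ≤ m, ¬ G.Adj (g i) (f j)) ∧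
      0 < a ∧ a < m ∧ G.Adj (g k) (f a) ∧
      ∀ j ≤ m, G.Adj (g k) (f j) → 0 < j ∧ j < m ∧ (j = a ∨ j = a + 2) := by
  classical
  set Q : Set V := {x | x = r 0 ∨ x = r 1 ∨ x ∈ Y} with hQ
  have conn : ∀ i j, ∃ p : G.Walk (r i) (r j), ∀ w ∈ p.support, w = r i ∨ w = r j ∨ w ∈ Y := by
    intro i j
    obtain ⟨p, hp⟩ := hY _ (hl i) _ (hl j)
    refine ⟨.cons (hrl i) (p.append (.cons (hrl j).symm .nil)), ?_⟩
    intro w hw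
    simp only [Walk.support_cons, List.mem_cons, Walk.mem_support_append_iff, Walk.support_nil,
      List.not_mem_nil, or_false] at hw
    rcases hw with rfl | hw | rfl | rfl
    · exact .inl rfl
    · exact .inr (.inr (hp w hw))
    · exact .inr (.inr (hl j))
    · exact .inr (.inl rfl)
  obtain ⟨f, m, hf, hf0, hfm, hfQ, hfmin⟩ := exists_indPath (G := G) (Q := Q) (T := {r 1})
    (u := r 0) (by
      obtain ⟨p, hp⟩ := conn 0 1
      exact ⟨r 1, rfl, p, hp⟩)
  rw [Set.mem_singleton_iff] at hfm
  have hm0 : m ≠ 0 := by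
    rintro rfl; exact hne 0 1 (by decide) (hf0.symm.trans hfm)
  have hfY : ∀ i < m, 0 < i → f i ∈ Y := by
    intro i hi hi0
    rcases hfQ i hi.le with h | h | h
    · have := hf.inj i 0 (by omega) (by omega) (h.trans hf0.symm); omega
    · have := hf.inj i m (by omega) (by omega) (h.trans hfm.symm); omega
    · exact h
  have hr2f : ∀ i ≤ m, f i ≠ r 2 := by
    intro i hi he
    rcases hfQ i hi with h | h | h
    · exact hne 0 2 (by decide) (h.symm.trans he)
    · exact hne 1 2 (by decide) (h.symm.trans he)
    · exact hr 2 (he ▸ h)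
  have hf1 : f 1 = l 0 := by
    have hadj := hf.adj 0 (by omega)
    rw [hf0] at hadj
    rcases hfQ 1 (by omega) with h | h | h
    · exact absurd hadj (by simp [h])
    · exact absurd hadj (by simpa [h] using hrr 0 1)
    · exact hrY 0 _ h (by simpa using hadj)
  have hfm1 : f (m - 1) = l 1 := by
    have hadj := hf.adj (m - 1) (by omega)
    rw [show m - 1 + 1 = m by omega, hfm] at hadj
    rcases hfQ (m - 1) (by omega) with h | h | h
    · exact absurd hadj (by simpa [h] using hrr 0 1)
    · exact absurd hadj (by simp [h])
    · exact hrY 1 _ h hadj.symm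
  set T : Set V := {y | ∃ i ≤ m, G.Adj y (f i)} with hT
  obtain ⟨g, k, hgp, hg0, hgT, hgQ, hgmin⟩ := exists_indPath (G := G)
    (Q := {x | x = r 2 ∨ x ∈ Y}) (T := T) (u := r 2) (by
      obtain ⟨p, hp⟩ := hY _ (hl 2) _ (hl 0)
      refine ⟨l 0, ⟨0, by omega, by rw [hf0]; exact (hrl 0).symm⟩, .cons (hrl 2) p, ?_⟩
      intro w hw
      simp only [Walk.support_cons, List.mem_cons] at hw
      rcases hw with rfl | hw
      · exact .inl rfl
      · exact .inr (hp w hw))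
  have hgY : ∀ i ≤ k, 0 < i → g i ∈ Y := by
    intro i hi hi0
    rcases hgQ i hi with h | h
    · have := hgp.inj i 0 (by omega) (by omega) (h.trans hg0.symm); omega
    · exact h
  have hgnT : ∀ i < k, g i ∉ T := by
    intro i hi hiT
    obtain ⟨p, hp, hp', -⟩ := exists_walk_of_seq (G := G) (f := g) (Nat.zero_le i)
      (fun j _ hj => hgp.adj j (by omega))
    have := hgmin _ hiT (p.copy hg0 rfl) (by
      intro w hw
      rw [Walk.support_copy] at hw
      obtain ⟨j, -, hj, rfl⟩ := hp' w hw
      exact hgQ j (by omega))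
    simp [hp] at this; omega
  have hPT : ∀ j ≤ m, f j ∈ T := by
    intro j hj
    rcases Nat.lt_or_ge j m with h | h
    · exact ⟨j + 1, h, hf.adj j h⟩
    · refine ⟨j - 1, by omega, ?_⟩
      have := hf.adj (j - 1) (by omega)
      rw [show j - 1 + 1 = j by omega] at this
      exact this.symm
  have hgf : ∀ i ≤ k, ∀ j ≤ m, g i ≠ f j := by
    intro i hi j hj he
    rcases hi.lt_or_eq with hi | rfl
    · exact hgnT i hi (he ▸ hPT j hj)
    · rcases Nat.eq_zero_or_pos i with rfl | hi0
      · exact hr2f j hj (he.symm.trans hg0)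
      · refine hgnT (i - 1) (by omega) ⟨j, hj, ?_⟩
        have := hgp.adj (i - 1) (by omega)
        rwa [show i - 1 + 1 = i by omega, he] at this
  -- neighbours of the last leg vertex on the path
  have hinner : ∀ j ≤ m, G.Adj (g k) (f j) → 0 < j ∧ j < m := by
    intro j hj hadj
    have hcase : ∀ i : Fin 3, i ≠ 2 → ∀ b ≤ m, l i = f b → ¬ G.Adj (g k) (r i) := by
      intro i hi b hb hlb hadj
      rcases Nat.eq_zero_or_pos k with rfl | hk0
      · rw [hg0] at hadj; exact hrr _ _ hadj
      · have := hrY i _ (hgY k le_rfl hk0) hadj.symm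
        exact hgf k le_rfl b hb (this.trans hlb)
    constructor
    · by_contra h0
      obtain rfl : j = 0 := by omega
      rw [hf0] at hadj
      exact hcase 0 (by decide) 1 (by omega) hf1.symm hadj
    · by_contra h0
      obtain rfl : j = m := by omega
      rw [hfm] at hadj
      exact hcase 1 (by decide) (j - 1) (by omega) hfm1.symm hadj
  have hexa : ∃ j, j ≤ m ∧ G.Adj (g k) (f j) := by
    obtain ⟨j, hj, hadj⟩ := hgT; exact ⟨j, hj, hadj⟩
  obtain ⟨ham, haadj⟩ := Nat.find_spec hexa
  set a := Nat.find hexa with ha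
  obtain ⟨ha0, ham'⟩ := hinner a ham haadj
  refine ⟨f, m, g, k, a, hf, hf0, hfm, hfY, hgp, hg0, hgY, hgf,
    fun i hi j hj hadj => hgnT i hi ⟨j, hj, hadj⟩, ha0, ham', haadj, ?_⟩
  intro j hj hadj
  have haj : a ≤ j := Nat.find_min' hexa ⟨hj, hadj⟩
  obtain ⟨hj0, hjm⟩ := hinner j hj hadj
  refine ⟨hj0, hjm, ?_⟩
  -- A second neighbour of the leg's end at distance one along f makes a triangle. At distance three
  -- or more it gives a shortcut for the shortest path f. If the leg is the single vertex `r 2`, its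
  -- neighbour in Y is unique.
  by_contra hcon
  rcases (by omega : j = a + 1 ∨ a + 3 ≤ j) with rfl | h'
  · exact hg.no_triangle h3 haadj (hf.adj a (by omega)) hadj.symm
  · rcases Nat.eq_zero_or_pos k with hk | hk0
    · rw [hk, hg0] at haadj hadj
      have e1 := hrY 2 _ (hfY a (by omega) ha0) haadj
      have e2 := hrY 2 _ (hfY j (by omega) hj0) hadj
      have := hf.inj a j (by omega) (by omega) (e1.trans e2.symm)
      omega
    · obtain ⟨p, hp, hp', -⟩ := exists_walk_of_seq (G := G) (f := f) (Nat.zero_le a)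
        (fun i _ hi => hf.adj i (by omega))
      obtain ⟨q, hq, hq', -⟩ := exists_walk_of_seq (G := G) (f := f) hj
        (fun i _ hi => hf.adj i (by omega))
      have := hfmin _ rfl ((p.append (.cons haadj.symm (.cons hadj q))).copy hf0 hfm) (by
        intro w hw
        rw [Walk.support_copy] at hw
        simp only [Walk.mem_support_append_iff, Walk.support_cons, List.mem_cons] at hw
        rcases hw with hw | rfl | rfl | hw
        · obtain ⟨i, -, hi, rfl⟩ := hp' w hw; exact hfQ i (by omega)
        · exact hfQ a (by omega)
        · exact .inr (.inr (hgY k le_rfl hk0))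
        · obtain ⟨i, -, hi, rfl⟩ := hq' w hw; exact hfQ i (by omega))
      simp [hp, hq] at this
      omega

/-- Among three such vertices two are joined by an even induced path. -/
theorem exists_even_link {g₀ : ℕ} (hg : G.OddGirthGE g₀) (h3 : 3 < g₀) {Y : Set V} (hY : G.ConnIn Y)
    {r l : Fin 3 → V} (hl : ∀ i, l i ∈ Y) (hr : ∀ i, r i ∉ Y) (hrl : ∀ i, G.Adj (r i) (l i))
    (hrY : ∀ i, ∀ y ∈ Y, G.Adj (r i) y → y = l i) (hrr : ∀ i j, ¬ G.Adj (r i) (r j))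
    (hne : ∀ i j, i ≠ j → r i ≠ r j) :
    ∃ i j, i ≠ j ∧ ∃ (f : ℕ → V) (m : ℕ), G.IsIndPath f m ∧ f 0 = r i ∧ f m = r j ∧ m % 2 = 0 ∧
      ∀ b < m, 0 < b → f b ∈ Y := by
  obtain ⟨f, m, g, k, a, hf, hf0, hfm, hfY, hgp, hg0, hgY, hgf, hgn, ha0, ham, haadj, hall⟩ :=
    exists_tripod hg h3 hY hl hr hrl hrY hrr hne
  -- With a and b the first and last attachments of the leg on f, the candidate lengths are m, k + 1
  -- + a and k + 1 + (m - b). Their sum is even because b - a is 0 or 2, so one of them is even.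
  by_cases hm : m % 2 = 0
  · exact ⟨0, 1, by decide, f, m, hf, hf0, hfm, hm, hfY⟩
  -- the path from `r 2` that turns at the attachment to the start of `f`
  have turn : ∀ (f : ℕ → V) (b : ℕ), b < m → G.IsIndPath f m → (∀ i < m, 0 < i → f i ∈ Y) →
      (∀ i ≤ k, ∀ j ≤ m, g i ≠ f j) → (∀ i < k, ∀ j ≤ m, ¬ G.Adj (g i) (f j)) →
      G.Adj (g k) (f b) → (∀ j < b, ¬ G.Adj (g k) (f j)) → 0 < b →
      ∃ u, G.IsIndPath u (k + (b + 1)) ∧ u 0 = r 2 ∧ u (k + (b + 1)) = f 0 ∧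
        ∀ c < k + (b + 1), 0 < c → u c ∈ Y := by
    intro f b hb hf hfY hgf hgn hadj hnon hb0
    refine ⟨_, hgp.cat (((hf.mono hb.le).reverse).cons (x := g k) (by simpa using hadj)
      (fun i hi => hgf k le_rfl _ (by omega)) (fun i hi hi0 => hnon (b - i) (by omega)))
      (by simp) ?_, ?_, ?_, ?_⟩
    · rintro i hi (_ | j) hj hj0
      · omega
      · simp only [consSeq_succ]
        exact ⟨hgf _ (by omega) _ (by omega), hgn _ (by omega) _ (by omega)⟩
    · rw [catSeq_left (by omega), hg0]
    · rw [catSeq_add (by simp), consSeq_succ]; simp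
    · intro c hc hc0
      rcases le_or_gt c k with h | h
      · rw [catSeq_left h]; exact hgY c h hc0
      · obtain ⟨e, rfl⟩ : ∃ e, c = k + (e + 1) := ⟨c - k - 1, by omega⟩
        rw [catSeq_add (by simp), consSeq_succ]
        exact hfY _ (by omega) (by omega)
  have hexb : ∃ b, 0 < b ∧ b < m ∧ G.Adj (g k) (f b) ∧ (b - a) % 2 = 0 ∧ a ≤ b ∧
      ∀ j ≤ m, b < j → ¬ G.Adj (g k) (f j) := by
    by_cases h : a + 2 ≤ m ∧ G.Adj (g k) (f (a + 2))
    · obtain ⟨h1, h2, -⟩ := hall _ h.1 h.2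
      refine ⟨a + 2, h1, h2, h.2, by omega, by omega, fun j hj hbj hadj => ?_⟩
      have := hall j hj hadj; omega
    · refine ⟨a, ha0, ham, haadj, by omega, le_rfl, fun j hj hbj hadj => ?_⟩
      obtain ⟨-, -, h1⟩ := hall j hj hadj
      rcases h1 with rfl | rfl
      · omega
      · exact h ⟨hj, hadj⟩
  obtain ⟨b, hb0, hbm, hbadj, hab, hle, hbmax⟩ := hexb
  by_cases hk : (k + (a + 1)) % 2 = 0
  · obtain ⟨u, h1, h2, h3, h4⟩ := turn f a ham hf hfY hgf hgn haadj
      (fun j hj hadj => by have := hall j (by omega) hadj; omega) ha0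
    exact ⟨2, 0, by decide, u, _, h1, h2, h3.trans hf0, hk, h4⟩
  · obtain ⟨u, h1, h2, h3, h4⟩ := turn (fun i => f (m - i)) (m - b) (by omega) hf.reverse
      (fun i hi hi0 => hfY _ (by omega) (by omega)) (fun i hi j hj => hgf i hi _ (by omega))
      (fun i hi j hj => hgn i hi _ (by omega)) (by simpa [Nat.sub_sub_self hbm.le] using hbadj)
      (fun j hj => hbmax _ (by omega) (by omega)) (by omega)
    refine ⟨2, 1, by decide, u, _, h1, h2, ?_, by omega, h4⟩
    rw [h3]; simpa using hfm

end pathops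

/-! ### Floors below a breadth-first level, and lollipops. -/

section setting
variable {G : SimpleGraph V}

/-- The surroundings of a level `X` of a breadth-first search: the previous level `R`, a chosen
parent `l r` of every `r ∈ R`, and the remaining lower levels `Y`. -/
structure IsFloor (G : SimpleGraph V) (X R Y : Set V) (l : V → V) : Prop where
  par : ∀ x ∈ X, ∃ r ∈ R, G.Adj r x
  RX : Disjoint R X
  YX : Disjoint Y X
  YR : Disjoint Y R
  antiYX : G.Anti Y X
  antiYR : G.Anti Y R
  conn : G.ConnIn Y
  adj : ∀ r ∈ R, G.Adj r (l r)
  lX : ∀ r ∈ R, l r ∉ X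
  lR : ∀ r ∈ R, l r ∉ R
  lantiX : ∀ r ∈ R, ∀ x ∈ X, ¬ G.Adj (l r) x
  lY : ∀ r ∈ R, ∃ y ∈ Y, G.Adj y (l r)

/-- Two vertices of the parent level that are equal or interact directly. -/
def Near (G : SimpleGraph V) (l : V → V) (r r' : V) : Prop :=
  r = r' ∨ G.Adj r r' ∨ G.Adj r (l r') ∨ G.Adj r' (l r)

theorem Near.symm {l : V → V} {r r' : V} (h : G.Near l r r') : G.Near l r' r := by
  rcases h with h | h | h | h
  · exact .inl h.symm
  · exact .inr (.inl h.symm)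
  · exact .inr (.inr (.inr h))
  · exact .inr (.inr (.inl h))

variable {X R Y : Set V} {l : V → V}

/-- The children of vertices near `r` end walks of length 1, 2 or 3 starting at `r`. At odd girth 9
the ends of each length form a stable set. -/
theorem IsFloor.col_near (hX : G.IsFloor X R Y l) (hg : G.OddGirthGE 9) {r : V} (hr : r ∈ R) :
    G.Col (G.nbrs {r' ∈ R | G.Near l r r'}) 3 := by
  refine (((hg.col_walkEnds r (t := 1) (by norm_num)).union
    (hg.col_walkEnds r (t := 2) (by norm_num))).union
    (hg.col_walkEnds r (t := 3) (by norm_num))).mono ?_ le_rfl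
  rintro x ⟨r', ⟨hr', h | h | h | h⟩, hx⟩
  · subst h; exact .inl (.inl ⟨.cons hx .nil, rfl⟩)
  · exact .inl (.inr ⟨.cons h (.cons hx .nil), rfl⟩)
  · exact .inr ⟨.cons h (.cons (hX.adj r' hr').symm (.cons hx .nil)), rfl⟩
  · exact .inr ⟨.cons (hX.adj r hr) (.cons h.symm (.cons hx .nil)), rfl⟩

/-- Three pairwise far parents satisfy the assumptions on tripods. -/
theorem IsFloor.three (hX : G.IsFloor X R Y l) {r : Fin 3 → V} (hr : ∀ i, r i ∈ R)
    (hfar : ∀ i j, i ≠ j → ¬ G.Near l (r i) (r j)) :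
    G.ConnIn (Y ∪ {y | ∃ i, y = l (r i)}) ∧ (∀ i, l (r i) ∈ Y ∪ {y | ∃ i, y = l (r i)}) ∧
    (∀ i, r i ∉ Y ∪ {y | ∃ i, y = l (r i)}) ∧
    (∀ i, ∀ y ∈ Y ∪ {y | ∃ i, y = l (r i)}, G.Adj (r i) y → y = l (r i)) ∧
    (∀ i j, ¬ G.Adj (r i) (r j)) ∧ (∀ i j, i ≠ j → r i ≠ r j) := by
  refine ⟨?_, fun i => .inr ⟨i, rfl⟩, ?_, ?_, ?_, ?_⟩
  · refine hX.conn.attach ?_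
    rintro a ⟨i, rfl⟩
    exact hX.lY _ (hr i)
  · rintro i (h | ⟨j, h⟩)
    · exact Set.disjoint_left.1 hX.YR h (hr i)
    · exact hX.lR _ (hr j) (h ▸ hr i)
  · rintro i y (h | ⟨j, rfl⟩) hadj
    · exact absurd hadj.symm (hX.antiYR y h _ (hr i))
    · by_cases hij : i = j
      · rw [hij]
      · exact absurd (.inr (.inr (.inl hadj))) (hfar i j hij)
  · intro i j hadj
    by_cases hij : i = j
    · subst hij; exact hadj.ne rfl
    · exact hfar i j hij (.inr (.inl hadj))
  · exact fun i j hij h => hfar i j hij (.inl h)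

/-- The segment lemma for a floor. -/
theorem IsFloor.col_of_segment (hX : G.IsFloor X R Y l) (hG : G.TPerfect) (hg : G.OddGirthGE 9)
    {h : ℕ → V} {n m : ℕ} (hh : G.IsHole h n) (hn : n % 2 = 1) (hm : m + 2 ≤ n) {R' F : Set V}
    (hR' : R' ⊆ R) (hFX : F ⊆ X) (hF : ∀ i ≤ m, ∀ x ∈ F, ¬ G.Adj (h i) x) (hFf : ∀ i ≤ m, h i ∉ F)
    (hgood : ∀ i < n, h i ∈ X ∨ (h i ∈ R ∧ ∀ r ∈ R', ¬ G.Near l (h i) r))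
    (hit : ∀ r ∈ R', ∃ i ≤ m, G.Adj r (h i)) : G.Col (F ∩ G.nbrs R') 36 := by
  have hnot : ∀ i < n, h i ∉ R' := by
    intro i hi hiR
    rcases hgood i hi with h1 | h1
    · exact Set.disjoint_left.1 hX.RX (hR' hiR) h1
    · exact h1.2 _ hiR (.inl rfl)
  -- Linked means lying on the same side D of a hub made of the two vertices, Y and chosen parents
  -- of R'. The hole lies in X apart from vertices of R far from R', so the opposite side A has no
  -- neighbour on it. Among three far vertices such a hub comes from an even path of a tripod.
  refine (hG.col_of_segment hh hn hm hF hFf (hX.RX.mono hR' hFX) hnot hit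
    (fun r r' => ∃ A D, G.IsHub A D ∧ r ∈ D ∧ r' ∈ D ∧ r ∈ R' ∧ r' ∈ R' ∧
      ∀ x ∈ A ∪ D, x = r ∨ x = r' ∨ x ∈ Y ∨ ∃ s ∈ R', x = l s) (G.Near l) ?_ ?_ (κ := 3) ?_).mono
      le_rfl (by norm_num)
  · rintro r hr r' hr' ⟨A, D, hub, hrD, hrD', -, -, hsub⟩
    refine ⟨A, D, hub, hrD, hrD', ?_, ?_⟩
    · intro i hi hmem
      rcases hsub _ hmem with h1 | h1 | h1 | ⟨s, hs, h1⟩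
      · exact hnot i hi (h1 ▸ hr)
      · exact hnot i hi (h1 ▸ hr')
      · rcases hgood i hi with h2 | h2
        · exact Set.disjoint_left.1 hX.YX h1 h2
        · exact Set.disjoint_left.1 hX.YR h1 h2.1
      · rcases hgood i hi with h2 | h2
        · exact hX.lX s (hR' hs) (h1 ▸ h2)
        · exact hX.lR s (hR' hs) (h1 ▸ h2.1)
    · intro i hi x hx hadj
      rcases hsub x (.inl hx) with h1 | h1 | h1 | ⟨s, hs, h1⟩
      · exact Set.disjoint_left.1 hub.disj hx (h1 ▸ hrD)
      · exact Set.disjoint_left.1 hub.disj hx (h1 ▸ hrD')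
      · rcases hgood i hi with h2 | h2
        · exact hX.antiYX x h1 _ h2 hadj
        · exact hX.antiYR x h1 _ h2.1 hadj
      · subst h1
        rcases hgood i hi with h2 | h2
        · exact hX.lantiX s (hR' hs) _ h2 hadj
        · exact h2.2 s hs (.inr (.inr (.inl hadj.symm)))
  · intro r₁ h₁ r₂ h₂ r₃ h₃ n12 n13 n23
    have hr : ∀ i : Fin 3, (![r₁, r₂, r₃] : Fin 3 → V) i ∈ R' := by
      intro i; fin_cases i <;> simpa
    obtain ⟨c1, c2, c3, c4, c5, c6⟩ := hX.three (r := ![r₁, r₂, r₃]) (fun i => hR' (hr i)) (by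
      intro i j hij
      fin_cases i <;> fin_cases j <;> simp at hij ⊢
      · exact n12
      · exact n13
      · exact fun h => n12 h.symm
      · exact n23
      · exact fun h => n13 h.symm
      · exact fun h => n23 h.symm)
    obtain ⟨i, j, hij, f, k, hf, hf0, hfk, hk, hfY⟩ := exists_even_link hg (by norm_num) c1 c2 c3
      (fun i => hX.adj _ (hR' (hr i))) c4 c5 c6
    set r : Fin 3 → V := ![r₁, r₂, r₃] with hrdef
    have main : ∃ A D, G.IsHub A D ∧ r i ∈ D ∧ r j ∈ D ∧
        ∀ x ∈ A ∪ D, x = r i ∨ x = r j ∨ x ∈ Y ∨ ∃ s ∈ R', x = l s := by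
      have h0 := hf.hub 0
      refine ⟨_, _, h0, ?_, ?_, ?_⟩
      · exact ⟨0, by omega, by omega, hf0.symm⟩
      · exact ⟨k, le_rfl, hk, hfk.symm⟩
      intro x hx
      have : ∃ b ≤ k, x = f b := by
        rcases hx with ⟨b, hb, -, rfl⟩ | ⟨b, hb, -, rfl⟩ <;> exact ⟨b, hb, rfl⟩
      obtain ⟨b, hb, rfl⟩ := this
      rcases Nat.eq_zero_or_pos b with rfl | hb0
      · exact .inl hf0
      rcases hb.eq_or_lt with rfl | hb
      · exact .inr (.inl hfk)
      rcases hfY b hb hb0 with h1 | ⟨i, h1⟩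
      · exact .inr (.inr (.inl h1))
      · exact .inr (.inr (.inr ⟨r i, hr i, h1⟩))
    obtain ⟨A, D, hub, hiD, hjD, hsub⟩ := main
    have e0 : r 0 = r₁ := rfl
    have e1 : r 1 = r₂ := rfl
    have e2 : r 2 = r₃ := rfl
    have hsub' : ∀ x ∈ A ∪ D, x = r j ∨ x = r i ∨ x ∈ Y ∨ ∃ s ∈ R', x = l s := fun x hx => by
      have := hsub x hx; tauto
    fin_cases i <;> fin_cases j
    · exact absurd rfl hij
    · exact .inl ⟨A, D, hub, hiD, hjD, h₁, h₂, hsub⟩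
    · exact .inr (.inl ⟨A, D, hub, hiD, hjD, h₁, h₃, hsub⟩)
    · exact .inl ⟨A, D, hub, hjD, hiD, h₁, h₂, hsub'⟩
    · exact absurd rfl hij
    · exact .inr (.inr ⟨A, D, hub, hiD, hjD, h₂, h₃, hsub⟩)
    · exact .inr (.inl ⟨A, D, hub, hjD, hiD, h₁, h₃, hsub'⟩)
    · exact .inr (.inr ⟨A, D, hub, hjD, hiD, h₂, h₃, hsub'⟩)
    · exact absurd rfl hij
  · intro r hr
    refine (hX.col_near hg (hR' hr)).mono ?_ le_rfl
    rintro x ⟨-, r', h', hx⟩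
    exact ⟨r', ⟨hR' h'.1, h'.2⟩, hx⟩

/-- A path `z 0, …, z m` ending on an odd hole `g` at `g 0`, and a connected set `B` attached to
the hole at `g q` only. -/
structure IsLolli (G : SimpleGraph V) (z : ℕ → V) (m : ℕ) (g : ℕ → V) (n q : ℕ) (B : Set V) :
    Prop where
  path : G.IsIndPath z m
  hole : G.IsHole g n
  odd : n % 2 = 1
  join : z m = g 0
  cross : ∀ i < m, ∀ j < n, z i ≠ g j ∧ (G.Adj (z i) (g j) → i + 1 = m ∧ j = 0)
  six_le : 6 ≤ q
  le_sub : q + 2 ≤ n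
  even : q % 2 = 0
  conn : G.ConnIn B
  zB : ∀ i ≤ m, z i ∉ B
  gB : ∀ j < n, g j ∉ B
  antiz : ∀ i ≤ m, ∀ x ∈ B, ¬ G.Adj (z i) x
  antig : ∀ j < n, j ≠ q → ∀ x ∈ B, ¬ G.Adj (g j) x
  att : ∃ x ∈ B, G.Adj (g q) x

/-- The two sides of the hole. -/
theorem IsLolli.side {z g : ℕ → V} {m n q : ℕ} {B : Set V} (hL : G.IsLolli z m g n q B) (e : ℕ) :
    ∃ (w : ℕ → V) (k : ℕ), G.IsIndPath w k ∧ w 0 = g 0 ∧ w k = g q ∧ k % 2 = e % 2 ∧ 3 ≤ k ∧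
      (∀ i ≤ k, ∃ j < n, w i = g j) ∧ (∀ i < k, 0 < i → ∃ j < n, j ≠ q ∧ j ≠ 0 ∧ w i = g j) := by
  have h1 := hL.six_le
  have h2 := hL.le_sub
  have h3 := hL.odd
  have h4 := hL.even
  -- As n is odd and q is even, the two sides have lengths q and n - q of different parity.
  by_cases he : e % 2 = 0
  · exact ⟨g, q, hL.hole.indPath h2, rfl, rfl, by omega, by omega, fun i hi => ⟨i, by omega, rfl⟩,
      fun i hi hi0 => ⟨i, by omega, by omega, by omega, rfl⟩⟩
  · refine ⟨_, n - q, hL.hole.reverse.indPath (by omega), by simp, ?_, by omega, by omega, ?_, ?_⟩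
    · rw [if_neg (by omega), show n - (n - q) = q by omega]
    · intro i hi
      by_cases hi0 : i = 0
      · exact ⟨0, by omega, by simp [hi0]⟩
      · exact ⟨n - i, by omega, if_neg hi0⟩
    · intro i hi hi0
      exact ⟨n - i, by omega, by omega, by omega, if_neg (by omega)⟩

/-- Induced paths of both parities through a lollipop. -/
theorem IsLolli.route {z g : ℕ → V} {m n q : ℕ} {B : Set V} (hL : G.IsLolli z m g n q B) (e : ℕ) :
    ∃ (w : ℕ → V) (k : ℕ), G.IsIndPath w (m + k) ∧ (∀ i ≤ m, w i = z i) ∧ w (m + k) = g q ∧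
      k % 2 = e % 2 ∧ 3 ≤ k ∧ (∀ i ≤ m + k, (∃ j ≤ m, w i = z j) ∨ ∃ j < n, w i = g j) ∧
      (∀ i < m + k, (∃ j ≤ m, w i = z j) ∨ ∃ j < n, j ≠ q ∧ w i = g j) := by
  obtain ⟨w, k, hw, hw0, hwk, hke, hk2, hwm, hwi⟩ := hL.side e
  have hj : z m = w 0 := hL.join.trans hw0.symm
  refine ⟨catSeq z m w, k, hL.path.cat hw hj ?_, fun i hi => catSeq_left hi, ?_, hke, hk2, ?_, ?_⟩
  · intro i hi j hjk hj0
    have : ∃ b < n, b ≠ 0 ∧ w j = g b := by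
      rcases hjk.lt_or_eq with h | rfl
      · obtain ⟨b, hb, -, h0, hb'⟩ := hwi j h hj0; exact ⟨b, hb, h0, hb'⟩
      · exact ⟨q, by have := hL.le_sub; omega, by have := hL.six_le; omega, hwk⟩
    obtain ⟨b, hb, hb0, hb'⟩ := this
    rw [hb']
    exact ⟨(hL.cross i hi b hb).1, fun hadj => hb0 ((hL.cross i hi b hb).2 hadj).2⟩
  · rw [catSeq_add hj, hwk]
  · intro i hi
    rcases le_or_gt i m with h | h
    · exact .inl ⟨i, h, catSeq_left h⟩
    · rw [catSeq_right h.le hj]; exact .inr (hwm _ (by omega))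
  · intro i hi
    rcases le_or_gt i m with h | h
    · exact .inl ⟨i, h, catSeq_left h⟩
    · rw [catSeq_right h.le hj]
      obtain ⟨b, hb, hq, -, hb'⟩ := hwi (i - m) (by omega) (by omega)
      exact .inr ⟨b, hb, hq, hb'⟩

/-- All but few vertices above a lollipop have their parents off the lollipop. -/
theorem IsFloor.col_lolli (hX : G.IsFloor X R Y l) (hG : G.TPerfect) (hg9 : G.OddGirthGE 9)
    {z g : ℕ → V} {m n q : ℕ} {B : Set V} (hL : G.IsLolli z m g n q B) {R' : Set V} (hR' : R' ⊆ R)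
    (hBX : B ⊆ X) (hz : ∀ i ≤ m, z i ∈ X ∨ (z i ∈ R ∧ ∀ r ∈ R', ¬ G.Near l (z i) r))
    (hgX : ∀ j < n, g j ∈ X ∨ (g j ∈ R ∧ ∀ r ∈ R', ¬ G.Near l (g j) r))
    (hit : ∀ r ∈ R', (∃ i ≤ m, G.Adj r (z i)) ∨ ∃ j < n, G.Adj r (g j)) :
    G.Col (B ∩ G.nbrs R') 76 := by
  classical
  have h1 := hL.six_le
  have h2 := hL.le_sub
  have h3 := hL.odd
  have h4 := hL.even
  -- Children of neighbours of `g q` end walks of length 2 from `g q`.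
  have c1 : G.Col (B ∩ G.nbrs {r ∈ R' | G.Adj r (g q)}) 1 := by
    refine (hg9.col_walkEnds (g q) (t := 2) (by norm_num)).mono ?_ le_rfl
    rintro x ⟨-, r, hr, hx⟩
    exact ⟨.cons hr.2.symm (.cons hx .nil), rfl⟩
  -- Rotated to begin right after `g q`, the hole minus `g q` is a segment with no neighbour in B,
  -- so the segment lemma applies.
  have c2 : G.Col (B ∩ G.nbrs {r ∈ R' | ∃ j < n, j ≠ q ∧ G.Adj r (g j)}) 36 := by
    have hrot : ∀ i ≤ n - 2, ∃ j < n, j ≠ q ∧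
        (if q + 1 + i < n then g (q + 1 + i) else g (q + 1 + i - n)) = g j := by
      intro i hi
      by_cases h : q + 1 + i < n
      · rw [if_pos h]; exact ⟨_, h, by omega, rfl⟩
      · rw [if_neg h]; exact ⟨_, by omega, by omega, rfl⟩
    refine hX.col_of_segment hG hg9 (hL.hole.rotate (a := q + 1) (by omega)) hL.odd
      (m := n - 2) (by omega) (fun r hr => hR' hr.1) hBX ?_ ?_ ?_ ?_
    · intro i hi x hx
      obtain ⟨j, hj, hjq, he⟩ := hrot i hi
      simp only [he]
      exact hL.antig j hj hjq x hx
    · intro i hi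
      obtain ⟨j, hj, hjq, he⟩ := hrot i hi
      simp only [he]
      exact hL.gB j hj
    · intro i hi
      have : ∃ j < n, (if q + 1 + i < n then g (q + 1 + i) else g (q + 1 + i - n)) = g j := by
        by_cases h : q + 1 + i < n
        · rw [if_pos h]; exact ⟨_, h, rfl⟩
        · rw [if_neg h]; exact ⟨_, by omega, rfl⟩
      obtain ⟨j, hj, he⟩ := this
      simp only [he]
      rcases hgX j hj with h | h
      · exact .inl h
      · exact .inr ⟨h.1, fun r hr => h.2 r hr.1⟩
    · rintro r ⟨hr, j, hj, hjq, hadj⟩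
      by_cases h : j < q
      · refine ⟨n + j - (q + 1), by omega, ?_⟩
        rw [if_neg (by omega), show q + 1 + (n + j - (q + 1)) - n = j by omega]
        exact hadj
      · refine ⟨j - (q + 1), by omega, ?_⟩
        rw [if_pos (by omega), show q + 1 + (j - (q + 1)) = j by omega]
        exact hadj
  -- The remaining relevant parents see the path z but not the hole, and they see B. The path is
  -- completed to an odd hole through one of them.
  set Q := {r ∈ R' | (∀ j < n, ¬ G.Adj r (g j)) ∧ ∃ x ∈ B, G.Adj r x} with hQ
  have c3 : G.Col (B ∩ G.nbrs Q) 39 := by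
    by_cases hQn : Q.Nonempty
    swap
    · rw [Set.not_nonempty_iff_eq_empty] at hQn
      rw [hQn]
      refine (col_empty _).mono ?_ le_rfl
      rintro x ⟨-, a, ha, -⟩; exact ha.elim
    have hlast : ∀ r, ∃ b, r ∈ Q → b < m ∧ G.Adj r (z b) ∧ ∀ i ≤ m, b < i → ¬ G.Adj r (z i) := by
      intro r
      by_cases hr : r ∈ Q
      · have hz' : ∃ i ≤ m, G.Adj r (z i) := by
          rcases hit r hr.1 with h | ⟨j, hj, h⟩
          · exact h
          · exact absurd h (hr.2.1 j hj)
        obtain ⟨i, hi, hadj⟩ := hz'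
        refine ⟨Nat.findGreatest (fun i => G.Adj r (z i)) m, fun _ => ?_⟩
        have hs := Nat.findGreatest_spec (P := fun i => G.Adj r (z i)) hi hadj
        have hle := Nat.findGreatest_le (P := fun i => G.Adj r (z i)) m
        refine ⟨lt_of_le_of_ne hle ?_, hs, fun j hj hbj => Nat.findGreatest_is_greatest hbj hj⟩
        intro he
        rw [he, hL.join] at hs
        exact hr.2.1 0 (by omega) hs
      · exact ⟨0, fun h => absurd h hr⟩
    choose b hb using hlast
    -- With `b r` the last contact of r on z, minimality of `b ra` ensures that every member of Q
    -- sees the segment of z from `b ra` to m.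
    obtain ⟨ra, hra, hmin⟩ := exists_min_of_nonempty hQn b
    obtain ⟨hbm, hbadj, hbl⟩ := hb ra hra
    have near3 : G.Col (B ∩ G.nbrs {r ∈ Q | G.Near l ra r}) 3 :=
      (hX.col_near hg9 (hR' hra.1)).mono
        (fun x ⟨_, r, hr, hx⟩ => ⟨r, ⟨hR' hr.1.1, hr.2⟩, hx⟩) le_rfl
    have far36 : G.Col (B ∩ G.nbrs {r ∈ Q | ¬ G.Near l ra r}) 36 := by
      -- vertices of the lollipop are not `ra`
      have hraB : ra ∉ B := fun h => Set.disjoint_left.1 hX.RX (hR' hra.1) (hBX h)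
      have hneg : ∀ v, v ∈ X ∨ (v ∈ R ∧ ∀ r ∈ R', ¬ G.Near l v r) → v ≠ ra := by
        rintro v (h | h) rfl
        · exact Set.disjoint_left.1 hX.RX (hR' hra.1) h
        · exact h.2 _ hra.1 (.inl rfl)
      -- closing path
      obtain ⟨u, k, hu, hu0, huk, huQ, -⟩ := exists_indPath (G := G)
        (Q := {x | x = g q ∨ x ∈ B ∨ x = ra}) (T := {ra}) (u := g q) (by
          obtain ⟨x, hx, hax⟩ := hL.att
          obtain ⟨y, hy, hay⟩ := hra.2.2
          obtain ⟨p, hp⟩ := hL.conn x hx y hy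
          refine ⟨ra, rfl, .cons hax (p.append (.cons hay.symm .nil)), ?_⟩
          intro w hw
          simp only [Walk.support_cons, List.mem_cons, Walk.mem_support_append_iff,
            Walk.support_nil, List.not_mem_nil, or_false] at hw
          rcases hw with rfl | hw | rfl | rfl
          · exact .inl rfl
          · exact .inr (.inl (hp w hw))
          · exact .inr (.inl hy)
          · exact .inr (.inr rfl))
      rw [Set.mem_singleton_iff] at huk
      have hgq : g q ≠ ra := hneg _ (hgX q (by omega))
      have hk2 : 2 ≤ k := by
        rcases (by omega : k = 0 ∨ k = 1 ∨ 2 ≤ k) with h | h | h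
        · subst h; exact absurd (hu0.symm.trans huk) hgq
        · subst h
          have := hu.adj 0 (by omega)
          rw [hu0, huk] at this
          exact absurd this.symm (hra.2.1 q (by omega))
        · exact h
      have huB : ∀ i < k, 0 < i → u i ∈ B := by
        intro i hi hi0
        rcases huQ i hi.le with h | h | h
        · have := hu.inj i 0 (by omega) (by omega) (h.trans hu0.symm); omega
        · exact h
        · have := hu.inj i k (by omega) (by omega) (h.trans huk.symm); omega
      -- The closing hole has length m + s - b ra + 1 + k. The side of g is chosen with s ≡ m + b ra
      -- + k modulo 2, which makes it odd.
      obtain ⟨w, s, hw, hwz, hws, hse, hs2, hwm, hwi⟩ := hL.route (m + b ra + k)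
      -- the path from `ra` along the lollipop
      have hlen : b ra ≤ m + s := by omega
      have hp1 := hw.drop hlen
      have hp2 := hp1.cons (x := ra) (by simpa [hwz (b ra) hbm.le] using hbadj)
        (by
          intro i hi
          rcases hwm (b ra + i) (by omega) with ⟨j, hj, he⟩ | ⟨j, hj, he⟩
          · simp only [he]; exact (hneg _ (hz j hj)).symm
          · simp only [he]; exact (hneg _ (hgX j hj)).symm)
        (by
          intro i hi hi0
          rcases le_or_gt (b ra + i) m with h | h
          · simp only [hwz _ h]; exact hbl _ h (by omega)
          · rcases hwm (b ra + i) (by omega) with ⟨j, hj, he⟩ | ⟨j, hj, he⟩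
            · have := hw.inj _ j (by omega) (by omega) (he.trans (hwz j hj).symm); omega
            · simp only [he]; exact hra.2.1 j hj)
      have hhole := IsHole.of_paths hp2 hu (by omega) hk2
        (by rw [consSeq_succ, hu0, ← hws]; congr 1; omega) (by rw [consSeq_zero, huk]) (by
          rintro (_ | i) hi hi0 j hj hj0
          · omega
          rw [consSeq_succ]
          have hx := huB j hj hj0
          rcases hwi (b ra + i) (by omega) with ⟨c, hc, he⟩ | ⟨c, hc, hcq, he⟩
          · simp only [he]
            exact ⟨fun h => hL.zB c hc (h ▸ hx), hL.antiz c hc _ hx⟩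
          · simp only [he]
            exact ⟨fun h => hL.gB c hc (h ▸ hx), hL.antig c hc hcq _ hx⟩)
      -- Position 0 is ra itself; after rotation by one the hole begins with `z (b ra), …, z m`.
      have hrot := hhole.rotate (a := 1) (by omega)
      set N := m + s - b ra + 1 + k with hN
      have hval : ∀ i, i ≤ m - b ra → (if 1 + i < N then
          catSeq (consSeq ra fun i => w (b ra + i)) (m + s - b ra + 1) u (1 + i) else
          catSeq (consSeq ra fun i => w (b ra + i)) (m + s - b ra + 1) u (1 + i - N)) =
          z (b ra + i) := by
        intro i hi
        rw [if_pos (by omega), catSeq_left (by omega), Nat.add_comm 1 i, consSeq_succ]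
        exact hwz _ (by omega)
      refine hX.col_of_segment hG hg9 hrot (by omega) (m := m - b ra) (by omega)
        (fun r hr => hR' hr.1.1) hBX ?_ ?_ ?_ ?_
      · intro i hi x hx
        simp only [hval i hi]
        exact hL.antiz _ (by omega) x hx
      · intro i hi
        simp only [hval i hi]
        exact hL.zB _ (by omega)
      · have good : ∀ i < N, catSeq (consSeq ra fun i => w (b ra + i)) (m + s - b ra + 1) u i ∈ X ∨
            (catSeq (consSeq ra fun i => w (b ra + i)) (m + s - b ra + 1) u i ∈ R ∧
              ∀ r ∈ {r ∈ Q | ¬ G.Near l ra r}, ¬ G.Near l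
                (catSeq (consSeq ra fun i => w (b ra + i)) (m + s - b ra + 1) u i) r) := by
          intro i hi
          rcases le_or_gt i (m + s - b ra + 1) with h | h
          · rw [catSeq_left h]
            rcases i with _ | i
            · rw [consSeq_zero]; exact .inr ⟨hR' hra.1, fun r hr => hr.2⟩
            · rw [consSeq_succ]
              rcases hwm (b ra + i) (by omega) with ⟨j, hj, he⟩ | ⟨j, hj, he⟩
              · rw [he]
                exact (hz j hj).imp_right fun h => ⟨h.1, fun r hr => h.2 r hr.1.1⟩
              · rw [he]
                exact (hgX j hj).imp_right fun h => ⟨h.1, fun r hr => h.2 r hr.1.1⟩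
          · rw [catSeq, if_neg (by omega)]
            exact .inl (hBX (huB _ (by omega) (by omega)))
        intro i hi
        by_cases h : 1 + i < N
        · simp only [h, if_true]; exact good _ h
        · simp only [h, if_false]; exact good _ (by omega)
      · rintro r ⟨hr, hrn⟩
        obtain ⟨k1, k2, k3⟩ := hb r hr
        have := hmin r hr
        refine ⟨b r - b ra, by omega, ?_⟩
        simp only [hval (b r - b ra) (by omega)]
        rwa [show b ra + (b r - b ra) = b r by omega]
    refine (near3.union far36).mono ?_ (by norm_num)
    rintro x ⟨hx, r, hr, hrx⟩
    by_cases h : G.Near l ra r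
    · exact .inl ⟨hx, r, ⟨hr, h⟩, hrx⟩
    · exact .inr ⟨hx, r, ⟨hr, h⟩, hrx⟩
  refine ((c1.union c2).union c3).mono ?_ (by norm_num)
  rintro x ⟨hx, r, hr, hrx⟩
  by_cases hq : G.Adj r (g q)
  · exact .inl (.inl ⟨hx, r, ⟨hr, hq⟩, hrx⟩)
  by_cases hj : ∃ j < n, j ≠ q ∧ G.Adj r (g j)
  · exact .inl (.inr ⟨hx, r, ⟨hr, hj⟩, hrx⟩)
  · refine .inr ⟨hx, r, ⟨hr, ?_, x, hx, hrx⟩, hrx⟩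
    intro j hj' hadj
    by_cases he : j = q
    · exact hq (he ▸ hadj)
    · exact hj ⟨j, hj', he, hadj⟩

end setting

/-! ### Stems and their completion to lollipops. -/

section gadget
variable {G : SimpleGraph V}

/-- A path `z 0, …, z m` ending on an odd hole `g` at `g 0`. -/
structure IsStem (G : SimpleGraph V) (z : ℕ → V) (m : ℕ) (g : ℕ → V) (n : ℕ) : Prop where
  path : G.IsIndPath z m
  hole : G.IsHole g n
  odd : n % 2 = 1
  join : z m = g 0
  cross : ∀ i < m, ∀ j < n, z i ≠ g j ∧ (G.Adj (z i) (g j) → i + 1 = m ∧ j = 0)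

/-- The two sides of the odd hole have lengths of different parity, so reversing the hole if
necessary makes `q` even. The margins of 5 on both sides then give the required 6. -/
theorem IsStem.exists_lolli {z g : ℕ → V} {m n q : ℕ} {B : Set V} (h : G.IsStem z m g n)
    (hq2 : 5 ≤ q) (hqn : q + 5 ≤ n) (conn : G.ConnIn B) (zB : ∀ i ≤ m, z i ∉ B)
    (gB : ∀ j < n, g j ∉ B) (antiz : ∀ i ≤ m, ∀ x ∈ B, ¬ G.Adj (z i) x)
    (antig : ∀ j < n, j ≠ q → ∀ x ∈ B, ¬ G.Adj (g j) x) (att : ∃ x ∈ B, G.Adj (g q) x) :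
    ∃ g' q', G.IsLolli z m g' n q' B ∧ ∀ j < n, ∃ j' < n, g' j = g j' := by
  have ho := h.odd
  by_cases hq : q % 2 = 0
  · exact ⟨g, q, ⟨h.path, h.hole, h.odd, h.join, h.cross, by omega, by omega, hq, conn, zB, gB, antiz, antig,
      att⟩, fun j hj => ⟨j, hj, rfl⟩⟩
  set g' : ℕ → V := fun i => if i = 0 then g 0 else g (n - i) with hg'
  have val : ∀ j < n, ∃ j' < n, g' j = g j' ∧ (j' = 0 → j = 0) ∧ (j' = q → j = n - q) := by
    intro j hj
    by_cases h0 : j = 0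
    · exact ⟨0, by omega, by simp [hg', h0], fun _ => h0, by omega⟩
    · exact ⟨n - j, by omega, by simp [hg', h0], by omega, by omega⟩
  have hgq : g' (n - q) = g q := by
    rw [hg']
    simp only
    rw [if_neg (by omega), show n - (n - q) = q by omega]
  refine ⟨g', n - q, ⟨h.path, h.hole.reverse, h.odd, by simpa [hg'] using h.join, ?_, by omega,
    by omega, by omega, conn, zB, ?_, antiz, ?_, by rwa [hgq]⟩, ?_⟩
  · intro i hi j hj
    obtain ⟨j', hj', e, h0, -⟩ := val j hj
    rw [e]
    exact ⟨(h.cross i hi j' hj').1, fun ha => ((h.cross i hi j' hj').2 ha).imp_right h0⟩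
  · intro j hj
    obtain ⟨j', hj', e, -⟩ := val j hj
    rw [e]; exact gB j' hj'
  · intro j hj hjq
    obtain ⟨j', hj', e, -, hq'⟩ := val j hj
    rw [e]; exact antig j' hj' fun h => hjq (hq' h)
  · intro j hj
    obtain ⟨j', hj', e, -⟩ := val j hj
    exact ⟨j', hj', e⟩

theorem IsHole.replace {g : ℕ → V} {n e : ℕ} (hh : G.IsHole g n) (he : 1 ≤ e) (hen : e + 1 < n)
    {u : V} (hu : ∀ j < n, u ≠ g j) (hadj : G.Adj u (g (e - 1))) (hadj' : G.Adj u (g (e + 1)))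
    (hon : ∀ j < n, G.Adj u (g j) → j = e - 1 ∨ j = e ∨ j = e + 1) :
    G.IsHole (fun j => if j = e then u else g j) n := by
  refine ⟨hh.three, ?_, ?_, ?_, ?_⟩
  · intro i j hi hj h
    split_ifs at h with h1 h2 h2
    · omega
    · exact absurd h (hu j hj)
    · exact absurd h.symm (hu i hi)
    · exact hh.inj i j hi hj h
  · intro i hi
    split_ifs with h1 h2 h2
    · omega
    · subst h1; exact hadj'
    · subst h2; exact hadj.symm
    · exact hh.adj i hi
  · rw [if_neg (by omega), if_neg (by omega)]
    exact hh.close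
  · intro i j hij hj h
    split_ifs at h with h1 h2 h2
    · omega
    · have := hon j hj h; omega
    · have := hon i (by omega) h.symm; omega
    · exact hh.ind i j hij hj h

/-- A stem whose hole meets a set of large chromatic number only near the middle of the hole
extends to a lollipop. -/
theorem IsStem.exists_lolli_of_top {z g : ℕ → V} {m M k : ℕ} (hS : G.IsStem z m g (2 * M + 1))
    (hg5 : G.OddGirthGE 9) (hM : 6 ≤ M) {C : Set V} (hC : G.ConnIn C) (hCk : ¬ G.Col C (4 + k))
    (hzC : ∀ i ≤ m, z i ∉ C) (hzaC : ∀ i ≤ m, ∀ x ∈ C, ¬ G.Adj (z i) x)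
    (hgC : ∀ j < 2 * M + 1, g j ∈ C → j = M ∨ j = M + 1)
    (hgaC : ∀ j < 2 * M + 1, ∀ x ∈ C, G.Adj (g j) x → M ≤ j + 1 ∧ j ≤ M + 2)
    (hx : ∃ x ∈ C, ∃ j < 2 * M + 1, x = g j ∨ G.Adj (g j) x) :
    ∃ g' q B, G.IsLolli z m g' (2 * M + 1) q B ∧ B ⊆ C ∧ ¬ G.Col B k ∧
      ∀ j < 2 * M + 1, (∃ j' < 2 * M + 1, g' j = g j') ∨ g' j ∈ C := by
  set T : Set V := {x | ∃ j < 2 * M + 1, x = g j ∨ G.Adj (g j) x} with hT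
  -- Hole vertices with neighbours in C have positions M - 1 to M + 2, and each neighbourhood is
  -- stable. Hole vertices lying in C, at M or M + 1, are covered by their neighbour on the middle
  -- edge.
  have hCT : G.Col (C ∩ T) 4 := by
    have key : ∀ j, G.Col (G.walkEnds (g j) 1) 1 := fun j => hg5.col_walkEnds _ (by norm_num)
    refine ((((key (M - 1)).union (key M)).union (key (M + 1))).union (key (M + 2))).mono ?_ le_rfl
    rintro x ⟨hxC, j, hj, rfl | hadj⟩
    · have hmid := hS.hole.adj M (by omega)
      rcases hgC j hj hxC with rfl | rfl
      · exact .inl (.inr ⟨.cons hmid.symm .nil, rfl⟩)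
      · exact .inl (.inl (.inr ⟨.cons hmid .nil, rfl⟩))
    · have := hgaC j hj x hxC hadj
      rcases (by omega : j = M - 1 ∨ j = M ∨ j = M + 1 ∨ j = M + 2) with rfl | rfl | rfl | rfl
      · exact .inl (.inl (.inl ⟨.cons hadj .nil, rfl⟩))
      · exact .inl (.inl (.inr ⟨.cons hadj .nil, rfl⟩))
      · exact .inl (.inr ⟨.cons hadj .nil, rfl⟩)
      · exact .inr ⟨.cons hadj .nil, rfl⟩
  have hCT' : ¬ G.Col (C \ T) k := by
    have := not_col_diff hCk hCT
    rwa [Set.sdiff_self_inter] at this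
  obtain ⟨F, hFs, hF, hFcl, hFk⟩ := exists_component hCT'
  obtain ⟨f₀, hf₀⟩ := nonempty_of_not_col hFk
  obtain ⟨x, hxC, hxT⟩ := hx
  have hxF : x ∉ F := fun h => (hFs h).2 hxT
  obtain ⟨p, hp⟩ := hC f₀ (hFs hf₀).1 x hxC
  -- The path from F to the hole's neighbourhood leaves F along an edge from f to u. Since F is a
  -- full component of C minus T, its outer end u lies in T and hence sees the hole.
  obtain ⟨dd, hdd, hd1, hd2⟩ := p.exists_boundary_dart F hf₀ hxF
  obtain ⟨⟨f, u⟩, hfu⟩ := dd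
  simp only at hd1 hd2 hfu
  have huC : u ∈ C := hp u (p.dart_snd_mem_support_of_mem_darts hdd)
  have huT : u ∈ T := by
    by_contra h
    exact hd2 (hFcl f hd1 u ⟨huC, h⟩ hfu)
  have hFg : ∀ j < 2 * M + 1, ∀ y ∈ F, ¬ G.Adj (g j) y := fun j hj y hy h =>
    (hFs hy).2 ⟨j, hj, .inr h⟩
  have hgF : ∀ j < 2 * M + 1, g j ∉ F := fun j hj h => (hFs h).2 ⟨j, hj, .inl rfl⟩
  have hug : ∀ j < 2 * M + 1, u ≠ g j := by
    rintro j hj rfl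
    exact hFg j hj f hd1 hfu.symm
  obtain ⟨e, he, hue⟩ : ∃ e < 2 * M + 1, G.Adj (g e) u := by
    obtain ⟨j, hj, h | h⟩ := huT
    · exact absurd h (hug j hj)
    · exact ⟨j, hj, h⟩
  have hrange : ∀ j < 2 * M + 1, G.Adj u (g j) → M ≤ j + 1 ∧ j ≤ M + 2 := fun j hj h =>
    hgaC j hj u huC h.symm
  -- If u has only one neighbour on the hole, F together with u is the head. Otherwise the odd girth
  -- leaves two neighbours `g (c - 1)` and `g (c + 1)`; then u takes the place of `g c` and F
  -- attaches there.
  by_cases hone : ∀ j < 2 * M + 1, G.Adj (g j) u → j = e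
  · have := hrange e he hue.symm
    obtain ⟨g', q', hL, hg'⟩ := hS.exists_lolli (q := e) (B := F ∪ {u}) (by omega) (by omega)
      (hF.attach (by rintro a rfl; exact ⟨f, hd1, hfu⟩))
      (by
        rintro i hi (h | h)
        · exact hzC i hi (hFs h).1
        · exact hzC i hi (by rw [show z i = u from h]; exact huC))
      (by
        rintro j hj (h | h)
        · exact hgF j hj h
        · exact hug j hj h.symm)
      (by
        rintro i hi y (h | h)
        · exact hzaC i hi y (hFs h).1
        · rw [show y = u from h]; exact hzaC i hi u huC)
      (by
        rintro j hj hje y (h | h)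
        · exact hFg j hj y h
        · rw [show y = u from h]; exact fun h => hje (hone j hj h))
      ⟨u, .inr rfl, hue⟩
    refine ⟨g', q', F ∪ {u}, hL, ?_, fun h => hFk (h.mono Set.subset_union_left le_rfl),
      fun j hj => .inl (hg' j hj)⟩
    rintro y (h | h)
    · exact (hFs h).1
    · rw [show y = u from h]; exact huC
  · have hgap : ∃ c, 5 ≤ c ∧ c + 5 ≤ 2 * M + 1 ∧ G.Adj u (g (c - 1)) ∧ G.Adj u (g (c + 1)) ∧
        ∀ j < 2 * M + 1, G.Adj u (g j) → j = c - 1 ∨ j = c ∨ j = c + 1 := by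
      have a0 := hS.hole.adj (M - 1) (by omega)
      rw [show M - 1 + 1 = M by omega] at a0
      have a1 := hS.hole.adj M (by omega)
      have a2 := hS.hole.adj (M + 1) (by omega)
      have n01 : ¬ (G.Adj u (g (M - 1)) ∧ G.Adj u (g M)) := fun h =>
        hg5.no_triangle (by norm_num) h.1 a0 h.2.symm
      have n12 : ¬ (G.Adj u (g M) ∧ G.Adj u (g (M + 1))) := fun h =>
        hg5.no_triangle (by norm_num) h.1 a1 h.2.symm
      have n23 : ¬ (G.Adj u (g (M + 1)) ∧ G.Adj u (g (M + 2))) := fun h =>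
        hg5.no_triangle (by norm_num) h.1 a2 h.2.symm
      have n03 : ¬ (G.Adj u (g (M - 1)) ∧ G.Adj u (g (M + 2))) := fun h =>
        hg5.no_pentagon (by norm_num) h.1 a0 a1 a2 h.2.symm
      have hcase : ∀ j < 2 * M + 1, G.Adj u (g j) → j = M - 1 ∨ j = M ∨ j = M + 1 ∨ j = M + 2 := by
        intro j hj h
        have := hrange j hj h
        omega
      push Not at hone
      obtain ⟨e', he', hue', hne⟩ := hone
      have pick : ∀ t, e = t ∨ e' = t → G.Adj u (g t) := by
        rintro t (rfl | rfl)
        · exact hue.symm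
        · exact hue'.symm
      by_cases b0 : G.Adj u (g (M - 1))
      · have hcase' : ∀ j < 2 * M + 1, G.Adj u (g j) → j = M - 1 ∨ j = M + 1 := by
          intro j hj h
          rcases hcase j hj h with h1 | h1 | h1 | h1
          · exact .inl h1
          · subst h1; exact absurd ⟨b0, h⟩ n01
          · exact .inr h1
          · subst h1; exact absurd ⟨b0, h⟩ n03
        have h1 := hcase' e he hue.symm
        have h2 := hcase' e' he' hue'.symm
        exact ⟨M, by omega, by omega, b0, pick _ (by omega), fun j hj h => by
          have := hcase' j hj h; omega⟩
      · have hcase' : ∀ j < 2 * M + 1, G.Adj u (g j) → j = M ∨ j = M + 1 ∨ j = M + 2 := by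
          intro j hj h
          rcases hcase j hj h with h1 | h1
          · subst h1; exact absurd h b0
          · exact h1
        have h1 := hcase' e he hue.symm
        have h2 := hcase' e' he' hue'.symm
        have h3 : e ≠ M + 1 ∧ e' ≠ M + 1 := by
          constructor <;> intro h
          · rcases (by omega : e' = M ∨ e' = M + 2) with h' | h'
            · exact n12 ⟨pick _ (.inr h'), pick _ (.inl h)⟩
            · exact n23 ⟨pick _ (.inl h), pick _ (.inr h')⟩
          · rcases (by omega : e = M ∨ e = M + 2) with h' | h'
            · exact n12 ⟨pick _ (.inl h'), pick _ (.inr h)⟩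
            · exact n23 ⟨pick _ (.inr h), pick _ (.inl h')⟩
        exact ⟨M + 1, by omega, by omega, pick _ (by omega), pick _ (by omega), fun j hj h => by
          have := hcase' j hj h; omega⟩
    obtain ⟨c, hc3, hcn, hc1, hc2, hcon⟩ := hgap
    have hS' : G.IsStem z m (fun j => if j = c then u else g j) (2 * M + 1) := by
      refine ⟨hS.path, hS.hole.replace (by omega) (by omega) hug hc1 hc2 hcon, hS.odd, ?_, ?_⟩
      · rw [if_neg (by omega)]; exact hS.join
      · intro i hi j hj
        split_ifs with h
        · exact ⟨fun h => hzC i hi.le (h ▸ huC), fun h => absurd h (hzaC i hi.le u huC)⟩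
        · exact hS.cross i hi j hj
    obtain ⟨g', q', hL, hg'⟩ := hS'.exists_lolli (q := c) (B := F) (by omega) (by omega) hF
      (fun i hi h => hzC i hi (hFs h).1)
      (by
        intro j hj
        split_ifs with h
        · exact hd2
        · exact hgF j hj)
      (fun i hi y hy => hzaC i hi y (hFs hy).1)
      (by
        intro j hj hjc y hy
        rw [if_neg hjc]
        exact hFg j hj y hy)
      ⟨f, hd1, by simpa using hfu.symm⟩
    refine ⟨g', q', F, hL, fun y hy => (hFs hy).1, hFk, fun j hj => ?_⟩
    obtain ⟨j', hj', h⟩ := hg' j hj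
    by_cases hjc : j' = c
    · simp only [hjc, if_true] at h
      exact .inr (h ▸ huC)
    · simp only [hjc, if_false] at h
      exact .inl ⟨j', hj', h⟩

end gadget

/-! ### Odd holes from two meeting descents. -/

section gadget
variable {G : SimpleGraph V}

/-- A sequence of `k + 1` vertices descending the levels of `d`, starting in level `t`. -/
structure IsDescent (G : SimpleGraph V) (s : Set V) (d : V → ℕ) (t : ℕ) (a : ℕ → V) (k : ℕ) :
    Prop where
  mem : ∀ i ≤ k, a i ∈ s
  lev : ∀ i ≤ k, d (a i) + i = t
  adj : ∀ i < k, G.Adj (a i) (a (i + 1))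

theorem IsDescent.mono {s : Set V} {d : V → ℕ} {t k k' : ℕ} {a : ℕ → V}
    (h : G.IsDescent s d t a k) (hk : k' ≤ k) : G.IsDescent s d t a k' :=
  ⟨fun i hi => h.mem i (hi.trans hk), fun i hi => h.lev i (hi.trans hk),
    fun i hi => h.adj i (hi.trans_le hk)⟩

/-- Follow `a` for `k` steps and then step to `y`. -/
theorem IsDescent.snoc {s : Set V} {d : V → ℕ} {t k : ℕ} {a : ℕ → V} (h : G.IsDescent s d t a k)
    {y : V} (hy : y ∈ s) (hd : d y + (k + 1) = t) (hadj : G.Adj (a k) y) :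
    G.IsDescent s d t (fun i => if i ≤ k then a i else y) (k + 1) := by
  refine ⟨fun i hi => ?_, fun i hi => ?_, fun i hi => ?_⟩
  · by_cases hk : i ≤ k
    · simp only [hk, if_true]; exact h.mem i hk
    · simp only [hk, if_false]; exact hy
  · by_cases hk : i ≤ k
    · simp only [hk, if_true]; exact h.lev i hk
    · simp only [hk, if_false]; rwa [show i = k + 1 by omega]
  · by_cases hk : i < k
    · simp only [hk.le, Nat.succ_le_of_lt hk, if_true]; exact h.adj i hk
    · obtain rfl : i = k := by omega
      simpa using hadj

/-- Two adjacent vertices of `C` with descents that first meet after `s` steps. -/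
theorem exists_meeting {S : Set V} {v : V} {d : V → ℕ} (hd : G.IsBFS S v d) {t : ℕ} {C : Set V}
    (hCS : C ⊆ S) (hCt : ∀ x ∈ C, d x = t) (hC : ∃ x ∈ C, ∃ y ∈ C, G.Adj x y) :
    ∃ (a b : ℕ → V) (s : ℕ), s ≤ t ∧ a 0 ∈ C ∧ b 0 ∈ C ∧ G.Adj (a 0) (b 0) ∧
      G.IsDescent S d t a s ∧ G.IsDescent S d t b s ∧ a s = b s ∧ (∀ h < s, a h ≠ b h) ∧
      (∀ h, h + 1 < s → ¬ G.Adj (a h) (b (h + 1))) ∧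
      (∀ h, h + 1 < s → ¬ G.Adj (b h) (a (h + 1))) := by
  classical
  -- The meeting step is minimised over all adjacent pairs of C and all their descents. An edge
  -- crossing from one descent to the next level of the other would reroute it to an earlier
  -- meeting.
  have hex : ∃ s, s ≤ t ∧ ∃ a b : ℕ → V, a 0 ∈ C ∧ b 0 ∈ C ∧ G.Adj (a 0) (b 0) ∧
      G.IsDescent S d t a s ∧ G.IsDescent S d t b s ∧ a s = b s := by
    obtain ⟨x, hx, y, hy, hxy⟩ := hC
    obtain ⟨a, ha0, ha⟩ := hd.descent (hCS hx)
    obtain ⟨b, hb0, hb⟩ := hd.descent (hCS hy)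
    rw [hCt x hx] at ha
    rw [hCt y hy] at hb
    refine ⟨t, le_rfl, a, b, ha0 ▸ hx, hb0 ▸ hy, by rwa [ha0, hb0],
      ⟨fun i hi => (ha i hi).1, fun i hi => (ha i hi).2.1, fun i hi => (ha i hi.le).2.2 hi⟩,
      ⟨fun i hi => (hb i hi).1, fun i hi => (hb i hi).2.1, fun i hi => (hb i hi.le).2.2 hi⟩, ?_⟩
    rw [hd.eq_root _ (ha t le_rfl).1 (by have := (ha t le_rfl).2.1; omega),
      hd.eq_root _ (hb t le_rfl).1 (by have := (hb t le_rfl).2.1; omega)]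
  obtain ⟨hst, a, b, ha0, hb0, hab, ha, hb, hs⟩ := Nat.find_spec hex
  set s := Nat.find hex with hsdef
  have hmin : ∀ s' < s, ¬ (s' ≤ t ∧ ∃ a b : ℕ → V, a 0 ∈ C ∧ b 0 ∈ C ∧ G.Adj (a 0) (b 0) ∧
      G.IsDescent S d t a s' ∧ G.IsDescent S d t b s' ∧ a s' = b s') := fun s' h =>
    Nat.find_min hex h
  refine ⟨a, b, s, hst, ha0, hb0, hab, ha, hb, hs, ?_, ?_, ?_⟩
  · intro h hh he
    exact hmin h hh ⟨by omega, a, b, ha0, hb0, hab, ha.mono hh.le, hb.mono hh.le, he⟩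
  · intro h hh hadj
    refine hmin (h + 1) hh ⟨by omega, _, b, ?_, hb0, ?_, (ha.mono (by omega : h ≤ s)).snoc
      (hb.mem _ hh.le) (hb.lev _ hh.le) hadj, hb.mono hh.le, by simp⟩
    · simpa using ha0
    · simpa using hab
  · intro h hh hadj
    refine hmin (h + 1) hh ⟨by omega, a, _, ha0, ?_, ?_, ha.mono hh.le,
      (hb.mono (by omega : h ≤ s)).snoc (ha.mem _ hh.le) (ha.lev _ hh.le) hadj, by simp⟩
    · simpa using hb0
    · simpa using hab

/-- Two descents that meet for the first time after `s` steps bound an odd hole. -/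
theorem exists_hole_of_meeting {S : Set V} {v : V} {d : V → ℕ} (hd : G.IsBFS S v d) {t : ℕ}
    {a b : ℕ → V} {s : ℕ} (ha : G.IsDescent S d t a s) (hb : G.IsDescent S d t b s)
    (hg : G.OddGirthGE 13) (hadj0 : G.Adj (a 0) (b 0))
    (hs : a s = b s) (hne : ∀ h < s, a h ≠ b h) (hab : ∀ h, h + 1 < s → ¬ G.Adj (a h) (b (h + 1)))
    (hba : ∀ h, h + 1 < s → ¬ G.Adj (b h) (a (h + 1))) :
    ∃ i M, i + M = s ∧ 6 ≤ M ∧ G.Adj (a i) (b i) ∧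
      G.IsHole (catSeq (fun h => a (s - h)) M (consSeq (a i) fun h => b (i + h))) (2 * M + 1) ∧
      (∀ h ≤ M, catSeq (fun h => a (s - h)) M (consSeq (a i) fun h => b (i + h)) h = a (s - h)) ∧
      ∀ h, catSeq (fun h => a (s - h)) M (consSeq (a i) fun h => b (i + h)) (M + 1 + h)
        = b (i + h) := by
  classical
  have hs0 : 0 < s := by
    rcases Nat.eq_zero_or_pos s with h | h
    · rw [h] at hs; exact absurd hs hadj0.ne
    · exact h
  -- Take the last step i at which the two descents are adjacent. Below it there are no edges
  -- between equal steps; minimality of the meeting excludes crossing edges, and the levels exclude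
  -- all others.
  set i := Nat.findGreatest (fun i => G.Adj (a i) (b i)) (s - 1) with hi
  have hadj : G.Adj (a i) (b i) := Nat.findGreatest_spec (P := fun i => G.Adj (a i) (b i))
    (Nat.zero_le _) hadj0
  have his : i ≤ s - 1 := Nat.findGreatest_le _
  have hgr : ∀ h, i < h → h < s → ¬ G.Adj (a h) (b h) := fun h h1 h2 =>
    Nat.findGreatest_is_greatest h1 (by omega)
  have lipa : ∀ h ≤ s, ∀ h' ≤ s, G.Adj (a h) (b h') → h ≤ h' + 1 ∧ h' ≤ h + 1 := by
    intro h hh h' hh' hadj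
    have l1 := hd.lip _ (ha.mem h hh) _ (hb.mem h' hh') hadj
    have l2 := hd.lip _ (hb.mem h' hh') _ (ha.mem h hh) hadj.symm
    have e1 := ha.lev h hh
    have e2 := hb.lev h' hh'
    omega
  have desc : ∀ {c : ℕ → V}, G.IsDescent S d t c s → G.IsIndPath c s := by
    intro c hc
    refine ⟨fun x y hx hy h => ?_, hc.adj, fun x y hxy hy h => ?_⟩
    · have e1 := hc.lev x hx
      have e2 := hc.lev y hy
      rw [h] at e1; omega
    · have e1 := hc.lev x (by omega)
      have e2 := hc.lev y hy
      have l1 := hd.lip _ (hc.mem x (by omega)) _ (hc.mem y hy) h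
      omega
  obtain ⟨M, hM⟩ : ∃ M, i + M = s := ⟨s - i, by omega⟩
  have hp1 : G.IsIndPath (fun h => a (s - h)) M := (desc ha).reverse.mono (by omega)
  have hp2 : G.IsIndPath (consSeq (a i) fun h => b (i + h)) (M + 1) := by
    refine (((desc hb).drop (a := i) (by omega)).mono (by omega : M ≤ s - i)).cons hadj ?_ ?_
    · intro h hh he
      have e1 := ha.lev i (by omega)
      have e2 := hb.lev (i + h) (by omega)
      rw [he] at e1
      obtain rfl : h = 0 := by omega
      exact hne i (by omega) he
    · intro h hh h0 hadj
      have := lipa i (by omega) (i + h) (by omega) hadj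
      obtain rfl : h = 1 := by omega
      rcases (by omega : i + 1 < s ∨ i + 1 = s) with h1 | h1
      · exact hab i h1 hadj
      · -- `a i`, `b i` and the meeting vertex form a triangle
        exact hg.no_triangle (by norm_num) hadj (hb.adj i (by omega)).symm ‹G.Adj (a i) (b i)›.symm
  have hM2 : 2 ≤ M := by
    by_contra h
    obtain rfl : M = 1 := by omega
    have h1 := ha.adj i (by omega)
    have h2 := hb.adj i (by omega)
    rw [hM] at h1 h2
    rw [hs] at h1
    exact hg.no_triangle (by norm_num) h1 h2.symm hadj.symm
  have hhole := IsHole.of_paths hp1 hp2 hM2 (by omega)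
    (by simp only [consSeq_zero]; congr 1; omega)
    (by simp only [consSeq_succ, Nat.sub_zero]; rw [hM]; exact hs.symm) (by
      rintro h hh h0 (_ | h') hh' h0'
      · omega
      simp only [consSeq_succ]
      constructor
      · intro he
        have e1 := ha.lev (s - h) (by omega)
        have e2 := hb.lev (i + h') (by omega)
        rw [he] at e1
        rw [show s - h = i + h' by omega] at he
        exact hne (i + h') (by omega) he
      · intro hadj
        have := lipa (s - h) (by omega) (i + h') (by omega) hadj
        rcases (by omega : s - h = i + h' ∨ s - h + 1 = i + h' ∨ s - h = i + h' + 1) with e | e | e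
        · rw [e] at hadj; exact hgr _ (by omega) (by omega) hadj
        · rw [← e] at hadj; exact hab _ (by omega) hadj
        · rw [e] at hadj; exact hba _ (by omega) hadj.symm)
  rw [show M + (M + 1) = 2 * M + 1 by omega] at hhole
  refine ⟨i, M, hM, ?_, hadj, hhole, fun h hh => catSeq_left hh, fun h => ?_⟩
  -- The hole is odd, so 2M + 1 ≥ 13.
  · have := hhole.oddGirth_le hg (by omega); omega
  · rw [add_assoc, catSeq_add (by simp only [consSeq_zero]; congr 1; omega), add_comm 1 h,
      consSeq_succ]

end gadget

/-! ### Lollipops inside a connected set of large chromatic number. -/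

section gadget
variable {G : SimpleGraph V}

/-- A connected set of large chromatic number attached to `v` contains a lollipop starting
at `v`. -/
theorem exists_gadget (hg : G.OddGirthGE 13) {B : Set V} (hB : G.ConnIn B) {v : V} (hv : v ∉ B)
    (hatt : ∃ x ∈ B, G.Adj v x) {k : ℕ} (hk : ¬ G.Col B (2 * (4 + k))) :
    ∃ z m g n q B', G.IsLolli z m g n q B' ∧ z 0 = v ∧ B' ⊆ B ∧ ¬ G.Col B' k ∧
      (∀ i ≤ m, 0 < i → z i ∈ B) ∧ ∀ j < n, g j = v ∨ g j ∈ B := by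
  have hS : G.ConnIn (B ∪ {v}) := hB.attach (by
    rintro a rfl
    obtain ⟨x, hx, h⟩ := hatt
    exact ⟨x, hx, h.symm⟩)
  set S := B ∪ {v} with hSdef
  obtain ⟨d, hd⟩ := exists_isBFS hS (v := v) (.inr rfl)
  -- Halving pays for passing to a single level; the 4 extra colours pay for clearing the
  -- neighbourhood of the hole there.
  obtain ⟨t, ht⟩ := exists_level d hd.lip (k := 4 + k)
    (fun h => hk (h.mono Set.subset_union_left le_rfl))
  have ht4 : 4 ≤ t := by
    by_contra h
    refine ht ((hg.col_walkEnds v (t := t) (by omega)).mono ?_ (by omega))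
    rintro a ⟨ha, rfl⟩
    exact hd.mem_walkEnds ha
  obtain ⟨C, hCs, hC, -, hCk⟩ := exists_component ht
  have hCS : C ⊆ S := fun x hx => (hCs hx).1
  have hCt : ∀ x ∈ C, d x = t := fun x hx => (hCs hx).2
  have inB : ∀ x ∈ S, 0 < d x → x ∈ B := by
    rintro x (h | h) h0
    · exact h
    · rw [show x = v from h, hd.root] at h0; omega
  have hCB : C ⊆ B := fun x hx => inB x (hCS hx) (by rw [hCt x hx]; omega)
  obtain ⟨a, b, s, hst, ha0, hb0, hab0, ha, hb, hs, hne, hab, hba⟩ := exists_meeting hd hCS hCt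
    (exists_adj_of_not_col (by omega) hCk)
  obtain ⟨i, M, hiM, hM, hadj, hhole, hgl, hgr⟩ := exists_hole_of_meeting hd ha hb hg hab0 hs hne
    hab hba
  set g := catSeq (fun h => a (s - h)) M (consSeq (a i) fun h => b (i + h)) with hgdef
  clear_value g
  -- levels of the hole
  have hgS : ∀ j < 2 * M + 1, g j ∈ S ∧ (j ≤ M ∧ g j = a (s - j) ∧ d (g j) + s = t + j ∨
      M < j ∧ g j = b (i + (j - (M + 1))) ∧ d (g j) + i + j = t + M + 1) := by
    intro j hj
    rcases le_or_gt j M with h | h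
    · rw [hgl j h]
      have := ha.lev (s - j) (by omega)
      exact ⟨ha.mem _ (by omega), .inl ⟨h, rfl, by omega⟩⟩
    · obtain ⟨c, rfl⟩ : ∃ c, j = M + 1 + c := ⟨j - (M + 1), by omega⟩
      rw [hgr c]
      have := hb.lev (i + c) (by omega)
      exact ⟨hb.mem _ (by omega), .inr ⟨h, by congr 1; omega, by omega⟩⟩
  -- the path from `v`
  obtain ⟨f, hf0, hf⟩ := hd.descent (ha.mem s le_rfl)
  have hds : d (a s) + s = t := ha.lev s le_rfl
  set m := d (a s) with hm
  set z : ℕ → V := fun i => f (m - i) with hz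
  have hzS : ∀ i ≤ m, z i ∈ S := fun i hi => (hf (m - i) (by omega)).1
  have hzd : ∀ i ≤ m, d (z i) = i := fun i hi => by
    have := (hf (m - i) (by omega)).2.1
    simp only [hz]; omega
  have hzadj : ∀ i < m, G.Adj (z i) (z (i + 1)) := fun i hi => by
    have := (hf (m - (i + 1)) (by omega)).2.2 (by omega)
    rw [show m - (i + 1) + 1 = m - i by omega] at this
    exact this.symm
  have hz0 : z 0 = v := hd.eq_root _ (hzS 0 (by omega)) (hzd 0 (by omega))
  have hzm : z m = g 0 := by
    rw [hgl 0 (by omega)]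
    simp only [hz, Nat.sub_self, Nat.sub_zero, hf0]
  have hzp : G.IsIndPath z m := by
    refine ⟨fun x y hx hy h => ?_, hzadj, fun x y hxy hy h => ?_⟩
    · have e1 := hzd x hx
      rw [h, hzd y hy] at e1; exact e1.symm
    · have l1 := hd.lip _ (hzS y hy) _ (hzS x (by omega)) h.symm
      rw [hzd y hy, hzd x (by omega)] at l1
      omega
  have hstem : G.IsStem z m g (2 * M + 1) := by
    refine ⟨hzp, hhole, by omega, hzm, fun x hx j hj => ?_⟩
    obtain ⟨hj1, hj2⟩ := hgS j hj
    constructor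
    · intro he
      have := hzd x hx.le
      rw [he] at this
      omega
    · intro hadj
      have l1 := hd.lip _ hj1 _ (hzS x hx.le) hadj.symm
      rw [hzd x hx.le] at l1
      omega
  have hzB : ∀ i ≤ m, 0 < i → z i ∈ B := fun i hi h0 => inB _ (hzS i hi) (by rwa [hzd i hi])
  have hSB : ∀ x ∈ S, x = v ∨ x ∈ B := by
    rintro x (h | h)
    · exact .inr h
    · exact .inl h
  have hzC : ∀ i ≤ m, z i ∉ C := fun i hi h => by
    have := hCt _ h
    rw [hzd i hi] at this; omega
  have hzaC : ∀ i ≤ m, ∀ x ∈ C, ¬ G.Adj (z i) x := fun i hi x hx hadj => by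
    have l1 := hd.lip _ (hCS hx) _ (hzS i hi) hadj.symm
    rw [hzd i hi, hCt x hx] at l1; omega
  -- If i is at most 1, the hole may touch C near its top and must be separated from it. If i ≥ 2,
  -- the descent `a 1, …, a (i - 1)` links C to the hole at `a i = g M`, and C needs no thinning.
  rcases lt_or_ge i 2 with hi | hi
  · obtain ⟨g', q, B', hL, hBC, hB'k, hg'⟩ := hstem.exists_lolli_of_top (hg.mono (by norm_num)) hM hC hCk hzC hzaC
      (by
        intro j hj hjC
        have := hCt _ hjC
        have := (hgS j hj).2
        omega)
      (by
        intro j hj x hx hadj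
        have l1 := hd.lip _ (hCS hx) _ (hgS j hj).1 hadj.symm
        rw [hCt x hx] at l1
        have := (hgS j hj).2
        omega)
      (by
        refine ⟨a 0, ha0, M, by omega, ?_⟩
        rw [hgl M (by omega)]
        rcases (by omega : i = 0 ∨ i = 1) with h | h
        · left; congr 1; omega
        · right; rw [show s - M = 0 + 1 by omega]; exact (ha.adj 0 (by omega)).symm)
    refine ⟨z, m, g', _, q, B', hL, hz0, hBC.trans hCB, hB'k, hzB, fun j hj => ?_⟩
    rcases hg' j hj with ⟨j', hj', h⟩ | h
    · rw [h]; exact hSB _ (hgS j' hj').1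
    · exact .inr (hCB h)
  · have hconn : ∀ k < i, G.ConnIn (C ∪ {y | ∃ h, 0 < h ∧ h ≤ k ∧ y = a h}) := by
      intro k
      induction k with
      | zero =>
        intro _
        rwa [show {y | ∃ h, 0 < h ∧ h ≤ 0 ∧ y = a h} = (∅ : Set V) by
          ext y; simp only [Set.mem_ofPred_eq, Set.mem_empty_iff_false, iff_false]
          rintro ⟨h, h1, h2, -⟩; omega, Set.union_empty]
      | succ k ih =>
        intro hk'
        have := (ih (by omega)).attach (t := {a (k + 1)}) (by
          rintro y rfl
          refine ⟨a k, ?_, ha.adj k (by omega)⟩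
          rcases Nat.eq_zero_or_pos k with rfl | h
          · exact .inl ha0
          · exact .inr ⟨k, h, le_rfl, rfl⟩)
        convert this using 1
        ext y
        constructor
        · rintro (h | ⟨h, h0, h1, rfl⟩)
          · exact .inl (.inl h)
          · rcases (by omega : h ≤ k ∨ h = k + 1) with h' | rfl
            · exact .inl (.inr ⟨h, h0, h', rfl⟩)
            · exact .inr rfl
        · rintro ((h | ⟨h, h0, h1, rfl⟩) | h)
          · exact .inl h
          · exact .inr ⟨h, h0, by omega, rfl⟩
          · exact .inr ⟨k + 1, by omega, le_rfl, h⟩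
    have hBS : ∀ y ∈ C ∪ {y | ∃ h, 0 < h ∧ h ≤ i - 1 ∧ y = a h}, y ∈ S ∧ t < d y + i := by
      rintro y (h | ⟨h, h0, h1, rfl⟩)
      · exact ⟨hCS h, by rw [hCt y h]; omega⟩
      · have := ha.lev h (by omega)
        exact ⟨ha.mem h (by omega), by omega⟩
    have hadja : G.Adj (g M) (a (i - 1)) := by
      rw [hgl M le_rfl, show s - M = i - 1 + 1 by omega]
      exact (ha.adj (i - 1) (by omega)).symm
    obtain ⟨g', q, hL, hg'⟩ := hstem.exists_lolli (q := M)
      (B := C ∪ {y | ∃ h, 0 < h ∧ h ≤ i - 1 ∧ y = a h}) (by omega) (by omega) (hconn _ (by omega))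
      (fun x hx h => by
        have := (hBS _ h).2
        rw [hzd x hx] at this; omega)
      (fun j hj h => by
        have := (hBS _ h).2
        have := (hgS j hj).2
        omega)
      (fun x hx y hy hadj => by
        obtain ⟨h1, h2⟩ := hBS y hy
        have l1 := hd.lip _ h1 _ (hzS x hx) hadj.symm
        rw [hzd x hx] at l1; omega)
      (by
        intro j hj hjM y hy hadj
        obtain ⟨hj1, hj2⟩ := hgS j hj
        have hyS := hBS y hy
        have l1 := hd.lip _ hyS.1 _ hj1 hadj.symm
        -- By levels, the only other hole vertex high enough to see the head is `b i = g (M + 1)`.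
        -- It is too low to see C, and an edge to `a (i - 1)` would be a crossing edge.
        have hjM' : j = M + 1 := by omega
        subst hjM'
        rw [show M + 1 = M + 1 + 0 from rfl, hgr 0, add_zero] at hadj
        have hbi := hb.lev i (by omega)
        rcases hy with h | ⟨h, h0, h1, rfl⟩
        · have l2 := hd.lip _ (hCS h) _ (hb.mem i (by omega)) hadj.symm
          rw [hCt y h] at l2
          omega
        · have l2 := hd.lip _ hyS.1 _ (hb.mem i (by omega)) hadj.symm
          have := ha.lev h (by omega)
          obtain rfl : h + 1 = i := by omega
          exact hab h (by omega) hadj.symm)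
      ⟨a (i - 1), .inr ⟨i - 1, by omega, le_rfl, rfl⟩, hadja⟩
    refine ⟨z, m, g', _, q, _, hL, hz0, ?_, fun h => hCk (h.mono Set.subset_union_left (by omega)),
      hzB, fun j hj => ?_⟩
    · exact fun y hy => inB y (hBS y hy).1 (by have := (hBS y hy).2; omega)
    · obtain ⟨j', hj', h⟩ := hg' j hj
      rw [h]; exact hSB _ (hgS j' hj').1

end gadget

/-! ### Successive lollipops and the joining of hubs. -/

section stages
variable {G : SimpleGraph V}

/-- A lollipop starting at `c` whose far part avoids a given set of small chromatic number. -/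
theorem exists_next_gadget (hg : G.OddGirthGE 13) {B : Set V} (hB : G.ConnIn B) {c : V}
    (hc : c ∉ B) (hatt : ∃ x ∈ B, G.Adj c x) {W : Set V} {κ k : ℕ} (hW : G.Col (B ∩ W) κ)
    (hk : ¬ G.Col B (κ + 2 * (4 + k))) :
    ∃ z m g n q B', G.IsLolli z m g n q B' ∧ z 0 = c ∧ B' ⊆ B \ W ∧ ¬ G.Col B' k ∧
      (∀ i ≤ m, 0 < i → z i ∈ B) ∧ ∀ j < n, 0 < j → g j ∈ B \ W := by
  have hBW := not_col_diff hk hW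
  rw [Set.sdiff_self_inter] at hBW
  obtain ⟨F, hFs, hF, -, hFk⟩ := exists_component hBW
  obtain ⟨f₀, hf₀⟩ := nonempty_of_not_col hFk
  have hcF : c ∉ F := fun h => hc (hFs h).1
  -- A shortest path from c to F lengthens the stem. It may pass through W; the hole beyond its
  -- first vertex and the head lie in F and avoid W.
  obtain ⟨e, N, he, he0, heN, heQ, hmin⟩ := exists_indPath (G := G) (Q := {x | x = c ∨ x ∈ B})
    (T := F) (u := c) (by
      obtain ⟨x, hx, hcx⟩ := hatt
      obtain ⟨p, hp⟩ := hB x hx f₀ (hFs hf₀).1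
      refine ⟨f₀, hf₀, .cons hcx p, fun w hw => ?_⟩
      rw [Walk.support_cons, List.mem_cons] at hw
      exact hw.imp_right (hp w))
  have hN : 1 ≤ N := by
    rcases Nat.eq_zero_or_pos N with rfl | h
    · exact absurd (he0 ▸ heN) hcF
    · exact h
  have hanti : ∀ i, i + 1 < N → ∀ y ∈ F, ¬ G.Adj (e i) y := by
    intro i hi y hy hadj
    obtain ⟨p, hpl, hps, -⟩ := exists_walk_of_seq (G := G) (f := e) (Nat.zero_le i)
      (fun b _ hb => he.adj b (by omega))
    have := hmin y hy ((p.copy he0 rfl).append (.cons hadj .nil)) (by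
      intro w hw
      rw [Walk.mem_support_append_iff, Walk.support_copy] at hw
      rcases hw with hw | hw
      · obtain ⟨b, -, hb, rfl⟩ := hps w hw
        exact heQ b (by omega)
      · rw [Walk.support_cons, Walk.support_nil, List.mem_cons, List.mem_singleton] at hw
        rcases hw with rfl | rfl
        · exact heQ i (by omega)
        · exact .inr (hFs hy).1)
    rw [Walk.length_append, Walk.length_copy, hpl, Walk.length_cons, Walk.length_nil] at this
    omega
  have hnF : ∀ i < N, e i ∉ F := by
    intro i hi hiF
    obtain ⟨p, hpl, hps, -⟩ := exists_walk_of_seq (G := G) (f := e) (Nat.zero_le i)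
      (fun b _ hb => he.adj b (by omega))
    have := hmin _ hiF (p.copy he0 rfl) (by
      intro w hw
      rw [Walk.support_copy] at hw
      obtain ⟨b, -, hb, rfl⟩ := hps w hw
      exact heQ b (by omega))
    rw [Walk.length_copy, hpl] at this
    omega
  have heB : ∀ i ≤ N, 0 < i → e i ∈ B := by
    intro i hi h0
    rcases heQ i hi with h | h
    · have := he.inj i 0 hi (by omega) (h.trans he0.symm); omega
    · exact h
  obtain ⟨z, m, g, n, q, B', hL, hz0, hB', hB'k, hzF, hgF⟩ := exists_gadget hg hF
    (v := e (N - 1)) (hnF _ (by omega)) ⟨e N, heN, by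
      have := he.adj (N - 1) (by omega)
      rwa [show N - 1 + 1 = N by omega] at this⟩ hFk
  have hgF' : ∀ j < n, 0 < j → g j ∈ F := by
    intro j hj h0
    rcases hgF j hj with h | h
    · rcases Nat.eq_zero_or_pos m with hm | hm
      · have := hL.join
        rw [hm, hz0] at this
        have := hL.hole.inj j 0 hj (by omega) (h.trans this)
        omega
      · exact absurd (hz0.trans h.symm) (hL.cross 0 hm j hj).1
    · exact h
  have hjoin : e (N - 1) = z 0 := hz0.symm
  have hp : G.IsIndPath (catSeq e (N - 1) z) (N - 1 + m) := by
    refine (he.mono (by omega)).cat hL.path hjoin fun i hi j hj h0 => ⟨fun h => ?_, ?_⟩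
    · exact hnF i (by omega) (h ▸ hzF j hj h0)
    · exact hanti i (by omega) _ (hzF j hj h0)
  have hval : ∀ i ≤ N - 1 + m, (i < N - 1 ∧ catSeq e (N - 1) z i = e i) ∨
      ∃ j ≤ m, i = N - 1 + j ∧ catSeq e (N - 1) z i = z j := by
    intro i hi
    rcases lt_or_ge i (N - 1) with h | h
    · exact .inl ⟨h, catSeq_left h.le⟩
    · exact .inr ⟨i - (N - 1), by omega, by omega, catSeq_right h hjoin⟩
  have hclose : ∀ j < n, ∀ i < N - 1, e i ≠ g j ∧ (G.Adj (e i) (g j) →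
      i + 1 = N - 1 ∧ m = 0 ∧ j = 0) := by
    intro j hj i hi
    rcases Nat.eq_zero_or_pos j with rfl | h0
    · rw [← hL.join]
      rcases Nat.eq_zero_or_pos m with hm | hm
      · rw [hm, hz0]
        refine ⟨fun h => ?_, fun h => ⟨?_, rfl, rfl⟩⟩
        · have := he.inj i (N - 1) (by omega) (by omega) h; omega
        · have := he.ind i (N - 1) hi (by omega) h; omega
      · exact ⟨fun h => hnF i (by omega) (h ▸ hzF m le_rfl hm), fun h =>
          absurd h (hanti i (by omega) _ (hzF m le_rfl hm))⟩
    · exact ⟨fun h => hnF i (by omega) (h ▸ hgF' j hj h0), fun h =>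
        absurd h (hanti i (by omega) _ (hgF' j hj h0))⟩
  refine ⟨catSeq e (N - 1) z, N - 1 + m, g, n, q, B', ⟨hp, hL.hole, hL.odd, ?_, ?_, hL.six_le,
    hL.le_sub, hL.even, hL.conn, ?_, hL.gB, ?_, hL.antig, hL.att⟩, ?_, hB'.trans hFs, hB'k, ?_,
    fun j hj h0 => hFs (hgF' j hj h0)⟩
  · rw [catSeq_add hjoin]; exact hL.join
  · intro i hi j hj
    rcases hval i hi.le with ⟨h, e1⟩ | ⟨b, hb, hib, e1⟩
    · rw [e1]
      refine ⟨(hclose j hj i h).1, fun hadj => ?_⟩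
      have := (hclose j hj i h).2 hadj
      omega
    · rw [e1]
      refine ⟨(hL.cross b (by omega) j hj).1, fun hadj => ?_⟩
      have := (hL.cross b (by omega) j hj).2 hadj
      omega
  · intro i hi
    rcases hval i hi with ⟨h, e1⟩ | ⟨b, hb, hib, e1⟩
    · rw [e1]; exact fun h' => hnF i (by omega) (hB' h')
    · rw [e1]; exact hL.zB b hb
  · intro i hi x hx
    rcases hval i hi with ⟨h, e1⟩ | ⟨b, hb, hib, e1⟩
    · rw [e1]; exact hanti i (by omega) x (hB' hx)
    · rw [e1]; exact hL.antiz b hb x hx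
  · rw [catSeq_left (Nat.zero_le _), he0]
  · intro i hi h0
    rcases hval i hi with ⟨h, e1⟩ | ⟨b, hb, hib, e1⟩
    · rw [e1]; exact heB i (by omega) h0
    · rw [e1]
      rcases Nat.eq_zero_or_pos b with rfl | hb0
      · rw [hz0]; exact heB _ (by omega) (by omega)
      · exact (hFs (hzF b hb hb0)).1

/-- Two disjoint hubs joined by edges between opposite classes. -/
theorem IsHub.join {A₁ D₁ A₂ D₂ : Set V} (h₁ : G.IsHub A₁ D₁) (h₂ : G.IsHub A₂ D₂)
    (hdisj : Disjoint (A₁ ∪ D₁) (A₂ ∪ D₂)) (hA : G.Anti A₁ A₂) (hD : G.Anti D₁ D₂)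
    (hadj : ∃ x ∈ A₁ ∪ D₁, ∃ y ∈ A₂ ∪ D₂, G.Adj x y) : G.IsHub (A₁ ∪ A₂) (D₁ ∪ D₂) := by
  have hd : ∀ x, x ∈ A₁ ∪ D₁ → x ∉ A₂ ∪ D₂ := fun x h => Set.disjoint_left.1 hdisj h
  refine ⟨?_, ?_, ?_, ?_⟩
  · rw [Set.disjoint_left]
    rintro x (h | h) (h' | h')
    · exact Set.disjoint_left.1 h₁.disj h h'
    · exact hd x (.inl h) (.inr h')
    · exact hd x (.inr h') (.inl h)
    · exact Set.disjoint_left.1 h₂.disj h h'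
  · rintro x (h | h) y (h' | h')
    · exact h₁.antiA x h y h'
    · exact hA x h y h'
    · exact hA.symm x h y h'
    · exact h₂.antiA x h y h'
  · rintro x (h | h) y (h' | h')
    · exact h₁.antiD x h y h'
    · exact hD x h y h'
    · exact hD.symm x h y h'
    · exact h₂.antiD x h y h'
  · obtain ⟨x, hx, y, hy, hxy⟩ := hadj
    have e : A₁ ∪ A₂ ∪ (D₁ ∪ D₂) = (A₁ ∪ D₁) ∪ (A₂ ∪ D₂) := by
      ext v; simp only [Set.mem_union]; tauto
    rw [e]
    have link : ∀ a ∈ A₁ ∪ D₁, ∀ b ∈ A₂ ∪ D₂, ∃ p : G.Walk a b,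
        ∀ v ∈ p.support, v ∈ (A₁ ∪ D₁) ∪ (A₂ ∪ D₂) := by
      intro a ha b hb
      obtain ⟨p, hp⟩ := h₁.conn a ha x hx
      obtain ⟨p', hp'⟩ := h₂.conn y hy b hb
      refine ⟨p.append (.cons hxy p'), fun v hv => ?_⟩
      rw [Walk.mem_support_append_iff, Walk.support_cons, List.mem_cons] at hv
      rcases hv with h | rfl | h
      · exact .inl (hp v h)
      · exact .inl hx
      · exact .inr (hp' v h)
    rintro a (ha | ha) b (hb | hb)
    · obtain ⟨p, hp⟩ := h₁.conn a ha b hb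
      exact ⟨p, fun v hv => .inl (hp v hv)⟩
    · exact link a ha b hb
    · obtain ⟨p, hp⟩ := link b hb a ha
      exact ⟨p.reverse, fun v hv => hp v (by simpa using hv)⟩
    · obtain ⟨p, hp⟩ := h₂.conn a ha b hb
      exact ⟨p, fun v hv => .inr (hp v hv)⟩

/-- A contracted index removes only the rim edges just before and just after it, so two indices lose
at most four. -/
theorem le_rimIdx_add_four {I : Set ℕ} {b c : ℕ} (hI : ∀ i ∈ I, i = b ∨ i = c) (k : ℕ) :
    k ≤ rimIdx I k + 4 := by
  have key : k ≤ rimIdx I k + ((if b ≤ k then 1 else 0) + (if b < k then 1 else 0) +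
      (if c ≤ k then 1 else 0) + (if c < k then 1 else 0)) := by
    induction k with
    | zero => exact Nat.zero_le _
    | succ k ih =>
      by_cases h : k ∈ I ∨ k + 1 ∈ I
      · rw [rimIdx_succ_of_mem h]
        have : k = b ∨ k = c ∨ k + 1 = b ∨ k + 1 = c := by
          rcases h with h | h <;> have := hI _ h <;> omega
        split_ifs at ih ⊢ <;> omega
      · rw [rimIdx_succ_of_not h]
        split_ifs at ih ⊢ <;> omega
  split_ifs at key <;> omega

end stages

/-! ### Two contacts on a path common to many holes. -/

section rims
variable {G : SimpleGraph V}

/-- The path `w` closes up through `O` to holes in which the end `e` of a leg attaches at a vertex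
of `O` (and possibly two steps further), at distances of all parities from both ends of `w`. -/
def Rims (G : SimpleGraph V) (w : ℕ → V) (W : ℕ) (e : V) (O : Set V) : Prop :=
  ∀ x y : ℕ, ∃ (h : ℕ → V) (n P a : ℕ), G.IsHole h n ∧ 7 ≤ n ∧ 0 < a ∧ a + 2 < P ∧ P + W < n ∧
    (∀ i ≤ W, h (P + i) = w i) ∧ (∀ i < n, i < P ∨ P + W < i → h i ∈ O) ∧
    (P - a) % 2 = x % 2 ∧ (n - (P + W) + a) % 2 = y % 2 ∧ G.Adj e (h a) ∧
    ∀ i < n, i < P ∨ P + W < i → G.Adj e (h i) → i = a ∨ i = a + 2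

open Classical in
/-- A leg `u` whose end attaches to the rims and which has two contacts of suitable parity on `w`
yields a contradiction. One of the contacts may be through a pendant vertex `v`. -/
theorem TPerfect.no_pair (hG : G.TPerfect) {w u : ℕ → V} {W k : ℕ} {O : Set V}
    (hR : G.Rims w W (u k) O) (hu : ∀ j ≤ k, u j ∉ O) (huO : ∀ j < k, ∀ y ∈ O, ¬ G.Adj (u j) y)
    (huinj : G.IsIndPath u k)
    (huw : ∀ j ≤ k, ∀ i ≤ W, u j ≠ w i) (huw' : ∀ j ≤ k, 0 < j → ∀ i ≤ W, ¬ G.Adj (u j) (w i))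
    {A D : Set V}
    (hub : ∀ k' ≤ k, G.IsHub (A ∪ {x | ∃ i ≤ k', i % 2 ≠ 0 % 2 ∧ x = u i})
      (D ∪ {x | ∃ i ≤ k', i % 2 = 0 % 2 ∧ x = u i}))
    (hO : ∀ x ∈ A ∪ D, x ∉ O ∧ ∀ y ∈ O, ¬ G.Adj x y) (hw : ∀ x ∈ A ∪ D, ∀ i ≤ W, x ≠ w i)
    (hAw : ∀ x ∈ A, ∀ i ≤ W, ¬ G.Adj x (w i)) (hADu : ∀ x ∈ A ∪ D, ∀ j ≤ k, x ≠ u j)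
    (hADu' : ∀ x ∈ A ∪ D, ∀ j ≤ k, 0 < j → ¬ G.Adj x (u j))
    {I : Set ℕ} {x₀ : ℕ} (hI : ∀ i ∈ I, i = x₀) (hx₀ : x₀ ≤ W) {v : V}
    (hv : I.Nonempty → (∀ x ∈ D, ¬ G.Adj x (w x₀)) ∧ ¬ G.Adj (u 0) (w x₀) ∧ v ∉ A ∪ D ∧
      (∀ j ≤ k, v ≠ u j) ∧ (∀ i ≤ W, v ≠ w i) ∧ v ∉ O ∧ (∀ x ∈ A, ¬ G.Adj x v) ∧
      (∀ j ≤ k, 0 < j → ¬ G.Adj (u j) v) ∧ G.Adj v (w x₀) ∧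
      (∀ i ≤ W, G.Adj v (w i) → i = x₀) ∧ ∀ y ∈ O, ¬ G.Adj v y)
    {x₁ x₂ : ℕ} (h12 : x₁ < x₂) (h2 : x₂ ≤ W)
    (con : ∀ i, i = x₁ ∨ i = x₂ → ∃ x ∈ D ∪ {u 0}, G.Adj x (if i ∈ I then v else w i))
    (odd : (x₂ - x₁ + (if x₁ ∈ I then 1 else 0) + (if x₂ ∈ I then 1 else 0)) % 2 = 1) : False := by
  -- If the leg is even, its end lies in class D and touches `h a` itself. If it is odd (τ = 1), the
  -- hub stops one step earlier, `h a` is contracted, and the end `u k` becomes the pendant at `h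
  -- a`.
  set τ : ℕ := if k % 2 = 0 then 0 else 1 with hτ
  set ε₁ : ℕ := if x₁ ∈ I then 1 else 0 with hε₁
  set ε₂ : ℕ := if x₂ ∈ I then 1 else 0 with hε₂
  -- The requested parities make both arcs between the attachment a and the path w odd, after the
  -- corrections τ, ε₁ and ε₂ for pendant contacts.
  obtain ⟨h, n, P, a, hh, hn7, ha0, haP, hPW, hhw, hhO, px, py, hea, hei⟩ :=
    hR (1 + x₁ + τ + ε₁) (1 + (W - x₂) + τ + ε₂)
  have hsplit : ∀ i < n, (∃ j ≤ W, i = P + j ∧ h i = w j) ∨ ((i < P ∨ P + W < i) ∧ h i ∈ O) := by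
    intro i hi
    by_cases hc : i < P ∨ P + W < i
    · exact .inr ⟨hc, hhO i hi hc⟩
    · refine .inl ⟨i - P, by omega, by omega, ?_⟩
      rw [← hhw (i - P) (by omega)]; congr 1; omega
  set k' := k - τ with hk'
  have hk'k : k' ≤ k := by omega
  have hτk : τ ≤ k := by
    rw [hτ]; split_ifs with h
    · omega
    · omega
  have hk'e : k' % 2 = 0 := by
    rw [hk', hτ]; split_ifs with h <;> omega
  set I' : Set ℕ := {i | (∃ j ∈ I, i = P + j) ∨ (τ = 1 ∧ i = a)} with hI'
  set pv : ℕ → V := fun i => if i = a then u k else v with hpv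
  have hPI : ∀ j, P + j ∈ I' ↔ j ∈ I := by
    intro j
    constructor
    · rintro (⟨b, hb, e⟩ | ⟨-, e⟩)
      · rwa [show j = b by omega]
      · omega
    · exact fun hj => .inl ⟨j, hj, rfl⟩
  have haI : a ∈ I' ↔ τ = 1 := by
    constructor
    · rintro (⟨b, hb, e⟩ | ⟨h, -⟩)
      · omega
      · exact h
    · exact fun h => .inr ⟨h, rfl⟩
  have hpva : pv a = u k := by simp [hpv]
  have hpvP : ∀ j, pv (P + j) = v := fun j => by
    simp only [hpv]; rw [if_neg (by omega)]
  have hcases : ∀ i ∈ I', (i = P + x₀ ∧ x₀ ∈ I) ∨ (i = a ∧ τ = 1) := by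
    rintro i (⟨j, hj, rfl⟩ | ⟨h1, h2⟩)
    · have := hI j hj
      subst this
      exact .inl ⟨rfl, hj⟩
    · exact .inr ⟨h2, h1⟩
  clear_value I'
  have hmemA : ∀ x ∈ A ∪ {x | ∃ i ≤ k', i % 2 ≠ 0 % 2 ∧ x = u i}, x ∈ A ∨ ∃ i ≤ k', 0 < i ∧
      x = u i := by
    rintro x (hx | ⟨i, hi, hp, rfl⟩)
    · exact .inl hx
    · exact .inr ⟨i, hi, by omega, rfl⟩
  have hmemD : ∀ x ∈ D ∪ {x | ∃ i ≤ k', i % 2 = 0 % 2 ∧ x = u i}, x ∈ D ∨ ∃ i ≤ k',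
      x = u i := by
    rintro x (hx | ⟨i, hi, hp, rfl⟩)
    · exact .inl hx
    · exact .inr ⟨i, hi, rfl⟩
  have hmem : ∀ x ∈ A ∪ {x | ∃ i ≤ k', i % 2 ≠ 0 % 2 ∧ x = u i} ∪
      (D ∪ {x | ∃ i ≤ k', i % 2 = 0 % 2 ∧ x = u i}), x ∈ A ∪ D ∨ ∃ i ≤ k', x = u i := by
    rintro x (hx | hx)
    · rcases hmemA x hx with h | ⟨i, hi, -, rfl⟩
      · exact .inl (.inl h)
      · exact .inr ⟨i, hi, rfl⟩
    · rcases hmemD x hx with h | h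
      · exact .inl (.inr h)
      · exact .inr h
  have hu0D : u 0 ∈ D ∪ {x | ∃ i ≤ k', i % 2 = 0 % 2 ∧ x = u i} := .inr ⟨0, by omega, rfl, rfl⟩
  refine hG.no_three_contacts hh (hub k' hk'k) I' pv (a := a) (b := P + x₁) (c := P + x₂)
    ?_ ?_ ?_ ?_ ?_ ?_ ?_ ?_ ?_ ?_ ?_ ?_ ?_ ?_ ?_ (by omega) (by omega) (by omega) ?_ ?_ ?_ ?_
  · intro h0
    rcases hcases 0 h0 with h | h <;> omega
  · intro i hi
    rcases hcases i hi with h | h <;> omega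
  · intro i hi hi'
    rcases hcases i hi with h | h <;> rcases hcases _ hi' with h' | h' <;> omega
  · intro i hi hi'
    rcases hcases i hi with h | h <;> rcases hcases _ hi' with h' | h' <;> omega
  -- At most two indices are contracted, so n ≥ 7 leaves a rim of length at least 3.
  · have := le_rimIdx_add_four (I := I') (b := P + x₀) (c := a)
      (fun i hi => (hcases i hi).imp And.left And.left) n
    omega
  · intro i hi hx
    rcases hmem _ hx with hx | ⟨j, hj, e⟩
    · rcases hsplit i hi with ⟨b, hb, -, e⟩ | ⟨-, hiO⟩
      · exact hw _ hx b hb e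
      · exact (hO _ hx).1 hiO
    · rcases hsplit i hi with ⟨b, hb, -, e'⟩ | ⟨-, hiO⟩
      · exact huw j (by omega) b hb (e.symm.trans e')
      · exact hu j (by omega) (e ▸ hiO)
  · intro i hi x hx hadj
    rcases hmemA x hx with hx | ⟨j, hj, hj0, rfl⟩
    · rcases hsplit i hi with ⟨b, hb, -, e⟩ | ⟨-, hiO⟩
      · exact hAw x hx b hb (e ▸ hadj)
      · exact (hO x (.inl hx)).2 _ hiO hadj
    · rcases hsplit i hi with ⟨b, hb, -, e⟩ | ⟨-, hiO⟩
      · exact huw' j (by omega) hj0 b hb (e ▸ hadj)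
      · rcases (by omega : j < k ∨ j = k) with hjk | hjk
        · exact huO j hjk _ hiO hadj
        · -- the end of an even leg lies in the other class
          rcases hx with hx | ⟨b, hb, hbp, e⟩
          · exact hADu _ (.inl hx) j (by omega) rfl
          · have := huinj.inj j b (by omega) (by omega) e
            omega
  · intro i hi x hx hadj
    rcases hcases i hi with ⟨rfl, hxI⟩ | ⟨rfl, hτ1⟩
    · obtain ⟨v1, v2, -⟩ := hv ⟨x₀, hxI⟩
      rw [hhw x₀ hx₀] at hadj
      rcases hmemD x hx with hx | ⟨j, hj, rfl⟩
      · exact v1 x hx hadj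
      · rcases Nat.eq_zero_or_pos j with rfl | hj0
        · exact v2 hadj
        · exact huw' j (by omega) hj0 x₀ hx₀ hadj
    · have hiO := hhO i (by omega) (.inl (by omega))
      rcases hmemD x hx with hx | ⟨j, hj, rfl⟩
      · exact (hO x (.inr hx)).2 _ hiO hadj
      · exact huO j (by omega) _ hiO hadj
  · intro i hi hx
    rcases hcases i hi with ⟨rfl, hxI⟩ | ⟨rfl, hτ1⟩
    · obtain ⟨-, -, v3, v4, -⟩ := hv ⟨x₀, hxI⟩
      rw [hpvP] at hx
      rcases hmem _ hx with hx | ⟨j, hj, e⟩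
      · exact v3 hx
      · exact v4 j (by omega) e
    · rw [hpva] at hx
      rcases hmem _ hx with hx | ⟨j, hj, e⟩
      · exact hADu _ hx k le_rfl rfl
      · have := huinj.inj k j le_rfl (by omega) e
        omega
  · intro i hi j hj e
    rcases hcases i hi with ⟨rfl, hxI⟩ | ⟨rfl, hτ1⟩
    · obtain ⟨-, -, -, -, v5, v6, -⟩ := hv ⟨x₀, hxI⟩
      rw [hpvP] at e
      rcases hsplit j hj with ⟨b, hb, -, e'⟩ | ⟨-, hiO⟩
      · exact v5 b hb (e.trans e')
      · exact v6 (e ▸ hiO)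
    · rw [hpva] at e
      rcases hsplit j hj with ⟨b, hb, -, e'⟩ | ⟨-, hiO⟩
      · exact huw k le_rfl b hb (e.trans e')
      · exact hu k le_rfl (e ▸ hiO)
  · intro i hi j hj e
    rcases hcases i hi with ⟨rfl, hxI⟩ | ⟨rfl, hτ1⟩ <;>
    rcases hcases j hj with ⟨rfl, hxI'⟩ | ⟨rfl, hτ1'⟩
    · rfl
    · rw [hpvP, hpva] at e
      exact absurd e ((hv ⟨x₀, hxI⟩).2.2.2.1 k le_rfl)
    · rw [hpvP, hpva] at e
      exact absurd e.symm ((hv ⟨x₀, hxI'⟩).2.2.2.1 k le_rfl)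
    · rfl
  · intro i hi x hx hadj
    rcases hcases i hi with ⟨rfl, hxI⟩ | ⟨rfl, hτ1⟩
    · obtain ⟨-, -, -, -, -, -, v7, v8, -⟩ := hv ⟨x₀, hxI⟩
      rw [hpvP] at hadj
      rcases hmemA x hx with hx | ⟨j, hj, hj0, rfl⟩
      · exact v7 x hx hadj
      · exact v8 j (by omega) hj0 hadj
    · rw [hpva] at hadj
      rcases hx with hx | ⟨j, hj, hjp, rfl⟩
      · exact hADu' x (.inl hx) k le_rfl (by omega) hadj
      · have := huinj.ind j k (by omega) le_rfl hadj
        omega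
  · intro i hi
    rcases hcases i hi with ⟨rfl, hxI⟩ | ⟨rfl, hτ1⟩
    · rw [hpvP, hhw x₀ hx₀]
      exact (hv ⟨x₀, hxI⟩).2.2.2.2.2.2.2.2.1
    · rw [hpva]; exact hea
  · intro i hi j hj hadj
    rcases hcases i hi with ⟨rfl, hxI⟩ | ⟨rfl, hτ1⟩
    · obtain ⟨-, -, -, -, -, -, -, -, -, v10, v11⟩ := hv ⟨x₀, hxI⟩
      rw [hpvP] at hadj
      rcases hsplit j hj with ⟨b, hb, hjb, e'⟩ | ⟨-, hiO⟩
      · rw [e'] at hadj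
        rw [v10 b hb hadj] at hjb
        exact .inl hjb
      · exact absurd hadj (v11 _ hiO)
    · rw [hpva] at hadj
      rcases hsplit j hj with ⟨b, hb, hjb, e'⟩ | ⟨hout, hiO⟩
      · rw [e'] at hadj
        exact absurd hadj (huw' k le_rfl (by omega) b hb)
      · exact hei j hj hout hadj
  · intro i hi j hj hadj
    rcases hcases i hi with ⟨rfl, hxI⟩ | ⟨rfl, hτ1⟩ <;>
    rcases hcases j hj with ⟨rfl, hxI'⟩ | ⟨rfl, hτ1'⟩
    · exact hadj.ne rfl
    · rw [hpvP, hpva] at hadj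
      exact (hv ⟨x₀, hxI⟩).2.2.2.2.2.2.2.1 k le_rfl (by omega) hadj.symm
    · rw [hpvP, hpva] at hadj
      exact (hv ⟨x₀, hxI'⟩).2.2.2.2.2.2.2.1 k le_rfl (by omega) hadj
    · exact hadj.ne rfl
  · have conw : ∀ j, j = x₁ ∨ j = x₂ → ∃ x ∈ D ∪ {x | ∃ i ≤ k', i % 2 = 0 % 2 ∧ x = u i},
        G.Adj x (if P + j ∈ I' then pv (P + j) else h (P + j)) := by
      intro j hj
      obtain ⟨x, hx, hadj⟩ := con j hj
      refine ⟨x, ?_, ?_⟩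
      · rcases hx with hx | rfl
        · exact .inl hx
        · exact hu0D
      · rw [hpvP, hhw j (by omega)]
        simpa only [hPI] using hadj
    rintro i (rfl | rfl | rfl)
    · by_cases hτ1 : τ = 1
      · rw [if_pos (haI.2 hτ1), hpva]
        refine ⟨u k', .inr ⟨k', le_rfl, hk'e, rfl⟩, ?_⟩
        have := huinj.adj k' (by omega)
        rwa [show k' + 1 = k by omega] at this
      · rw [if_neg (fun h => hτ1 (haI.1 h))]
        have hτ0 : τ = 0 := by
          rw [hτ] at hτ1 ⊢; split_ifs at hτ1 ⊢ <;> omega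
        exact ⟨u k, .inr ⟨k, by omega, by omega, rfl⟩, hea⟩
    · exact conw x₁ (.inl rfl)
    · exact conw x₂ (.inr rfl)
  · have e1 : (if a ∈ I' then 1 else 0) = τ := by
      by_cases hτ1 : τ = 1
      · rw [if_pos (haI.2 hτ1), hτ1]
      · rw [if_neg (fun h => hτ1 (haI.1 h))]
        rw [hτ] at hτ1 ⊢; split_ifs at hτ1 ⊢ <;> omega
    simp only [hPI]
    rw [e1, ← hε₁]
    omega
  · simp only [hPI]
    rw [← hε₁, ← hε₂]
    omega
  · have e1 : (if a ∈ I' then 1 else 0) = τ := by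
      by_cases hτ1 : τ = 1
      · rw [if_pos (haI.2 hτ1), hτ1]
      · rw [if_neg (fun h => hτ1 (haI.1 h))]
        rw [hτ] at hτ1 ⊢; split_ifs at hτ1 ⊢ <;> omega
    simp only [hPI]
    rw [e1, ← hε₂]
    omega

end rims

/-! ### Frames, their spines and their rims. -/

section frame
variable {G : SimpleGraph V}

/-- A lollipop `t, g` continued by a path `y`, with connections of both parities from `t 0` to
`f m` through `S₁` and from the end of `y` to `f 0` through `S₃`, and a leg `u` attached to the
path `f` at `f a`. -/
structure IsFrame (G : SimpleGraph V) (f u t g y : ℕ → V) (m k a mt n q my : ℕ)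
    (X B₁ B S₁ S₃ : Set V) : Prop where
  fpath : G.IsIndPath f m
  upath : G.IsIndPath u k
  a_pos : 0 < a
  a_lt : a < m
  uf_ne : ∀ i ≤ k, ∀ j ≤ m, u i ≠ f j
  uf_anti : ∀ i < k, ∀ j ≤ m, ¬ G.Adj (u i) (f j)
  uf_adj : G.Adj (u k) (f a)
  uf_only : ∀ j ≤ m, G.Adj (u k) (f j) → j < m ∧ (j = a ∨ j = a + 2)
  fX : ∀ i ≤ m, f i ∉ X
  faX : ∀ i < m, 0 < i → ∀ x ∈ X, ¬ G.Adj (f i) x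
  uX : ∀ i ≤ k, u i ∉ X
  uaX : ∀ i ≤ k, 0 < i → ∀ x ∈ X, ¬ G.Adj (u i) x
  left : ∀ e : ℕ, ∃ v N, G.IsIndPath v N ∧ v 0 = f m ∧ v N = t 0 ∧ 3 ≤ N ∧ N % 2 = e % 2 ∧
    ∀ i < N, v i ∈ S₁
  right : ∀ e : ℕ, ∃ v N, G.IsIndPath v N ∧ v 0 = y my ∧ v N = f 0 ∧ 2 ≤ N ∧ N % 2 = e % 2 ∧
    ∀ i < N, 0 < i → v i ∈ S₃
  S₁X : ∀ x ∈ S₁, x ∈ X ∨ x = f m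
  S₁B : ∀ x ∈ S₁, x ≠ t 0 ∧ ∀ b ∈ B₁, x ≠ b ∧ ¬ G.Adj x b
  lol : G.IsLolli t mt g n q B
  t0 : t 0 ∈ X
  tB : ∀ i ≤ mt, 0 < i → t i ∈ B₁
  gB : ∀ j < n, 0 < j → g j ∈ B₁
  BB : B ⊆ B₁
  B₁X : B₁ ⊆ X
  ypath : G.IsIndPath y my
  y0 : y 0 = g q
  yB : ∀ i ≤ my, 0 < i → y i ∈ B
  S₃B : S₃ ⊆ B
  S₃y : ∀ x ∈ S₃, ∀ i < my, x ≠ y i ∧ ¬ G.Adj x (y i)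
  rS₁ : ∀ x ∈ S₁, ¬ G.Adj (f 0) x
  rt : ∀ i ≤ mt, ¬ G.Adj (f 0) (t i)
  rg : ∀ j < n, ¬ G.Adj (f 0) (g j)
  ry : ∀ i ≤ my, ¬ G.Adj (f 0) (y i)
  pS₁ : ∀ x ∈ S₁, ¬ G.Adj (u 0) x
  pS₃ : ∀ x ∈ S₃, ¬ G.Adj (u 0) x

variable {f u t g y : ℕ → V} {m k a mt n q my : ℕ} {X B₁ B S₁ S₃ : Set V}

/-- The path along `t`, one side `s` of the hole, and `y`. -/
def spine (t : ℕ → V) (mt : ℕ) (s : ℕ → V) (K : ℕ) (y : ℕ → V) : ℕ → V :=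
  catSeq (catSeq t mt s) (mt + K) y

/-- `s` is one of the two sides of the hole of a frame. -/
structure IsSide (G : SimpleGraph V) (g : ℕ → V) (n q : ℕ) (s : ℕ → V) (K : ℕ) : Prop where
  path : G.IsIndPath s K
  zero : s 0 = g 0
  last : s K = g q
  two_le : 2 ≤ K
  mem : ∀ i < K, 0 < i → ∃ j < n, j ≠ 0 ∧ j ≠ q ∧ s i = g j

section
variable {s : ℕ → V} {K : ℕ}

theorem spine_of_le {i : ℕ} (hi : i ≤ mt) : spine t mt s K y i = t i := by
  rw [spine, catSeq_left (by omega), catSeq_left hi]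

theorem IsFrame.spine_s (hF : G.IsFrame f u t g y m k a mt n q my X B₁ B S₁ S₃)
    (hs : G.IsSide g n q s K) {i : ℕ} (hi : i ≤ K) : spine t mt s K y (mt + i) = s i := by
  rw [spine, catSeq_left (by omega), catSeq_add (hF.lol.join.trans hs.zero.symm)]

theorem IsFrame.spine_y (hF : G.IsFrame f u t g y m k a mt n q my X B₁ B S₁ S₃)
    (hs : G.IsSide g n q s K) {i : ℕ} : spine t mt s K y (mt + K + i) = y i := by
  rw [spine, catSeq_add]
  rw [catSeq_add (hF.lol.join.trans hs.zero.symm), hs.last, hF.y0]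

/-- The three kinds of vertices of a spine. -/
theorem IsFrame.spine_cases (hF : G.IsFrame f u t g y m k a mt n q my X B₁ B S₁ S₃)
    (hs : G.IsSide g n q s K) {i : ℕ} (hi : i ≤ mt + K + my) :
    (i ≤ mt ∧ spine t mt s K y i = t i) ∨
    (mt < i ∧ i < mt + K ∧ ∃ j < n, j ≠ 0 ∧ j ≠ q ∧ spine t mt s K y i = g j) ∨
    (∃ j ≤ my, i = mt + K + j ∧ spine t mt s K y i = y j) := by
  rcases (by omega : i ≤ mt ∨ (mt < i ∧ i < mt + K) ∨ mt + K ≤ i) with h | h | h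
  · exact .inl ⟨h, spine_of_le h⟩
  · obtain ⟨j, hj, h0, hq, e⟩ := hs.mem (i - mt) (by omega) (by omega)
    refine .inr (.inl ⟨h.1, h.2, j, hj, h0, hq, ?_⟩)
    rw [← e, ← hF.spine_s hs (by omega)]; congr 1; omega
  · refine .inr (.inr ⟨i - (mt + K), by omega, by omega, ?_⟩)
    rw [← hF.spine_y hs (i := i - (mt + K))]; congr 1; omega

theorem IsFrame.spine_path (hF : G.IsFrame f u t g y m k a mt n q my X B₁ B S₁ S₃)
    (hs : G.IsSide g n q s K) : G.IsIndPath (spine t mt s K y) (mt + K + my) := by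
  have hq := hF.lol.six_le
  have hqn := hF.lol.le_sub
  have hj : t mt = s 0 := hF.lol.join.trans hs.zero.symm
  have h1 : G.IsIndPath (catSeq t mt s) (mt + K) := by
    refine hF.lol.path.cat hs.path hj fun i hi j hjK hj0 => ?_
    have : ∃ b < n, b ≠ 0 ∧ s j = g b := by
      rcases hjK.lt_or_eq with h | rfl
      · obtain ⟨b, hb, h0, -, e⟩ := hs.mem j h hj0; exact ⟨b, hb, h0, e⟩
      · exact ⟨q, by omega, by omega, hs.last⟩
    obtain ⟨b, hb, hb0, e⟩ := this
    rw [e]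
    exact ⟨(hF.lol.cross i hi b hb).1, fun hadj => hb0 ((hF.lol.cross i hi b hb).2 hadj).2⟩
  refine h1.cat hF.ypath (by rw [catSeq_add hj, hs.last, hF.y0]) fun i hi j hjy hj0 => ?_
  have hyB := hF.yB j hjy hj0
  rcases le_or_gt i mt with h | h
  · rw [catSeq_left h]
    exact ⟨fun e => hF.lol.zB i h (e ▸ hyB), hF.lol.antiz i h _ hyB⟩
  · rw [catSeq_right h.le hj]
    obtain ⟨b, hb, -, hbq, e⟩ := hs.mem (i - mt) (by omega) (by omega)
    rw [e]
    exact ⟨fun e => hF.lol.gB b hb (e ▸ hyB), hF.lol.antig b hb hbq _ hyB⟩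

theorem spine_zero : spine t mt s K y 0 = t 0 := spine_of_le (Nat.zero_le _)

theorem IsFrame.spine_mem (hF : G.IsFrame f u t g y m k a mt n q my X B₁ B S₁ S₃)
    (hs : G.IsSide g n q s K) {i : ℕ} (hi : i ≤ mt + K + my) (h0 : 0 < i) :
    spine t mt s K y i ∈ B₁ := by
  have := hs.two_le
  rcases hF.spine_cases hs hi with ⟨h, e⟩ | ⟨-, -, j, hj, hj0, -, e⟩ | ⟨j, hj, hij, e⟩
  · rw [e]; exact hF.tB i h h0
  · rw [e]; exact hF.gB j hj (by omega)
  · rw [e]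
    rcases Nat.eq_zero_or_pos j with rfl | hj0
    · rw [hF.y0]
      have h1 := hF.lol.six_le
      have h2 := hF.lol.le_sub
      exact hF.gB q (by omega) (by omega)
    · exact hF.BB (hF.yB j hj hj0)

theorem IsFrame.spine_X (hF : G.IsFrame f u t g y m k a mt n q my X B₁ B S₁ S₃)
    (hs : G.IsSide g n q s K) {i : ℕ} (hi : i ≤ mt + K + my) : spine t mt s K y i ∈ X := by
  rcases Nat.eq_zero_or_pos i with rfl | h
  · rw [spine_zero]; exact hF.t0
  · exact hF.B₁X (hF.spine_mem hs hi h)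

theorem IsFrame.r_spine (hF : G.IsFrame f u t g y m k a mt n q my X B₁ B S₁ S₃)
    (hs : G.IsSide g n q s K) {i : ℕ} (hi : i ≤ mt + K + my) :
    ¬ G.Adj (f 0) (spine t mt s K y i) := by
  rcases hF.spine_cases hs hi with ⟨h, e⟩ | ⟨-, -, j, hj, hj0, -, e⟩ | ⟨j, hj, hij, e⟩
  · rw [e]; exact hF.rt i h
  · rw [e]; exact hF.rg j hj
  · rw [e]; exact hF.ry j hj

theorem IsFrame.spine_S₃ (hF : G.IsFrame f u t g y m k a mt n q my X B₁ B S₁ S₃)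
    (hs : G.IsSide g n q s K) {i : ℕ} (hi : i < mt + K + my) {x : V} (hx : x ∈ S₃) :
    spine t mt s K y i ≠ x ∧ ¬ G.Adj (spine t mt s K y i) x := by
  have hxB := hF.S₃B hx
  rcases hF.spine_cases hs hi.le with ⟨h, e⟩ | ⟨-, -, j, hj, -, hjq, e⟩ | ⟨j, hj, hij, e⟩
  · rw [e]
    exact ⟨fun e => hF.lol.zB i h (e ▸ hxB), hF.lol.antiz i h _ hxB⟩
  · rw [e]
    exact ⟨fun e => hF.lol.gB j hj (e ▸ hxB), hF.lol.antig j hj hjq _ hxB⟩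
  · rw [e]
    have := hF.S₃y x hx j (by omega)
    exact ⟨this.1.symm, fun h => this.2 h.symm⟩

/-- The vertices outside the spine on the rims of a frame. -/
def outside (f : ℕ → V) (m : ℕ) (S₁ S₃ : Set V) : Set V := {x | ∃ i ≤ m, x = f i} ∪ S₁ ∪ S₃

theorem IsFrame.S₃X (hF : G.IsFrame f u t g y m k a mt n q my X B₁ B S₁ S₃) : S₃ ⊆ X :=
  fun _ hx => hF.B₁X (hF.BB (hF.S₃B hx))

theorem IsFrame.u_outside (hF : G.IsFrame f u t g y m k a mt n q my X B₁ B S₁ S₃) {j : ℕ}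
    (hj : j ≤ k) : ∀ x ∈ S₁ ∪ S₃, ¬ G.Adj (u j) x := by
  intro x hx hadj
  rcases Nat.eq_zero_or_pos j with rfl | h0
  · exact hx.elim (fun h => hF.pS₁ x h hadj) fun h => hF.pS₃ x h hadj
  · have : x ∈ X ∨ x = f m := hx.elim (hF.S₁X x) fun h => .inl (hF.S₃X h)
    rcases this with h | rfl
    · exact hF.uaX j hj h0 x h hadj
    · rcases hj.lt_or_eq with h | rfl
      · exact hF.uf_anti j h m le_rfl hadj
      · exact (hF.uf_only m le_rfl hadj).1.ne rfl

/-- The hole runs along `f`, a left connection, the spine, and a right connection back to `f 0`.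
Both connections exist in either parity, so the distances from `f a` to the two ends of the spine
can be adjusted independently. -/
theorem IsFrame.rims (hF : G.IsFrame f u t g y m k a mt n q my X B₁ B S₁ S₃)
    (hs : G.IsSide g n q s K) :
    G.Rims (spine t mt s K y) (mt + K + my) (u k) (outside f m S₁ S₃) := by
  intro ex ey
  have hup := hF.u_outside (j := k) le_rfl
  set w := spine t mt s K y with hw
  set W := mt + K + my with hW
  obtain ⟨v, N, hv, hv0, hvN, hN, hNe, hvS⟩ := hF.left (ex + m + a)
  obtain ⟨v', N', hv', hv0', hvN', hN', hNe', hvS'⟩ := hF.right (ey + a)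
  have ha := hF.a_pos
  have ham := hF.a_lt
  have hwW : w W = y my := hF.spine_y hs
  have h1 : G.IsIndPath (catSeq f m v) (m + N) := by
    refine hF.fpath.cat hv hv0.symm fun i hi j hj hj0 => ?_
    rcases hj.lt_or_eq with h | rfl
    · have hS := hvS j h
      rcases hF.S₁X _ hS with hX | e
      · refine ⟨fun e => hF.fX i hi.le (e ▸ hX), fun hadj => ?_⟩
        rcases Nat.eq_zero_or_pos i with rfl | h0
        · exact hF.rS₁ _ hS hadj
        · exact hF.faX i hi h0 _ hX hadj
      · have := hv.inj j 0 hj (by omega) (e.trans hv0.symm); omega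
    · rw [hvN]
      refine ⟨fun e => hF.fX i hi.le (e ▸ hF.t0), fun hadj => ?_⟩
      rcases Nat.eq_zero_or_pos i with rfl | h0
      · exact hF.rt 0 (Nat.zero_le _) hadj
      · exact hF.faX i hi h0 _ hF.t0 hadj
  have hj1 : catSeq f m v (m + N) = w 0 := by
    rw [catSeq_add hv0.symm, hvN, hw, spine_zero]
  have h2 : G.IsIndPath (catSeq (catSeq f m v) (m + N) w) (m + N + W) := by
    refine h1.cat (hF.spine_path hs) hj1 fun i hi j hj hj0 => ?_
    have hB := hF.spine_mem hs hj hj0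
    rcases lt_or_ge i m with h | h
    · rw [catSeq_left h.le]
      refine ⟨fun e => hF.fX i h.le (e ▸ hF.B₁X hB), fun hadj => ?_⟩
      rcases Nat.eq_zero_or_pos i with rfl | h0
      · exact hF.r_spine hs hj hadj
      · exact hF.faX i h h0 _ (hF.B₁X hB) hadj
    · rw [catSeq_right h hv0.symm]
      exact (hF.S₁B _ (hvS _ (by omega))).2 _ hB
  have hhole := IsHole.of_paths h2 hv' (by omega) hN'
    (by rw [catSeq_add hj1, hwW, hv0'])
    (by rw [hvN', catSeq_left (by omega), catSeq_left (by omega)]) (by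
      intro i hi hi0 j hj hj0
      have hS := hvS' j hj hj0
      rcases lt_or_ge i (m + N) with h | h
      · rw [catSeq_left h.le]
        rcases lt_or_ge i m with h' | h'
        · rw [catSeq_left h'.le]
          have hX := hF.B₁X (hF.BB (hF.S₃B hS))
          exact ⟨fun e => hF.fX i h'.le (e ▸ hX), hF.faX i h' hi0 _ hX⟩
        · rw [catSeq_right h' hv0.symm]
          exact (hF.S₁B _ (hvS _ (by omega))).2 _ (hF.BB (hF.S₃B hS))
      · rw [catSeq_right h hj1]
        exact hF.spine_S₃ hs (by omega) hS)
  set h := catSeq (catSeq (catSeq f m v) (m + N) w) (m + N + W) v' with hh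
  have hhl : ∀ i ≤ m, h i = f i := fun i hi => by
    rw [hh, catSeq_left (by omega), catSeq_left (by omega), catSeq_left hi]
  have hhv : ∀ i, m ≤ i → i < m + N → h i ∈ S₁ := fun i hi hi' => by
    rw [hh, catSeq_left (by omega), catSeq_left (by omega), catSeq_right hi hv0.symm]
    exact hvS _ (by omega)
  have hhv' : ∀ i, m + N + W < i → i < m + N + W + N' → h i ∈ S₃ := fun i hi hi' => by
    rw [hh, catSeq, if_neg (by omega)]
    exact hvS' _ (by omega) (by omega)
  refine ⟨h, m + N + W + N', m + N, a, hhole, by omega, ha, by omega, by omega, ?_, ?_, by omega,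
    by omega, ?_, ?_⟩
  · intro i hi
    rw [hh, catSeq_left (by omega), catSeq_add hj1]
  · rintro i hi (h' | h')
    · rcases lt_or_ge i m with h'' | h''
      · exact .inl (.inl ⟨i, h''.le, hhl i h''.le⟩)
      · exact .inl (.inr (hhv i h'' h'))
    · exact .inr (hhv' i h' hi)
  · rw [hhl a ham.le]; exact hF.uf_adj
  · rintro i hi (h' | h') hadj
    · rcases lt_or_ge i m with h'' | h''
      · rw [hhl i h''.le] at hadj
        exact (hF.uf_only i h''.le hadj).2
      · exact absurd hadj (hup _ (.inl (hhv i h'' h')))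
    · exact absurd hadj (hup _ (.inr (hhv' i h' hi)))

end
end frame

/-! ### Contacts of the foot of the leg with a spine. -/

section frame
variable {G : SimpleGraph V} {f u t g y : ℕ → V} {m k a mt n q my : ℕ} {X B₁ B S₁ S₃ : Set V}

theorem IsFrame.gX (hF : G.IsFrame f u t g y m k a mt n q my X B₁ B S₁ S₃) {j : ℕ} (hj : j < n) :
    g j ∈ X := by
  rcases Nat.eq_zero_or_pos j with rfl | h
  · rw [← hF.lol.join]
    rcases Nat.eq_zero_or_pos mt with h | h
    · rw [h]; exact hF.t0
    · exact hF.B₁X (hF.tB mt le_rfl h)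
  · exact hF.B₁X (hF.gB j hj h)

theorem IsFrame.fm_mem (hF : G.IsFrame f u t g y m k a mt n q my X B₁ B S₁ S₃) : f m ∈ S₁ := by
  obtain ⟨v, N, -, hv0, -, hN, -, hvS⟩ := hF.left 0
  rw [← hv0]; exact hvS 0 (by omega)

theorem IsFrame.tX (hF : G.IsFrame f u t g y m k a mt n q my X B₁ B S₁ S₃) {i : ℕ} (hi : i ≤ mt) :
    t i ∈ X := by
  rcases Nat.eq_zero_or_pos i with rfl | h
  · exact hF.t0
  · exact hF.B₁X (hF.tB i hi h)

theorem IsFrame.yX (hF : G.IsFrame f u t g y m k a mt n q my X B₁ B S₁ S₃) {i : ℕ} (hi : i ≤ my) :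
    y i ∈ X := by
  rcases Nat.eq_zero_or_pos i with rfl | h
  · have := hF.lol.le_sub
    rw [hF.y0]; exact hF.gX (by omega)
  · exact hF.B₁X (hF.BB (hF.yB i hi h))

theorem IsFrame.g_outside (hF : G.IsFrame f u t g y m k a mt n q my X B₁ B S₁ S₃) {j : ℕ}
    (hj : j < n) (hj0 : 0 < j) (hjq : j ≠ q) :
    g j ∉ outside f m S₁ S₃ ∧ ∀ x ∈ outside f m S₁ S₃, ¬ G.Adj (g j) x := by
  have hB := hF.gB j hj hj0
  have hX := hF.gX hj
  constructor
  · rintro ((⟨i, hi, e⟩ | h) | h)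
    · exact hF.fX i hi (e ▸ hX)
    · exact ((hF.S₁B _ h).2 _ hB).1 rfl
    · exact hF.lol.gB j hj (hF.S₃B h)
  · rintro x ((⟨i, hi, rfl⟩ | h) | h) hadj
    · rcases Nat.eq_zero_or_pos i with rfl | h0
      · exact hF.rg j hj hadj.symm
      · rcases hi.lt_or_eq with h | rfl
        · exact hF.faX i h h0 _ hX hadj.symm
        · exact ((hF.S₁B _ hF.fm_mem).2 _ hB).2 hadj.symm
    · exact ((hF.S₁B _ h).2 _ hB).2 hadj.symm
    · exact hF.lol.antig j hj hjq x (hF.S₃B h) hadj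

open Classical in
/-- The two-contact argument for a frame. -/
theorem IsFrame.no_pair (hF : G.IsFrame f u t g y m k a mt n q my X B₁ B S₁ S₃) (hG : G.TPerfect)
    {s : ℕ → V} {K : ℕ} (hs : G.IsSide g n q s K) {A D : Set V}
    (hub : ∀ k' ≤ k, G.IsHub (A ∪ {x | ∃ i ≤ k', i % 2 ≠ 0 % 2 ∧ x = u i})
      (D ∪ {x | ∃ i ≤ k', i % 2 = 0 % 2 ∧ x = u i}))
    (hAD : ∀ x ∈ A ∪ D, ∃ j < n, 0 < j ∧ j ≠ q ∧ x = g j)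
    (hw : ∀ x ∈ A ∪ D, ∀ i ≤ mt + K + my, x ≠ spine t mt s K y i)
    (hAw : ∀ x ∈ A, ∀ i ≤ mt + K + my, ¬ G.Adj x (spine t mt s K y i))
    {I : Set ℕ} {x₀ : ℕ} (hI : ∀ i ∈ I, i = x₀) (hx₀ : x₀ ≤ mt + K + my) {v : V}
    (hv : I.Nonempty → (∀ x ∈ D, ¬ G.Adj x (spine t mt s K y x₀)) ∧
      ¬ G.Adj (u 0) (spine t mt s K y x₀) ∧ v ∉ A ∪ D ∧ (∃ j < n, 0 < j ∧ j ≠ q ∧ v = g j) ∧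
      (∀ i ≤ mt + K + my, v ≠ spine t mt s K y i) ∧ (∀ x ∈ A, ¬ G.Adj x v) ∧
      G.Adj v (spine t mt s K y x₀) ∧ ∀ i ≤ mt + K + my, G.Adj v (spine t mt s K y i) → i = x₀)
    {x₁ x₂ : ℕ} (h12 : x₁ < x₂) (h2 : x₂ ≤ mt + K + my)
    (con : ∀ i, i = x₁ ∨ i = x₂ → ∃ x ∈ D ∪ {u 0},
      G.Adj x (if i ∈ I then v else spine t mt s K y i))
    (odd : (x₂ - x₁ + (if x₁ ∈ I then 1 else 0) + (if x₂ ∈ I then 1 else 0)) % 2 = 1) : False := by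
  have hADX : ∀ x ∈ A ∪ D, x ∈ X := fun x hx => by
    obtain ⟨j, hj, -, -, rfl⟩ := hAD x hx; exact hF.gX hj
  refine hG.no_pair (hF.rims hs) ?_ ?_ hF.upath ?_ ?_ hub ?_ hw hAw ?_ ?_ hI hx₀ (v := v) ?_ h12 h2
    con odd
  · rintro j hj ((⟨i, hi, e⟩ | h) | h)
    · exact hF.uf_ne j hj i hi e
    · rcases hF.S₁X _ h with h | h
      · exact hF.uX j hj h
      · exact hF.uf_ne j hj m le_rfl h
    · exact hF.uX j hj (hF.S₃X h)
  · rintro j hj x ((⟨i, hi, rfl⟩ | h) | h)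
    · exact hF.uf_anti j hj i hi
    · exact hF.u_outside hj.le x (.inl h)
    · exact hF.u_outside hj.le x (.inr h)
  · exact fun j hj i hi e => hF.uX j hj (e ▸ hF.spine_X hs hi)
  · exact fun j hj h0 i hi => hF.uaX j hj h0 _ (hF.spine_X hs hi)
  · intro x hx
    obtain ⟨j, hj, hj0, hjq, rfl⟩ := hAD x hx
    exact hF.g_outside hj hj0 hjq
  · exact fun x hx j hj e => hF.uX j hj (e ▸ hADX x hx)
  · exact fun x hx j hj h0 hadj => hF.uaX j hj h0 x (hADX x hx) hadj.symm
  · intro hne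
    obtain ⟨v1, v2, v3, ⟨j, hj, hj0, hjq, rfl⟩, v5, v6, v7, v8⟩ := hv hne
    exact ⟨v1, v2, v3, fun i hi e => hF.uX i hi (e ▸ hF.gX hj), v5, (hF.g_outside hj hj0 hjq).1, v6,
      fun i hi h0 => hF.uaX i hi h0 _ (hF.gX hj), v7, v8, (hF.g_outside hj hj0 hjq).2⟩

theorem IsFrame.leg_hub (hF : G.IsFrame f u t g y m k a mt n q my X B₁ B S₁ S₃) :
    ∀ k' ≤ k, G.IsHub (∅ ∪ {x | ∃ i ≤ k', i % 2 ≠ 0 % 2 ∧ x = u i})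
      (∅ ∪ {x | ∃ i ≤ k', i % 2 = 0 % 2 ∧ x = u i}) := by
  intro k' hk'
  rw [Set.empty_union, Set.empty_union]
  exact (hF.upath.mono hk').hub 0

/-- All contacts of the foot of the leg on a spine have the same parity. -/
theorem IsFrame.same_parity (hF : G.IsFrame f u t g y m k a mt n q my X B₁ B S₁ S₃)
    (hG : G.TPerfect) {s : ℕ → V} {K : ℕ} (hs : G.IsSide g n q s K) {x₁ x₂ : ℕ}
    (h1 : x₁ ≤ mt + K + my) (h2 : x₂ ≤ mt + K + my) (c1 : G.Adj (u 0) (spine t mt s K y x₁))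
    (c2 : G.Adj (u 0) (spine t mt s K y x₂)) : x₁ % 2 = x₂ % 2 := by
  have main : ∀ x₁ x₂, x₁ < x₂ → x₂ ≤ mt + K + my → G.Adj (u 0) (spine t mt s K y x₁) →
      G.Adj (u 0) (spine t mt s K y x₂) → x₁ % 2 = x₂ % 2 := by
    intro x₁ x₂ h12 h2 c1 c2
    by_contra hne
    -- The leg alone is the hub: two contacts at odd distance and the attachment at `f a` would make
    -- three.
    refine hF.no_pair hG hs (A := ∅) (D := ∅) hF.leg_hub (by simp) (by simp) (by simp) (I := ∅)
      (x₀ := 0) (by simp) (Nat.zero_le _) (v := u 0) (fun h => by simp at h) h12 h2 ?_ ?_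
    · rintro i (rfl | rfl)
      · exact ⟨u 0, .inr rfl, by simpa using c1⟩
      · exact ⟨u 0, .inr rfl, by simpa using c2⟩
    · simp only [Set.mem_empty_iff_false, if_false]; omega
  rcases lt_trichotomy x₁ x₂ with h | h | h
  · exact main x₁ x₂ h h2 c1 c2
  · rw [h]
  · exact (main x₂ x₁ h h1 c2 c1).symm

end frame

/-! ### Virtual contacts through the near side of the hole. -/

section frame
variable {G : SimpleGraph V} {f u t g y : ℕ → V} {m k a mt n q my : ℕ} {X B₁ B S₁ S₃ : Set V}

/-- The far side of the hole. -/
def farSide (g : ℕ → V) (n : ℕ) (i : ℕ) : V := if i = 0 then g 0 else g (n - i)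

theorem IsFrame.near_side (hF : G.IsFrame f u t g y m k a mt n q my X B₁ B S₁ S₃) :
    G.IsSide g n q g q := by
  have h1 := hF.lol.six_le
  have h2 := hF.lol.le_sub
  exact ⟨hF.lol.hole.indPath h2, rfl, rfl, by omega, fun i hi h0 => ⟨i, by omega, by omega,
    by omega, rfl⟩⟩

theorem IsFrame.far_side (hF : G.IsFrame f u t g y m k a mt n q my X B₁ B S₁ S₃) :
    G.IsSide g n q (farSide g n) (n - q) := by
  have h1 := hF.lol.six_le
  have h2 := hF.lol.le_sub
  refine ⟨hF.lol.hole.reverse.indPath (by omega), rfl, ?_, by omega, fun i hi h0 => ⟨n - i,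
    by omega, by omega, by omega, if_neg (by omega)⟩⟩
  rw [farSide, if_neg (by omega), show n - (n - q) = q by omega]

/-- Adjacencies between the interior of the near side and the far spine. -/
theorem IsFrame.near_far (hF : G.IsFrame f u t g y m k a mt n q my X B₁ B S₁ S₃) {b i : ℕ}
    (hb0 : 0 < b) (hbq : b < q) (hi : i ≤ mt + (n - q) + my) :
    g b ≠ spine t mt (farSide g n) (n - q) y i ∧
    (G.Adj (g b) (spine t mt (farSide g n) (n - q) y i) →
      (b = 1 ∧ i = mt) ∨ (b + 1 = q ∧ i = mt + (n - q))) := by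
  have h1 := hF.lol.six_le
  have h2 := hF.lol.le_sub
  have hh := hF.lol.hole
  rcases (by omega : i < mt ∨ i = mt ∨ (mt < i ∧ i < mt + (n - q)) ∨ i = mt + (n - q) ∨
    mt + (n - q) < i) with h | h | h | h | h
  · rw [spine_of_le h.le]
    have := hF.lol.cross i h b (by omega)
    exact ⟨this.1.symm, fun hadj => by have := (this.2 hadj.symm).2; omega⟩
  · rw [h, spine_of_le le_rfl, hF.lol.join]
    refine ⟨fun e => ?_, fun hadj => ?_⟩
    · have := hh.inj b 0 (by omega) (by omega) e; omega
    · have := hh.ind 0 b hb0 (by omega) hadj.symm; omega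
  · have e : spine t mt (farSide g n) (n - q) y i = g (n - (i - mt)) := by
      have := hF.spine_s hF.far_side (i := i - mt) (by omega)
      rw [show mt + (i - mt) = i by omega] at this
      rw [this, farSide, if_neg (by omega)]
    rw [e]
    refine ⟨fun e => ?_, fun hadj => ?_⟩
    · have := hh.inj b _ (by omega) (by omega) e; omega
    · have := hh.ind b _ (by omega) (by omega) hadj; omega
  · have e : spine t mt (farSide g n) (n - q) y i = g q := by
      have := hF.spine_s hF.far_side (i := n - q) le_rfl
      rw [h, this, hF.far_side.last]
    rw [e]
    refine ⟨fun e => ?_, fun hadj => ?_⟩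
    · have := hh.inj b q (by omega) (by omega) e; omega
    · have := hh.ind b q hbq (by omega) hadj; omega
  · have e : spine t mt (farSide g n) (n - q) y i = y (i - (mt + (n - q))) := by
      rw [← hF.spine_y hF.far_side]; congr 1; omega
    rw [e]
    have hyB := hF.yB (i - (mt + (n - q))) (by omega) (by omega)
    exact ⟨fun e => hF.lol.gB b (by omega) (e ▸ hyB), fun hadj =>
      absurd hadj (hF.lol.antig b (by omega) (by omega) _ hyB)⟩

/-- Contact from the foot of the leg to the far spine through the near side. -/
theorem IsFrame.no_virtual (hF : G.IsFrame f u t g y m k a mt n q my X B₁ B S₁ S₃)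
    (hG : G.TPerfect) {s : ℕ → V} (hs : G.IsIndPath s q)
    (hsg : ∀ b, 0 < b → b < q → ∃ j, 0 < j ∧ j < q ∧ s b = g j)
    {x₀ : ℕ} (hx₀ : x₀ ≤ mt + (n - q) + my)
    (hsx : spine t mt (farSide g n) (n - q) y x₀ = s 0)
    (hsw : ∀ b, 0 < b → b + 1 < q → ∀ i ≤ mt + (n - q) + my,
      G.Adj (s b) (spine t mt (farSide g n) (n - q) y i) → b = 1 ∧ i = x₀)
    (hodd : ∀ b ≤ q, G.Adj (u 0) (s b) → b % 2 = 1)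
    {e₀ : ℕ} (he₀ : e₀ + 3 ≤ q) (hue₀ : G.Adj (u 0) (s e₀))
    {x : ℕ} (hx : x ≤ mt + (n - q) + my) (hne : x ≠ x₀) (hpar : x % 2 = x₀ % 2)
    (hit : G.Adj (u 0) (spine t mt (farSide g n) (n - q) y x)) : False := by
  classical
  have hq6 := hF.lol.six_le
  have hqn := hF.lol.le_sub
  have hsX : ∀ b, 0 < b → b < q → s b ∈ X := fun b h0 hb => by
    obtain ⟨j, -, hj, e⟩ := hsg b h0 hb
    rw [e]; exact hF.gX (by omega)
  -- The hub is the leg, enlarged by `s 2, …, s e` up to the first contact e of the foot, unless e =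
  -- 1. As e is odd, `s e` lies on the side opposite to `u 0`, and `s 2`, which sees `s 1`, on the
  -- same side as `u 0`.
  obtain ⟨A, D, hub, hA, hD, hcon⟩ : ∃ A D : Set V,
      (∀ k' ≤ k, G.IsHub (A ∪ {x | ∃ i ≤ k', i % 2 ≠ 0 % 2 ∧ x = u i})
        (D ∪ {x | ∃ i ≤ k', i % 2 = 0 % 2 ∧ x = u i})) ∧
      (∀ x ∈ A, ∃ b, 3 ≤ b ∧ b + 3 ≤ q ∧ x = s b) ∧ (∀ x ∈ D, ∃ b, 2 ≤ b ∧ b + 3 ≤ q ∧ x = s b) ∧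
      ∃ x ∈ D ∪ {u 0}, G.Adj x (s 1) := by
    have hex : ∃ e, G.Adj (u 0) (s e) := ⟨e₀, hue₀⟩
    have hle : Nat.find hex ≤ e₀ := Nat.find_le hue₀
    have hadj := Nat.find_spec hex
    set e := Nat.find hex with he
    have heo := hodd e (by omega) hadj
    rcases (by omega : e = 1 ∨ 3 ≤ e) with h1 | h3
    · exact ⟨∅, ∅, hF.leg_hub, by simp, by simp, u 0, .inr rfl, h1 ▸ hadj⟩
    have hpath : G.IsIndPath (fun i => s (2 + i)) (e - 2) :=
      (hs.drop (a := 2) (by omega)).mono (by omega)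
    refine ⟨_, _, fun k' hk' => (hpath.hub 0).join ((hF.upath.mono hk').hub 0) ?_ ?_ ?_ ?_, ?_, ?_,
      ?_⟩
    · rw [Set.disjoint_left]
      intro z hz hz'
      have h1 : z ∈ X := by
        rcases hz with ⟨i, hi, -, rfl⟩ | ⟨i, hi, -, rfl⟩ <;> exact hsX _ (by omega) (by omega)
      rcases hz' with ⟨i, hi, -, rfl⟩ | ⟨i, hi, -, rfl⟩ <;> exact hF.uX i (by omega) h1
    · rintro z ⟨i, hi, -, rfl⟩ z' ⟨j, hj, hjp, rfl⟩ hadj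
      exact hF.uaX j (by omega) (by omega) _ (hsX _ (by omega) (by omega)) hadj.symm
    · rintro z ⟨i, hi, hip, rfl⟩ z' ⟨j, hj, hjp, rfl⟩ hadj
      rcases Nat.eq_zero_or_pos j with rfl | hj0
      · have := hodd _ (by omega) hadj.symm; omega
      · exact hF.uaX j (by omega) hj0 _ (hsX _ (by omega) (by omega)) hadj.symm
    · refine ⟨s e, .inl ⟨e - 2, le_rfl, by omega, ?_⟩, u 0, .inr ⟨0, by omega, rfl, rfl⟩,
        hadj.symm⟩
      congr 1; omega
    · rintro z ⟨i, hi, hip, rfl⟩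
      exact ⟨2 + i, by omega, by omega, rfl⟩
    · rintro z ⟨i, hi, hip, rfl⟩
      exact ⟨2 + i, by omega, by omega, rfl⟩
    · exact ⟨s 2, .inl ⟨0, by omega, rfl, rfl⟩, (hs.adj 1 (by omega)).symm⟩
  have hAD : ∀ x ∈ A ∪ D, ∃ b, 2 ≤ b ∧ b + 3 ≤ q ∧ x = s b := by
    rintro x (h | h)
    · obtain ⟨b, h1, h2, h3⟩ := hA x h; exact ⟨b, by omega, h2, h3⟩
    · exact hD x h
  have hsne : ∀ b, 0 < b → b < q → ∀ i ≤ mt + (n - q) + my,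
      s b ≠ spine t mt (farSide g n) (n - q) y i := by
    intro b h0 hb i hi
    obtain ⟨j, hj0, hj, e⟩ := hsg b h0 hb
    rw [e]; exact (hF.near_far hj0 hj hi).1
  -- The spine is contracted at x₀, with `s 1` as the pendant. This shifts the parity by one, so a
  -- contact x of the same parity as x₀ lies at odd distance.
  obtain ⟨I, hI⟩ : ∃ I : Set ℕ, ∀ i, i ∈ I ↔ i = x₀ := ⟨{x₀}, fun i => Iff.rfl⟩
  have hxI : x ∉ I := fun h => hne ((hI x).1 h)
  have hx₀I : x₀ ∈ I := (hI x₀).2 rfl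
  have hcon1 : ∃ z ∈ D ∪ {u 0}, G.Adj z (if x ∈ I then s 1 else
      spine t mt (farSide g n) (n - q) y x) := by
    refine ⟨u 0, .inr rfl, ?_⟩
    rwa [if_neg hxI]
  have hcon2 : ∃ z ∈ D ∪ {u 0}, G.Adj z (if x₀ ∈ I then s 1 else
      spine t mt (farSide g n) (n - q) y x₀) := by
    rw [if_pos hx₀I]; exact hcon
  have fin : ∀ x₁ x₂, x₁ < x₂ → x₂ ≤ mt + (n - q) + my → (x₁ = x ∧ x₂ = x₀ ∨ x₁ = x₀ ∧ x₂ = x) →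
      False := by
    intro x₁ x₂ h12 h2 hc
    refine hF.no_pair hG hF.far_side hub ?_ ?_ ?_ (I := I) (x₀ := x₀) (fun i hi => (hI i).1 hi) hx₀
      (v := s 1) (fun _ => ⟨?_, ?_, ?_, ?_, ?_, ?_, ?_, ?_⟩) h12 h2 ?_ ?_
    · intro z hz
      obtain ⟨b, hb2, hb3, rfl⟩ := hAD z hz
      obtain ⟨j, hj0, hj, e⟩ := hsg b (by omega) (by omega)
      exact ⟨j, by omega, hj0, by omega, e⟩
    · intro z hz
      obtain ⟨b, hb2, hb3, rfl⟩ := hAD z hz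
      exact hsne b (by omega) (by omega)
    · intro z hz i hi hadj
      obtain ⟨b, hb2, hb3, rfl⟩ := hA z hz
      have := hsw b (by omega) (by omega) i hi hadj
      omega
    · intro z hz hadj
      obtain ⟨b, hb2, hb3, rfl⟩ := hD z hz
      have := hsw b (by omega) (by omega) _ hx₀ hadj
      omega
    · intro hadj
      rw [hsx] at hadj
      have := hodd 0 (by omega) hadj
      omega
    · intro hz
      obtain ⟨b, hb2, hb3, e⟩ := hAD _ hz
      have := hs.inj 1 b (by omega) (by omega) e
      omega
    · obtain ⟨j, hj0, hj, e⟩ := hsg 1 (by omega) (by omega)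
      exact ⟨j, by omega, hj0, by omega, e⟩
    · exact hsne 1 (by omega) (by omega)
    · intro z hz hadj
      obtain ⟨b, hb2, hb3, rfl⟩ := hA z hz
      have := hs.ind 1 b (by omega) (by omega) hadj.symm
      omega
    · rw [hsx]; exact (hs.adj 0 (by omega)).symm
    · exact fun i hi hadj => (hsw 1 (by omega) (by omega) i hi hadj).2
    · rintro i hi
      rcases hc with ⟨rfl, rfl⟩ | ⟨rfl, rfl⟩ <;> rcases hi with rfl | rfl
      · exact hcon1
      · exact hcon2
      · exact hcon2
      · exact hcon1
    · rcases hc with ⟨rfl, rfl⟩ | ⟨rfl, rfl⟩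
      · rw [if_neg hxI, if_pos hx₀I]; omega
      · rw [if_pos hx₀I, if_neg hxI]; omega
  rcases lt_or_gt_of_ne hne with h | h
  · exact fin x x₀ h hx₀ (.inl ⟨rfl, rfl⟩)
  · exact fin x₀ x h hx (.inr ⟨rfl, rfl⟩)

/-- The foot of the leg has no neighbour on `t` and `y`. -/
theorem IsFrame.misses (hF : G.IsFrame f u t g y m k a mt n q my X B₁ B S₁ S₃)
    (hG : G.TPerfect) (h3 : G.Adj (u 0) (g 3)) :
    (∀ i ≤ mt, ¬ G.Adj (u 0) (t i)) ∧ ∀ i ≤ my, ¬ G.Adj (u 0) (y i) := by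
  have hq6 := hF.lol.six_le
  have hqn := hF.lol.le_sub
  have hqe := hF.lol.even
  have hno := hF.lol.odd
  -- The contact at `g 3` fixes the parity of all contacts of the foot on the near spine.
  have c3 : G.Adj (u 0) (spine t mt g q y (mt + 3)) := by
    rwa [hF.spine_s hF.near_side (by omega)]
  have hpar : ∀ i ≤ mt + q + my, G.Adj (u 0) (spine t mt g q y i) → i % 2 = (mt + 3) % 2 :=
    fun i hi h => hF.same_parity hG hF.near_side hi (by omega) h c3
  have pt : ∀ i ≤ mt, G.Adj (u 0) (t i) → i % 2 = (mt + 1) % 2 := fun i hi h => by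
    have := hpar i (by omega) (by rwa [spine_of_le hi]); omega
  have pg : ∀ i ≤ q, G.Adj (u 0) (g i) → i % 2 = 1 := fun i hi h => by
    have := hpar (mt + i) (by omega) (by rwa [hF.spine_s hF.near_side hi]); omega
  have py : ∀ i ≤ my, G.Adj (u 0) (y i) → i % 2 = 1 := fun i hi h => by
    have := hpar (mt + q + i) (by omega) (by rwa [hF.spine_y hF.near_side]); omega
  have hgp : G.IsIndPath g q := hF.near_side.path
  -- A neighbour on t is paired with a virtual contact at `g q`, one on y with a virtual contact at
  -- `g 0`. In both cases the parities agree on the far spine because n - q is odd.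
  constructor
  · intro i hi hadj
    have := pt i hi hadj
    have hsub : ∀ b ≤ q, q - (q - b) = b := fun b hb => by omega
    refine hF.no_virtual hG (s := fun b => g (q - b)) hgp.reverse ?_ (x₀ := mt + (n - q))
      (by omega) ?_ ?_ ?_ (e₀ := q - 3) (by omega) ?_ (x := i) (by omega) (by omega) (by omega)
      (by rwa [spine_of_le hi])
    · exact fun b h0 hb => ⟨q - b, by omega, by omega, rfl⟩
    · rw [hF.spine_s hF.far_side le_rfl, hF.far_side.last, Nat.sub_zero]
    · intro b h0 hb i hi hadj
      have := (hF.near_far (b := q - b) (by omega) (by omega) hi).2 hadj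
      omega
    · intro b hb hadj
      have := pg (q - b) (by omega) hadj
      omega
    · simpa only [hsub 3 (by omega)] using h3
  · intro i hi hadj
    have := py i hi hadj
    refine hF.no_virtual hG (s := g) hgp ?_ (x₀ := mt) (by omega) ?_ ?_ pg (e₀ := 3) (by omega)
      h3 (x := mt + (n - q) + i) (by omega) (by omega) (by omega) (by rwa [hF.spine_y hF.far_side])
    · exact fun b h0 hb => ⟨b, h0, hb, rfl⟩
    · rw [spine_of_le le_rfl, hF.lol.join]
    · intro b h0 hb i hi hadj
      have := (hF.near_far h0 (by omega) hi).2 hadj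
      omega

end frame

/-! ### Nonexistence of frames. -/

section frame
variable {G : SimpleGraph V} {f u t g y : ℕ → V} {m k a mt n q my : ℕ} {X B₁ B S₁ S₃ : Set V}

/-- The connection from the end of the hole to `f 0`. -/
theorem IsFrame.right_arm (hF : G.IsFrame f u t g y m k a mt n q my X B₁ B S₁ S₃) (e : ℕ) :
    ∃ v N, G.IsIndPath v N ∧ v 0 = g q ∧ v N = f 0 ∧ 2 ≤ N ∧ N % 2 = e % 2 ∧
      ∀ i < N, 0 < i → v i ∈ B ∧ (v i ∈ S₃ ∨ ∃ j ≤ my, v i = y j) := by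
  obtain ⟨v, N, hv, hv0, hvN, hN, hNe, hvS⟩ := hF.right (e + my)
  refine ⟨catSeq y my v, my + N, hF.ypath.cat hv hv0.symm ?_, ?_, ?_, by omega, by omega, ?_⟩
  · intro i hi j hj hj0
    rcases hj.lt_or_eq with h | rfl
    · have := hF.S₃y _ (hvS j h hj0) i hi
      exact ⟨this.1.symm, fun h => this.2 h.symm⟩
    · rw [hvN]
      exact ⟨fun e => hF.fX 0 (Nat.zero_le _) (e ▸ hF.yX hi.le), fun h => hF.ry i hi.le h.symm⟩
  · rw [catSeq_left (Nat.zero_le _), hF.y0]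
  · rw [catSeq_add hv0.symm, hvN]
  · intro i hi hi0
    rcases le_or_gt i my with h | h
    · rw [catSeq_left h]
      exact ⟨hF.yB i h hi0, .inr ⟨i, h, rfl⟩⟩
    · rw [catSeq_right h.le hv0.symm]
      have := hvS (i - my) (by omega) (by omega)
      exact ⟨hF.S₃B this, .inl this⟩

/-- The connection from `f m` to the start of the hole. -/
theorem IsFrame.left_arm (hF : G.IsFrame f u t g y m k a mt n q my X B₁ B S₁ S₃) (e : ℕ) :
    ∃ v N, G.IsIndPath v N ∧ v 0 = f m ∧ v N = g 0 ∧ 3 ≤ N ∧ N % 2 = e % 2 ∧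
      ∀ i < N, v i ∈ S₁ ∨ ∃ j < mt, v i = t j := by
  obtain ⟨v, N, hv, hv0, hvN, hN, hNe, hvS⟩ := hF.left (e + mt)
  refine ⟨catSeq v N t, N + mt, hv.cat hF.lol.path hvN ?_, ?_, ?_, by omega, by omega, ?_⟩
  · intro i hi j hj hj0
    exact (hF.S₁B _ (hvS i hi)).2 _ (hF.tB j hj hj0)
  · rw [catSeq_left (Nat.zero_le _), hv0]
  · rw [catSeq_add hvN, hF.lol.join]
  · intro i hi
    rcases lt_or_ge i N with h | h
    · rw [catSeq_left h.le]; exact .inl (hvS i h)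
    · rw [catSeq_right h hvN]; exact .inr ⟨i - N, by omega, rfl⟩

/-- The hub is the path that starts next to `g q` on the right arm, follows `f`, and ends next to `g
0` on the left arm, with the leg attached at `f a`. It touches the hole at 0, 3 and `q`, and the
arcs 3, q - 3 and n - q are all odd. `IsFrame.misses` ensures that the foot of the leg has no
neighbour on the arms. -/
theorem IsFrame.contradiction (hF : G.IsFrame f u t g y m k a mt n q my X B₁ B S₁ S₃)
    (hG : G.TPerfect) (h3 : G.Adj (u 0) (g 3)) : False := by
  obtain ⟨mist, misy⟩ := hF.misses hG h3
  have hq6 := hF.lol.six_le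
  have hqn := hF.lol.le_sub
  have hqe := hF.lol.even
  have hno := hF.lol.odd
  -- The arm parities below make L even, so both ends of the long path are in class D, and they put
  -- `f a` and `u k` in opposite classes. Thus path and leg join to a hub with `u 0` in D as well.
  have ha := hF.a_pos
  have ham := hF.a_lt
  obtain ⟨x, M, hx, hx0, hxM, hM, hMe, hxS⟩ := hF.right_arm (k + a)
  obtain ⟨v, N, hv, hv0, hvN, hN, hNe, hvS⟩ := hF.left_arm (k + m + a)
  have hxX : ∀ i < M, 0 < i → x i ∈ X := fun i hi h0 => hF.B₁X (hF.BB (hxS i hi h0).1)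
  have hvX : ∀ i < N, 0 < i → v i ∈ X := by
    intro i hi h0
    rcases hvS i hi with h | ⟨j, hj, e⟩
    · rcases hF.S₁X _ h with h | h
      · exact h
      · have := hv.inj i 0 hi.le (by omega) (h.trans hv0.symm); omega
    · rw [e]; exact hF.tX hj.le
  -- the long path from the end of the hole to its start
  have hx1 : G.IsIndPath (fun i => x (1 + i)) (M - 1) := hx.drop (by omega)
  have hj1 : (fun i => x (1 + i)) (M - 1) = f 0 := by
    rw [← hxM]; simp only; congr 1; omega
  have hT1 : G.IsIndPath (catSeq (fun i => x (1 + i)) (M - 1) f) (M - 1 + m) := by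
    refine hx1.cat hF.fpath hj1 fun i hi j hj hj0 => ?_
    have hB := (hxS (1 + i) (by omega) (by omega)).1
    rcases hj.lt_or_eq with h | rfl
    · exact ⟨fun e => hF.fX j hj (e ▸ hF.B₁X (hF.BB hB)), fun hadj =>
        hF.faX j h hj0 _ (hF.B₁X (hF.BB hB)) hadj.symm⟩
    · have := (hF.S₁B _ hF.fm_mem).2 _ (hF.BB hB)
      exact ⟨this.1.symm, fun h => this.2 h.symm⟩
  have hj2 : catSeq (fun i => x (1 + i)) (M - 1) f (M - 1 + m) = v 0 := by
    rw [catSeq_add (f := fun i => x (1 + i)) hj1, hv0]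
  have hT : G.IsIndPath (catSeq (catSeq (fun i => x (1 + i)) (M - 1) f) (M - 1 + m) v)
      (M - 1 + m + (N - 1)) := by
    refine hT1.cat (hv.mono (by omega)) hj2 fun i hi j hj hj0 => ?_
    have hX := hvX j (by omega) hj0
    rcases lt_or_ge i (M - 1) with h | h
    · rw [catSeq_left h.le]
      have hB := (hxS (1 + i) (by omega) (by omega)).1
      rcases hvS j (by omega) with hS | ⟨b, hb, e⟩
      · have := (hF.S₁B _ hS).2 _ (hF.BB hB)
        exact ⟨this.1.symm, fun h => this.2 h.symm⟩
      · rw [e]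
        exact ⟨fun e => hF.lol.zB b hb.le (e ▸ hB), fun hadj =>
          hF.lol.antiz b hb.le _ hB hadj.symm⟩
    · rw [catSeq_right h hj1]
      refine ⟨fun e => hF.fX _ (by omega) (e ▸ hX), fun hadj => ?_⟩
      rcases Nat.eq_zero_or_pos (i - (M - 1)) with h0 | h0
      · rw [h0] at hadj
        rcases hvS j (by omega) with hS | ⟨b, hb, e⟩
        · exact hF.rS₁ _ hS hadj
        · exact hF.rt b hb.le (e ▸ hadj)
      · exact hF.faX _ (by omega) h0 _ hX hadj
  set T := catSeq (catSeq (fun i => x (1 + i)) (M - 1) f) (M - 1 + m) v with hTdef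
  set L := M - 1 + m + (N - 1) with hL
  have hcase : ∀ i ≤ L, (i < M - 1 ∧ T i = x (1 + i)) ∨
      (∃ j ≤ m, i = M - 1 + j ∧ T i = f j) ∨
      ∃ j < N, 0 < j ∧ i = M - 1 + m + j ∧ T i = v j := by
    intro i hi
    rcases (by omega : i < M - 1 ∨ (M - 1 ≤ i ∧ i ≤ M - 1 + m) ∨ M - 1 + m < i) with h | h | h
    · exact .inl ⟨h, by rw [hTdef, catSeq_left (by omega), catSeq_left h.le]⟩
    · exact .inr (.inl ⟨i - (M - 1), by omega, by omega, by
        rw [hTdef, catSeq_left h.2, catSeq_right h.1 hj1]⟩)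
    · exact .inr (.inr ⟨i - (M - 1 + m), by omega, by omega, by omega, by
        rw [hTdef, catSeq_right h.le hj2]⟩)
  have hT0 : T 0 = x 1 := by
    rw [hTdef, catSeq_left (by omega), catSeq_left (by omega)]
  have hTL : T L = v (N - 1) := by rw [hTdef, hL, catSeq_add hj2]
  have hTa : T (M - 1 + a) = f a := by
    rw [hTdef, catSeq_left (by omega), catSeq_add (f := fun i => x (1 + i)) hj1]
  clear_value T
  -- the path against the leg
  have hTu : ∀ i ≤ L, ∀ j ≤ k, T i ≠ u j ∧
      (G.Adj (T i) (u j) → j = k ∧ (i = M - 1 + a ∨ i = M - 1 + a + 2)) := by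
    intro i hi j hj
    rcases hcase i hi with ⟨h, e⟩ | ⟨b, hb, hib, e⟩ | ⟨b, hb, hb0, hib, e⟩
    · rw [e]
      have hX := hxX (1 + i) (by omega) (by omega)
      refine ⟨fun e => hF.uX j hj (e ▸ hX), fun hadj => ?_⟩
      exfalso
      rcases Nat.eq_zero_or_pos j with rfl | h0
      · rcases (hxS (1 + i) (by omega) (by omega)).2 with hS | ⟨c, hc, e'⟩
        · exact hF.pS₃ _ hS hadj.symm
        · exact misy c hc (e' ▸ hadj.symm)
      · exact hF.uaX j hj h0 _ hX hadj.symm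
    · rw [e]
      refine ⟨(hF.uf_ne j hj b hb).symm, fun hadj => ?_⟩
      rcases hj.lt_or_eq with h | rfl
      · exact absurd hadj.symm (hF.uf_anti j h b hb)
      · have := (hF.uf_only b hb hadj.symm).2
        omega
    · rw [e]
      have hX := hvX b hb hb0
      refine ⟨fun e => hF.uX j hj (e ▸ hX), fun hadj => ?_⟩
      exfalso
      rcases Nat.eq_zero_or_pos j with rfl | h0
      · rcases hvS b hb with hS | ⟨c, hc, e'⟩
        · exact hF.pS₁ _ hS hadj.symm
        · exact mist c hc.le (e' ▸ hadj.symm)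
      · exact hF.uaX j hj h0 _ hX hadj.symm
  -- the path against the hole
  have hTg : ∀ i ≤ L, ∀ j < n, T i ≠ g j ∧ (G.Adj (T i) (g j) → i = 0 ∨ i = L) := by
    intro i hi j hj
    rcases hcase i hi with ⟨h, e⟩ | ⟨b, hb, hib, e⟩ | ⟨b, hb, hb0, hib, e⟩
    · rw [e]
      have hB := (hxS (1 + i) (by omega) (by omega)).1
      refine ⟨fun e => hF.lol.gB j hj (e ▸ hB), fun hadj => ?_⟩
      by_cases hjq : j = q
      · rw [hjq, ← hx0] at hadj
        have := hx.ind 0 (1 + i) (by omega) (by omega) hadj.symm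
        omega
      · exact absurd hadj.symm (hF.lol.antig j hj hjq _ hB)
    · rw [e]
      refine ⟨fun e => hF.fX b hb (e ▸ hF.gX hj), fun hadj => ?_⟩
      exfalso
      rcases Nat.eq_zero_or_pos b with rfl | h0
      · exact hF.rg j hj hadj
      · rcases hb.lt_or_eq with h | rfl
        · exact hF.faX b h h0 _ (hF.gX hj) hadj
        · rcases Nat.eq_zero_or_pos j with rfl | hj0
          · rw [← hvN, ← hv0] at hadj
            have := hv.ind 0 N (by omega) le_rfl hadj
            omega
          · exact ((hF.S₁B _ hF.fm_mem).2 _ (hF.gB j hj hj0)).2 hadj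
    · rw [e]
      rcases Nat.eq_zero_or_pos j with rfl | hj0
      · rw [← hvN]
        refine ⟨fun e => ?_, fun hadj => ?_⟩
        · have := hv.inj b N hb.le le_rfl e; omega
        · have := hv.ind b N hb le_rfl hadj; omega
      · rcases hvS b hb with hS | ⟨c, hc, e'⟩
        · have := (hF.S₁B _ hS).2 _ (hF.gB j hj hj0)
          exact ⟨this.1, fun h => absurd h this.2⟩
        · rw [e']
          have := hF.lol.cross c hc j hj
          exact ⟨this.1, fun h => by have := (this.2 h).2; omega⟩
  have hLe : L % 2 = 0 := by omega
  have hub := (hT.hub 0).join (hF.upath.hub 0) (by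
      rw [Set.disjoint_left]
      rintro z (⟨i, hi, -, rfl⟩ | ⟨i, hi, -, rfl⟩) (⟨j, hj, -, e⟩ | ⟨j, hj, -, e⟩) <;>
        exact (hTu i hi j hj).1 e)
    (by
      rintro z ⟨i, hi, hip, rfl⟩ z' ⟨j, hj, hjp, rfl⟩ hadj
      have := (hTu i hi j hj).2 hadj
      omega)
    (by
      rintro z ⟨i, hi, hip, rfl⟩ z' ⟨j, hj, hjp, rfl⟩ hadj
      have := (hTu i hi j hj).2 hadj
      omega)
    (by
      refine ⟨T (M - 1 + a), ?_, u k, ?_, by rw [hTa]; exact hF.uf_adj.symm⟩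
      · rcases Nat.mod_two_eq_zero_or_one (M - 1 + a) with h | h
        · exact .inr ⟨_, by omega, by omega, rfl⟩
        · exact .inl ⟨_, by omega, by omega, rfl⟩
      · rcases Nat.mod_two_eq_zero_or_one k with h | h
        · exact .inr ⟨_, le_rfl, by omega, rfl⟩
        · exact .inl ⟨_, le_rfl, by omega, rfl⟩)
  refine hG.no_three_hits hF.lol.hole hno hub (a := 0) (b := 3) (c := q) ?_ ?_ (by omega) (by omega)
    (by omega) (by omega) (by omega) ?_ ?_ ?_
  · rintro j hj ((⟨i, hi, -, e⟩ | ⟨i, hi, -, e⟩) | (⟨i, hi, -, e⟩ | ⟨i, hi, -, e⟩))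
    · exact (hTg i hi j hj).1 e.symm
    · exact hF.uX i hi (e ▸ hF.gX hj)
    · exact (hTg i hi j hj).1 e.symm
    · exact hF.uX i hi (e ▸ hF.gX hj)
  · rintro j hj z (⟨i, hi, hip, rfl⟩ | ⟨i, hi, hip, rfl⟩) hadj
    · have := (hTg i hi j hj).2 hadj; omega
    · exact hF.uaX i hi (by omega) _ (hF.gX hj) hadj
  · refine ⟨T L, .inl ⟨L, le_rfl, by omega, rfl⟩, ?_⟩
    rw [hTL, ← hvN]
    have := hv.adj (N - 1) (by omega)
    rwa [show N - 1 + 1 = N by omega] at this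
  · exact ⟨u 0, .inr ⟨0, by omega, rfl, rfl⟩, h3⟩
  · refine ⟨T 0, .inl ⟨0, by omega, rfl, rfl⟩, ?_⟩
    rw [hT0, ← hx0]
    exact (hx.adj 0 (by omega)).symm

end frame

/-! ### Bounding the chromatic number of a level. -/

section floor
variable {G : SimpleGraph V}

/-- Connections of both parities from the start of the hole of a lollipop to a vertex attached to
its head. -/
theorem IsLolli.exists_tail {z g : ℕ → V} {m n q : ℕ} {B : Set V} (hL : G.IsLolli z m g n q B)
    {r : V} (hr : ∃ x ∈ B, G.Adj r x) (hrg : ∀ j < n, r ≠ g j ∧ ¬ G.Adj r (g j)) (e : ℕ) :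
    ∃ v N, G.IsIndPath v N ∧ v 0 = g 0 ∧ v N = r ∧ 2 ≤ N ∧ N % 2 = e % 2 ∧
      ∀ i < N, 0 < i → (∃ j < n, 0 < j ∧ v i = g j) ∨ v i ∈ B := by
  have h1 := hL.six_le
  have h2 := hL.le_sub
  obtain ⟨u, k, hu, hu0, huk, huQ, -⟩ := exists_indPath (G := G)
    (Q := {x | x = g q ∨ x ∈ B ∨ x = r}) (T := {r}) (u := g q) (by
      obtain ⟨x, hx, hax⟩ := hL.att
      obtain ⟨y, hy, hay⟩ := hr
      obtain ⟨p, hp⟩ := hL.conn x hx y hy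
      refine ⟨r, rfl, .cons hax (p.append (.cons hay.symm .nil)), ?_⟩
      intro w hw
      simp only [Walk.support_cons, List.mem_cons, Walk.mem_support_append_iff,
        Walk.support_nil, List.not_mem_nil, or_false] at hw
      rcases hw with rfl | hw | rfl | rfl
      · exact .inl rfl
      · exact .inr (.inl (hp w hw))
      · exact .inr (.inl hy)
      · exact .inr (.inr rfl))
  rw [Set.mem_singleton_iff] at huk
  have huB : ∀ i < k, 0 < i → u i ∈ B := by
    intro i hi hi0
    rcases huQ i hi.le with h | h | h
    · have := hu.inj i 0 (by omega) (by omega) (h.trans hu0.symm); omega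
    · exact h
    · have := hu.inj i k (by omega) (by omega) (h.trans huk.symm); omega
  obtain ⟨w, s, hw, hw0, hws, hse, hs3, hwm, hwi⟩ := hL.side (e + k)
  have hj : w s = u 0 := hws.trans hu0.symm
  refine ⟨catSeq w s u, s + k, hw.cat hu hj ?_, ?_, ?_, by omega, by omega, ?_⟩
  · intro i hi j hjk hj0
    have : ∃ b < n, b ≠ q ∧ w i = g b := by
      rcases Nat.eq_zero_or_pos i with rfl | h0
      · exact ⟨0, by omega, by omega, hw0⟩
      · obtain ⟨b, hb, hbq, -, e⟩ := hwi i hi h0; exact ⟨b, hb, hbq, e⟩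
    obtain ⟨b, hb, hbq, e⟩ := this
    rw [e]
    rcases hjk.lt_or_eq with h | rfl
    · have hB := huB j h hj0
      exact ⟨fun e => hL.gB b hb (e ▸ hB), hL.antig b hb hbq _ hB⟩
    · rw [huk]
      exact ⟨(hrg b hb).1.symm, fun h => (hrg b hb).2 h.symm⟩
  · rw [catSeq_left (Nat.zero_le _), hw0]
  · rw [catSeq_add hj, huk]
  · intro i hi hi0
    rcases lt_trichotomy i s with h | h | h
    · rw [catSeq_left h.le]
      obtain ⟨b, hb, -, hb0, e⟩ := hwi i h hi0
      exact .inl ⟨b, hb, by omega, e⟩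
    · rw [h, catSeq_left le_rfl, hws]
      exact .inl ⟨q, by omega, by omega, rfl⟩
    · rw [catSeq_right h.le hj]
      exact .inr (huB _ (by omega) (by omega))

variable {X R Y : Set V} {l : V → V}

/-- Above a lollipop, only few vertices have a parent hitting the lollipop or near a given
parent. -/
theorem IsFloor.col_dirty (hX : G.IsFloor X R Y l) (hG : G.TPerfect) (hg9 : G.OddGirthGE 9)
    {z g : ℕ → V} {m n q : ℕ} {B : Set V} (hL : G.IsLolli z m g n q B) (hBX : B ⊆ X) {p : V}
    (hp : p ∈ R) (hz : ∀ i ≤ m, z i ∈ X ∨ z i = p) (hgX : ∀ j < n, g j ∈ X ∨ g j = p) :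
    G.Col (B ∩ G.nbrs {r ∈ R | ((∃ i ≤ m, G.Adj r (z i)) ∨ ∃ j < n, G.Adj r (g j)) ∨
      G.Near l p r}) 79 := by
  have c1 := hX.col_lolli hG hg9 hL (R' := {r ∈ R | ((∃ i ≤ m, G.Adj r (z i)) ∨
    ∃ j < n, G.Adj r (g j)) ∧ ¬ G.Near l p r}) (fun r hr => hr.1) hBX
    (fun i hi => by
      rcases hz i hi with h | e
      · exact .inl h
      · rw [e]; exact .inr ⟨hp, fun r hr => hr.2.2⟩)
    (fun i hi => by
      rcases hgX i hi with h | e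
      · exact .inl h
      · rw [e]; exact .inr ⟨hp, fun r hr => hr.2.2⟩)
    (fun r hr => hr.2.1)
  refine (c1.union (hX.col_near hg9 hp)).mono ?_ le_rfl
  rintro x ⟨hx, r, ⟨hr, h⟩, hrx⟩
  by_cases hn : G.Near l p r
  · exact .inr ⟨r, ⟨hr, hn⟩, hrx⟩
  · exact .inl ⟨hx, r, ⟨hr, h.resolve_right hn, hn⟩, hrx⟩

/-- A level of a breadth-first search in a t-perfect graph of large odd girth has bounded
chromatic number. -/
theorem IsFloor.col (hX : G.IsFloor X R Y l) (hG : G.TPerfect) (hg : G.OddGirthGE 13)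
    (hconn : G.ConnIn X) : G.Col X 1138 := by
  -- The constants are consumed by three nested lollipops: 1138 = 2(4 + 565), 565 = 79 + 2(4 + 239)
  -- and 239 = 79 + 2(4 + 76). The final 76 covers the vertices whose parents see the third
  -- lollipop.
  by_contra hcol
  have hg9 : G.OddGirthGE 9 := hg.mono (by norm_num)
  have hRX : ∀ x ∈ R, x ∉ X := fun x h h' => Set.disjoint_left.1 hX.RX h h'
  obtain ⟨x₀, hx₀⟩ := nonempty_of_not_col hcol
  obtain ⟨p₀, hp₀, hpx⟩ := hX.par x₀ hx₀
  obtain ⟨z₁, m₁, g₁, n₁, q₁, B₁, L₁, hz₁0, hB₁, hk₁, hz₁, hg₁⟩ := exists_gadget hg hconn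
    (hRX p₀ hp₀) ⟨x₀, hx₀, hpx⟩ (k := 565) hcol
  have six₁ := L₁.six_le
  have sub₁ := L₁.le_sub
  have hz₁' : ∀ i ≤ m₁, z₁ i ∈ X ∨ z₁ i = p₀ := fun i hi => by
    rcases Nat.eq_zero_or_pos i with rfl | h
    · exact .inr hz₁0
    · exact .inl (hz₁ i hi h)
  have hzq : ∀ i ≤ m₁, z₁ i ≠ g₁ q₁ := by
    intro i hi e
    rcases hi.lt_or_eq with h | rfl
    · exact (L₁.cross i h q₁ (by omega)).1 e
    · have := L₁.hole.inj 0 q₁ (by omega) (by omega) (L₁.join.symm.trans e); omega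
  have hc₁X : g₁ q₁ ∈ X := by
    rcases hg₁ q₁ (by omega) with h | h
    · exact absurd (hz₁0.trans h.symm) (hzq 0 (Nat.zero_le _))
    · exact h
  set W₁ := G.nbrs {r ∈ R | ((∃ i ≤ m₁, G.Adj r (z₁ i)) ∨ ∃ j < n₁, G.Adj r (g₁ j)) ∨
    G.Near l p₀ r} with hW₁
  have clean₁ : ∀ x ∉ W₁, ∀ r ∈ R, G.Adj r x → (∀ i ≤ m₁, ¬ G.Adj r (z₁ i)) ∧
      (∀ j < n₁, ¬ G.Adj r (g₁ j)) ∧ ¬ G.Near l p₀ r := by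
    intro x hx r hr hrx
    refine ⟨fun i hi h => ?_, fun j hj h => ?_, fun h => ?_⟩
    · exact hx ⟨r, ⟨hr, .inl (.inl ⟨i, hi, h⟩)⟩, hrx⟩
    · exact hx ⟨r, ⟨hr, .inl (.inr ⟨j, hj, h⟩)⟩, hrx⟩
    · exact hx ⟨r, ⟨hr, .inr h⟩, hrx⟩
  obtain ⟨z₂, m₂, g₂, n₂, q₂, B₂, L₂, hz₂0, hB₂, hk₂, hz₂, hg₂⟩ := exists_next_gadget hg L₁.conn
    (L₁.gB q₁ (by omega)) L₁.att (k := 239) (hX.col_dirty hG hg9 L₁ hB₁ hp₀ hz₁' (fun j hj =>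
      (hg₁ j hj).symm)) hk₁
  have six₂ := L₂.six_le
  have sub₂ := L₂.le_sub
  have hz₂X : ∀ i ≤ m₂, z₂ i ∈ X := fun i hi => by
    rcases Nat.eq_zero_or_pos i with rfl | h
    · rw [hz₂0]; exact hc₁X
    · exact hB₁ (hz₂ i hi h)
  have hg₂X : ∀ j < n₂, g₂ j ∈ X := fun j hj => by
    rcases Nat.eq_zero_or_pos j with rfl | h
    · rw [← L₂.join]; exact hz₂X m₂ le_rfl
    · exact hB₁ (hg₂ j hj h).1
  -- This parent becomes the foot of the leg. Since `g₂ 3` lies outside W₁, p does not see the first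
  -- lollipop and is far from p₀.
  obtain ⟨p, hp, hpe⟩ := hX.par (g₂ 3) (hg₂X 3 (by omega))
  obtain ⟨pz₁, pg₁, pfar⟩ := clean₁ _ (hg₂ 3 (by omega) (by omega)).2 p hp hpe
  set W₂ := G.nbrs {r ∈ R | ((∃ i ≤ m₂, G.Adj r (z₂ i)) ∨ ∃ j < n₂, G.Adj r (g₂ j)) ∨
    G.Near l p r} with hW₂
  obtain ⟨z₃, m₃, g₃, n₃, q₃, B₃, L₃, hz₃0, hB₃, hk₃, hz₃, hg₃⟩ := exists_next_gadget hg L₂.conn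
    (L₂.gB q₂ (by omega)) L₂.att (k := 76) (hX.col_dirty hG hg9 L₂ (fun x hx => hB₁ (hB₂ hx).1)
      hp (fun i hi => .inl (hz₂X i hi)) (fun j hj => .inl (hg₂X j hj))) hk₂
  have six₃ := L₃.six_le
  have sub₃ := L₃.le_sub
  have hB₂X : B₂ ⊆ X := fun x hx => hB₁ (hB₂ hx).1
  have hz₃X : ∀ i ≤ m₃, z₃ i ∈ X := fun i hi => by
    rcases Nat.eq_zero_or_pos i with rfl | h
    · rw [hz₃0]; exact hg₂X _ (by omega)
    · exact hB₂X (hz₃ i hi h)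
  have hg₃X : ∀ j < n₃, g₃ j ∈ X := fun j hj => by
    rcases Nat.eq_zero_or_pos j with rfl | h
    · rw [← L₃.join]; exact hz₃X m₃ le_rfl
    · exact hB₂X (hg₃ j hj h).1
  have c₃ := hX.col_lolli hG hg9 L₃ (R' := {r ∈ R | (∃ i ≤ m₃, G.Adj r (z₃ i)) ∨
    ∃ j < n₃, G.Adj r (g₃ j)}) (fun r hr => hr.1) (fun x hx => hB₂X (hB₃ hx).1)
    (fun i hi => .inl (hz₃X i hi)) (fun j hj => .inl (hg₃X j hj)) (fun r hr => hr.2)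
  -- Some vertex of the last head remains, and its parent r sees none of the three path-and-hole
  -- parts and is far from p₀ and p.
  obtain ⟨x, hxB, hxW⟩ := nonempty_of_not_col (not_col_diff (l := 0) hk₃ c₃)
  have hxX : x ∈ X := hB₂X (hB₃ hxB).1
  obtain ⟨r, hr, hrx⟩ := hX.par x hxX
  obtain ⟨rz₁, rg₁, rfar₁⟩ := clean₁ x (hB₂ (hB₃ hxB).1).2 r hr hrx
  have hxW₂ : x ∉ W₂ := (hB₃ hxB).2
  have rz₂ : ∀ i ≤ m₂, ¬ G.Adj r (z₂ i) := fun i hi h =>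
    hxW₂ ⟨r, ⟨hr, .inl (.inl ⟨i, hi, h⟩)⟩, hrx⟩
  have rg₂ : ∀ j < n₂, ¬ G.Adj r (g₂ j) := fun j hj h =>
    hxW₂ ⟨r, ⟨hr, .inl (.inr ⟨j, hj, h⟩)⟩, hrx⟩
  have rfar₂ : ¬ G.Near l p r := fun h => hxW₂ ⟨r, ⟨hr, .inr h⟩, hrx⟩
  have rz₃ : ∀ i ≤ m₃, ¬ G.Adj r (z₃ i) := fun i hi h =>
    hxW ⟨hxB, r, ⟨hr, .inl ⟨i, hi, h⟩⟩, hrx⟩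
  have rg₃ : ∀ j < n₃, ¬ G.Adj r (g₃ j) := fun j hj h =>
    hxW ⟨hxB, r, ⟨hr, .inr ⟨j, hj, h⟩⟩, hrx⟩
  have hpW₂ : ∀ x ∉ W₂, ¬ G.Adj p x := fun x hx h => hx ⟨p, ⟨hp, .inr (.inl rfl)⟩, h⟩
  -- connect the three parents below
  have hrR : ∀ i : Fin 3, (![r, p₀, p] : Fin 3 → V) i ∈ R := by
    intro i; fin_cases i <;> assumption
  obtain ⟨c1, c2, c3, c4, c5, c6⟩ := hX.three (r := ![r, p₀, p]) hrR (by
    intro i j hij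
    fin_cases i <;> fin_cases j <;> simp at hij ⊢
    · exact fun h => rfar₁ h.symm
    · exact fun h => rfar₂ h.symm
    · exact rfar₁
    · exact pfar
    · exact rfar₂
    · exact fun h => pfar h.symm)
  obtain ⟨f, m, u, k, a, hf, hf0, hfm, hfY, hu, hu0, huY, huf, hun, ha0, ham, haadj, hall⟩ :=
    exists_tripod hg (by norm_num) c1 c2 c3 (fun i => hX.adj _ (hrR i)) c4 c5 c6
  change f 0 = r at hf0
  change f m = p₀ at hfm
  change u 0 = p at hu0
  have hYX : ∀ y ∈ Y ∪ {y | ∃ i, y = l ((![r, p₀, p] : Fin 3 → V) i)}, y ∉ X ∧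
      ∀ x ∈ X, ¬ G.Adj y x := by
    rintro y (h | ⟨i, rfl⟩)
    · exact ⟨fun h' => Set.disjoint_left.1 hX.YX h h', fun x hx => hX.antiYX y h x hx⟩
    · exact ⟨hX.lX _ (hrR i), hX.lantiX _ (hrR i)⟩
  -- The tripod path f goes from r to p₀ and its leg starts at p. The first lollipop gives the left
  -- connection, the second the hole with its stem, the third the path y and the right connection.
  have frame : G.IsFrame f u z₂ g₂ z₃ m k a m₂ n₂ q₂ m₃ X B₁ B₂
      {x | (∃ j ≤ m₁, x = z₁ j) ∨ ∃ j < n₁, j ≠ q₁ ∧ x = g₁ j}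
      ({x | ∃ j < n₃, 0 < j ∧ x = g₃ j} ∪ B₃) :=
    { fpath := hf
      upath := hu
      a_pos := ha0
      a_lt := ham
      uf_ne := huf
      uf_anti := hun
      uf_adj := haadj
      uf_only := fun j hj h => (hall j hj h).2
      fX := by
        intro i hi
        rcases Nat.eq_zero_or_pos i with rfl | h0
        · rw [hf0]; exact hRX r hr
        · rcases hi.lt_or_eq with h | rfl
          · exact (hYX _ (hfY i h h0)).1
          · rw [hfm]; exact hRX p₀ hp₀
      faX := fun i hi h0 => (hYX _ (hfY i hi h0)).2
      uX := by
        intro i hi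
        rcases Nat.eq_zero_or_pos i with rfl | h0
        · rw [hu0]; exact hRX p hp
        · exact (hYX _ (huY i hi h0)).1
      uaX := fun i hi h0 => (hYX _ (huY i hi h0)).2
      left := by
        intro e
        obtain ⟨w, s, hw, hwz, hws, hse, hs3, -, hwi⟩ := L₁.route (e + m₁)
        refine ⟨w, m₁ + s, hw, ?_, ?_, by omega, by omega, fun i hi => hwi i hi⟩
        · rw [hwz 0 (Nat.zero_le _), hz₁0, hfm]
        · rw [hws, hz₂0]
      right := by
        intro e
        obtain ⟨v, N, hv, hv0, hvN, hN, hNe, hvS⟩ := L₃.exists_tail ⟨x, hxB, hrx⟩ (fun j hj =>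
          ⟨fun e => hRX r hr (e ▸ hg₃X j hj), rg₃ j hj⟩) e
        exact ⟨v, N, hv, hv0.trans L₃.join.symm, hvN.trans hf0.symm, hN, hNe, hvS⟩
      S₁X := by
        rintro y (⟨j, hj, rfl⟩ | ⟨j, hj, -, rfl⟩)
        · rw [hfm]; exact hz₁' j hj
        · rw [hfm]; exact (hg₁ j hj).symm
      S₁B := by
        rintro y (⟨j, hj, rfl⟩ | ⟨j, hj, hjq, rfl⟩)
        · refine ⟨by rw [hz₂0]; exact hzq j hj, fun b hb => ⟨?_, L₁.antiz j hj b hb⟩⟩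
          exact fun e => L₁.zB j hj (e ▸ hb)
        · refine ⟨?_, fun b hb => ⟨fun e => L₁.gB j hj (e ▸ hb), L₁.antig j hj hjq b hb⟩⟩
          rw [hz₂0]
          exact fun e => hjq (L₁.hole.inj j q₁ hj (by omega) e)
      lol := L₂
      t0 := hz₂X 0 (Nat.zero_le _)
      tB := hz₂
      gB := fun j hj h0 => (hg₂ j hj h0).1
      BB := fun x hx => (hB₂ hx).1
      B₁X := hB₁
      ypath := L₃.path
      y0 := hz₃0
      yB := hz₃
      S₃B := by
        rintro y (⟨j, hj, h0, rfl⟩ | h)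
        · exact (hg₃ j hj h0).1
        · exact (hB₃ h).1
      S₃y := by
        rintro y (⟨j, hj, h0, rfl⟩ | h) i hi
        · have := L₃.cross i hi j hj
          exact ⟨this.1.symm, fun h => by have := (this.2 h.symm).2; omega⟩
        · exact ⟨fun e => L₃.zB i hi.le (e ▸ h), fun h' => L₃.antiz i hi.le y h h'.symm⟩
      rS₁ := by
        rintro y (⟨j, hj, rfl⟩ | ⟨j, hj, -, rfl⟩)
        · rw [hf0]; exact rz₁ j hj
        · rw [hf0]; exact rg₁ j hj
      rt := by rw [hf0]; exact rz₂
      rg := by rw [hf0]; exact rg₂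
      ry := by rw [hf0]; exact rz₃
      pS₁ := by
        rintro y (⟨j, hj, rfl⟩ | ⟨j, hj, -, rfl⟩)
        · rw [hu0]; exact pz₁ j hj
        · rw [hu0]; exact pg₁ j hj
      pS₃ := by
        rintro y (⟨j, hj, h0, rfl⟩ | h)
        · rw [hu0]; exact hpW₂ _ (hg₃ j hj h0).2
        · rw [hu0]; exact hpW₂ _ (hB₃ h).2 }
  exact frame.contradiction hG (by rw [hu0]; exact hpe)

end floor

/-! ### From a single level to the whole graph. -/

section levels
variable {G : SimpleGraph V}

theorem IsBFS.connIn_ball {s : Set V} {v : V} {d : V → ℕ} (hd : G.IsBFS s v d) (k : ℕ) :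
    G.ConnIn {a ∈ s | d a ≤ k} := by
  have key : ∀ j ≤ k, ∀ a ∈ s, d a = j → ∃ p : G.Walk a v, ∀ w ∈ p.support, w ∈ s ∧ d w ≤ k := by
    intro j
    induction j with
    | zero =>
      intro _ a ha h0
      obtain rfl := hd.eq_root a ha h0
      refine ⟨.nil, fun w hw => ?_⟩
      rw [Walk.support_nil, List.mem_singleton] at hw
      rw [hw, h0]; exact ⟨ha, Nat.zero_le _⟩
    | succ j ih =>
      intro hj a ha hda
      obtain ⟨b, hb, hab, hdb⟩ := hd.parent a ha (by omega)
      obtain ⟨p, hp⟩ := ih (by omega) b hb (by omega)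
      refine ⟨.cons hab p, fun w hw => ?_⟩
      rw [Walk.support_cons, List.mem_cons] at hw
      rcases hw with rfl | hw
      · exact ⟨ha, by omega⟩
      · exact hp w hw
  rintro a ⟨ha, hda⟩ b ⟨hb, hdb⟩
  obtain ⟨p, hp⟩ := key _ hda a ha rfl
  obtain ⟨p', hp'⟩ := key _ hdb b hb rfl
  refine ⟨p.append p'.reverse, fun w hw => ?_⟩
  rw [Walk.mem_support_append_iff, Walk.support_reverse, List.mem_reverse] at hw
  exact hw.elim (hp w) (hp' w)

/-- A subset of a high level of a breadth-first search is a floor. -/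
theorem IsBFS.isFloor {s : Set V} {v : V} {d : V → ℕ} (hd : G.IsBFS s v d) {t : ℕ} {X : Set V}
    (hXs : X ⊆ {a ∈ s | d a = t + 3}) :
    ∃ l, G.IsFloor X {a ∈ s | d a = t + 2} {a ∈ s | d a ≤ t} l := by
  have hpar : ∀ r, ∃ b, r ∈ s → d r = t + 2 → b ∈ s ∧ G.Adj r b ∧ d b = t + 1 := by
    intro r
    by_cases h : r ∈ s ∧ d r = t + 2
    · obtain ⟨b, hb, hrb, hdb⟩ := hd.parent r h.1 (by omega)
      exact ⟨b, fun _ _ => ⟨hb, hrb, by omega⟩⟩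
    · exact ⟨r, fun h1 h2 => absurd ⟨h1, h2⟩ h⟩
  choose l hl using hpar
  refine ⟨l, ⟨?_, ?_, ?_, ?_, ?_, ?_, hd.connIn_ball t, ?_, ?_, ?_, ?_, ?_⟩⟩
  · intro x hx
    obtain ⟨hxs, hxd⟩ := hXs hx
    obtain ⟨b, hb, hxb, hdb⟩ := hd.parent x hxs (by omega)
    exact ⟨b, ⟨hb, by omega⟩, hxb.symm⟩
  · rw [Set.disjoint_left]
    intro x hx hx'
    have := (hXs hx').2
    have := hx.2
    omega
  · rw [Set.disjoint_left]
    intro x hx hx'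
    have := (hXs hx').2
    have := hx.2
    omega
  · rw [Set.disjoint_left]
    intro x hx hx'
    have := hx'.2
    have := hx.2
    omega
  · intro y hy x hx hadj
    have := hd.lip x (hXs hx).1 y hy.1 hadj.symm
    have := (hXs hx).2
    have := hy.2
    omega
  · intro y hy x hx hadj
    have := hd.lip x hx.1 y hy.1 hadj.symm
    have := hx.2
    have := hy.2
    omega
  · exact fun r hr => (hl r hr.1 hr.2).2.1
  · intro r hr h
    have := (hl r hr.1 hr.2).2.2
    have := (hXs h).2
    omega
  · intro r hr h
    have := (hl r hr.1 hr.2).2.2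
    have := h.2
    omega
  · intro r hr x hx hadj
    have h1 := hl r hr.1 hr.2
    have := hd.lip x (hXs hx).1 _ h1.1 hadj.symm
    have := (hXs hx).2
    omega
  · intro r hr
    have h1 := hl r hr.1 hr.2
    obtain ⟨b, hb, hxb, hdb⟩ := hd.parent _ h1.1 (by omega)
    exact ⟨b, ⟨hb, by omega⟩, hxb.symm⟩

/-- t-perfect graphs of odd girth at least 13 have bounded chromatic number. -/
theorem TPerfect.col_of_oddGirth (hG : G.TPerfect) (hg : G.OddGirthGE 13) :
    G.Col Set.univ 2276 := by
  by_contra hcol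
  obtain ⟨c, -, hc, -, hck⟩ := exists_component hcol
  obtain ⟨v, hv⟩ := nonempty_of_not_col hck
  obtain ⟨d, hd⟩ := exists_isBFS hc hv
  obtain ⟨t, ht⟩ := exists_level d hd.lip (k := 1138) hck
  -- Levels 0, 1 and 2 are stable. So t ≥ 3, which leaves room below for the parents, the chosen
  -- grandparents and Y.
  have ht3 : 3 ≤ t := by
    by_contra h
    refine ht ((hg.col_walkEnds v (t := t) (by omega)).mono ?_ (by omega))
    rintro a ⟨ha, rfl⟩
    exact hd.mem_walkEnds ha
  obtain ⟨X, hXs, hX, -, hXk⟩ := exists_component ht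
  obtain ⟨t, rfl⟩ : ∃ t', t = t' + 3 := ⟨t - 3, by omega⟩
  obtain ⟨l, hl⟩ := hd.isFloor hXs
  exact hXk (hl.col hG hg hX)

end levels

/-! ### Induced subgraphs and raising the odd girth. -/

section reductions
variable {G : SimpleGraph V}

open Classical in
/-- The property `HSTAB ⊆ SSP` passes to induced subgraphs. -/
theorem hstab_subset_induce (hG : G.hstab ⊆ G.stableSetPolytope) (s : Set V) :
    (G.induce s).hstab ⊆ (G.induce s).stableSetPolytope := by
  rintro x ⟨hx0, hxK, hxC⟩
  -- Extend x by zero; afterwards a convex combination for y is restricted to s.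
  set y : V → ℝ := fun v => if h : v ∈ s then x ⟨v, h⟩ else 0 with hy
  have hys : ∀ v : s, y v = x v := fun v => by simp [hy]
  have hyn : ∀ v, v ∉ s → y v = 0 := fun v hv => by simp [hy, hv]
  have hy0 : ∀ v, 0 ≤ y v := fun v => by
    by_cases h : v ∈ s
    · rw [hys ⟨v, h⟩]; exact hx0 _
    · rw [hyn v h]
  have hyK : ∀ K : Finset V, G.IsClique (K : Set V) → ∑ v ∈ K, y v ≤ 1 := by
    intro K hK
    have h1 : ∑ v ∈ K, y v = ∑ v ∈ K.subtype (· ∈ s), x v := by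
      rw [← Finset.sum_filter_add_sum_filter_not K (· ∈ s) y,
        Finset.sum_eq_zero (s := K.filter (· ∉ s)) (fun v hv => hyn v (Finset.mem_filter.1 hv).2),
        add_zero, ← Finset.sum_subtype_eq_sum_filter]
      exact Finset.sum_congr rfl fun v _ => hys v
    rw [h1]
    apply hxK
    intro a ha b hb hab
    rw [Finset.mem_coe, Finset.mem_subtype] at ha hb
    exact hK ha hb fun h => hab (Subtype.ext h)
  have hyedge : ∀ a b, G.Adj a b → y a + y b ≤ 1 := by
    intro a b hab
    have := hyK {a, b} (by
      intro c hc d hd hcd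
      simp only [Finset.coe_insert, Finset.coe_singleton, Set.mem_insert_iff,
        Set.mem_singleton_iff] at hc hd
      rcases hc with rfl | rfl <;> rcases hd with rfl | rfl
      · exact absurd rfl hcd
      · exact hab
      · exact hab.symm
      · exact absurd rfl hcd)
    rwa [Finset.sum_pair hab.ne] at this
  have hymem : y ∈ G.stableSetPolytope := by
    refine hG ⟨hy0, hyK, fun w c hc ho => ?_⟩
    by_cases hin : ∀ v ∈ c.support, v ∈ s
    · have hc' : (c.induce s hin).IsCycle := by
        have h := Walk.map_induce c hin
        refine Walk.IsCycle.of_map (f := (Embedding.induce s).toHom) ?_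
        rw [h]; exact hc
      have hlen : (c.induce s hin).length = c.length := by
        have h := congrArg Walk.length (Walk.map_induce c hin)
        exact (Walk.length_map _ _).symm.trans h
      have h1 := hxC _ _ hc' (by rwa [hlen])
      rw [hlen] at h1
      refine le_of_eq_of_le ?_ h1
      rw [Walk.support_induce]
      symm
      have mem := fun v => @List.mem_toFinset _ (fun a b => Classical.propDecidable (a = b))
        (c.support.attachWith _ hin) v
      refine Finset.sum_bij (fun v _ => (v : V)) ?_ (fun v _ v' _ h => Subtype.ext h) ?_
        fun v _ => (hys v).symm
      · intro v hv
        have := (List.mem_attachWith _ _).1 ((mem _).1 hv)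
        exact List.mem_toFinset.2 this
      · intro v hv
        have := List.mem_toFinset.1 hv
        exact ⟨⟨v, hin v this⟩, (mem _).2 ((List.mem_attachWith _ _).2 this), rfl⟩
    -- An odd cycle leaving s passes through a vertex of weight 0, so its inequality already follows
    -- from the edge inequalities.
    · push Not at hin
      obtain ⟨v, hv, hvs⟩ := hin
      have h1 := one_le_walkSlack_of_zero hyedge c ho hv (hyn v hvs)
      rw [walkSlack_cycle hc] at h1
      linarith
  -- restrict a convex combination
  have hx : x = LinearMap.funLeft ℝ ℝ ((↑) : s → V) y := by
    ext v; exact (hys v).symm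
  rw [hx]
  have himg := Set.mem_image_of_mem (LinearMap.funLeft ℝ ℝ ((↑) : s → V)) hymem
  unfold stableSetPolytope at himg
  rw [LinearMap.image_convexHull] at himg
  refine convexHull_mono ?_ himg
  rintro _ ⟨_, ⟨S, hS, rfl⟩, rfl⟩
  refine ⟨{v | (v : V) ∈ S}, ?_, ?_⟩
  · intro a ha b hb hab
    exact hS ha hb fun h => hab (Subtype.ext h)
  · ext v
    simp [LinearMap.funLeft_apply, Set.indicator_apply]

theorem col_univ_iff {k : ℕ} : G.Col Set.univ k ↔ G.Colorable k := by
  rw [col_iff_colorable]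
  exact ⟨fun h => h.of_hom (induceUnivIso G).symm.toHom, fun h => h.of_hom (induceUnivIso G).toHom⟩

/-- Removing a stable set costs one colour. -/
theorem colorable_succ_of_indepSet {S : Set V} (hS : G.IsIndepSet S) {k : ℕ}
    (h : (G.induce Sᶜ).Colorable k) : G.Colorable (k + 1) := by
  rw [← col_univ_iff, ← Set.compl_union_self S]
  refine (col_iff_colorable.2 h).union (Col.of_anti fun a ha b hb hab => ?_)
  exact hS ha hb hab.ne hab

theorem CliqueFree.oddGirthGE (h3 : G.CliqueFree 3) : G.OddGirthGE 5 := by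
  intro v p hp
  by_contra hlt
  have : p.length = 1 ∨ p.length = 3 := by
    obtain ⟨m, hm⟩ := hp; omega
  rcases p with _ | ⟨h1, p⟩
  · simp at this
  rcases p with _ | ⟨h2, p⟩
  · exact h1.ne rfl
  rcases p with _ | ⟨h3', p⟩
  · simp at this
  rcases p with _ | ⟨h4, p⟩
  · classical
    exact h3 _ (is3Clique_triple_iff.2 ⟨h1, h3'.symm, h2⟩)
  · simp at this

theorem walkSlack_const {c : ℝ} {u v : V} (p : G.Walk u v) :
    walkSlack (fun _ => c) p = p.length * (1 - 2 * c) := by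
  induction p with
  | nil => simp
  | cons h p ih => rw [walkSlack_cons, ih, Walk.length_cons]; push_cast; ring

theorem walkSlack_eq_length {S : Set V} {u v : V} (p : G.Walk u v) (h : ∀ w ∈ p.support, w ∉ S) :
    walkSlack (S.indicator 1) p = p.length := by
  induction p with
  | nil => simp
  | cons hadj p ih =>
    rw [walkSlack_cons, ih fun w hw => h w (by simp [hw]),
      Set.indicator_of_notMem (h _ (by simp)), Set.indicator_of_notMem (h _ (by simp)),
      Walk.length_cons]
    push_cast; ring

/-- In a t-perfect graph, deleting a suitable stable set increases the odd girth. -/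
theorem TPerfect.exists_indepSet_oddGirth (hG : G.TPerfect) {g : ℕ} (hg3 : 3 ≤ g) (hgo : Odd g)
    (hg : G.OddGirthGE g) : ∃ S : Set V, G.IsIndepSet S ∧ (G.induce Sᶜ).OddGirthGE (g + 2) := by
  rcases isEmpty_or_nonempty V with hV | ⟨⟨d⟩⟩
  · exact ⟨∅, by intro a; exact hV.elim a, fun v => hV.elim v.1⟩
  have hg' : (3 : ℝ) ≤ g := by exact_mod_cast hg3
  -- This constant gives every edge slack 1/g. A closed odd walk of length ℓ then has slack ℓ/g,
  -- tight exactly for ℓ = g.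
  set c : ℝ := (g - 1) / (2 * g) with hc
  have hc1 : 1 - 2 * c = 1 / g := by rw [hc]; field_simp; ring
  have hc0 : 0 < c := by rw [hc]; apply div_pos <;> linarith
  have hc2 : 2 * c ≤ 1 := by
    have : 0 ≤ 1 / (g : ℝ) := by positivity
    linarith
  obtain ⟨S, hS, -, -, hSw⟩ := hG (fun _ => c) ⟨fun _ => hc0.le, fun _ => by linarith,
    fun _ _ _ => by linarith, fun v p hp => by
      rw [walkSlack_const, hc1, mul_one_div, le_div_iff₀ (by linarith), one_mul]
      exact_mod_cast hg v p hp⟩ d hc0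
  refine ⟨S, hS, fun v p hp => ?_⟩
  set p' := p.map (Embedding.induce Sᶜ).toHom with hp'
  have hlen : p'.length = p.length := Walk.length_map _ _
  have hge := hg _ p' (by rwa [hlen])
  rw [hlen] at hge
  -- A walk of length g avoiding S would have slack g at S, whereas tightness demands 1.
  have hne : p.length ≠ g := by
    intro he
    have h1 := hSw _ p' (by rwa [hlen]) (by
      rw [walkSlack_const, hc1, hlen, he]
      field_simp)
    rw [walkSlack_eq_length p' (by
      intro w hw
      rw [hp', Walk.support_map, List.mem_map] at hw
      obtain ⟨w', -, rfl⟩ := hw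
      exact w'.2), hlen, he] at h1
    linarith
  obtain ⟨a, ha⟩ := hgo
  obtain ⟨b, hb⟩ := hp
  omega

/-- Triangle-free h-perfect graphs have bounded chromatic number. -/
theorem colorable_of_cliqueFree_three (hG : G.hstab ⊆ G.stableSetPolytope) (h3 : G.CliqueFree 3) :
    G.Colorable 2280 := by
  -- Deleting j stable sets raises the odd girth from 13 - 2j to 13; triangle-free graphs start at j
  -- = 4.
  have step : ∀ j : ℕ, j ≤ 4 → ∀ {V : Type _} {G : SimpleGraph V},
      G.hstab ⊆ G.stableSetPolytope → G.CliqueFree 3 → G.OddGirthGE (13 - 2 * j) →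
      G.Colorable (2276 + j) := by
    intro j
    induction j with
    | zero =>
      intro _ V G hG h3 hg
      exact col_univ_iff.1 ((tperfect_of_hstab_subset hG h3).col_of_oddGirth hg)
    | succ j ih =>
      intro hj V G hG h3 hg
      obtain ⟨S, hS, hgS⟩ := (tperfect_of_hstab_subset hG h3).exists_indepSet_oddGirth (by omega)
        (by rw [Nat.odd_iff]; omega) hg
      refine colorable_succ_of_indepSet hS (ih (by omega) (hstab_subset_induce hG _)
        (h3.comap ⟨(Embedding.induce _).toCopy⟩) ?_)
      rwa [show 13 - 2 * (j + 1) + 2 = 13 - 2 * j by omega] at hgS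
  exact step 4 le_rfl hG h3 h3.oddGirthGE

end reductions

/-! ### Lowering the clique number, and the final bound. -/

section cliques
variable {G : SimpleGraph V}

/-- If `HSTAB ⊆ SSP`, then some stable set meets all cliques of the maximum size `n ≥ 3`. -/
theorem exists_indepSet_cliqueFree (hG : G.hstab ⊆ G.stableSetPolytope) {n : ℕ} (hn : 3 ≤ n)
    (hfree : G.CliqueFree (n + 1)) :
    ∃ S : Set V, G.IsIndepSet S ∧ (G.induce Sᶜ).CliqueFree n := by
  classical
  rcases isEmpty_or_nonempty V with hV | ⟨⟨d⟩⟩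
  · refine ⟨∅, by intro a; exact hV.elim a, fun K hK => ?_⟩
    have h0 : K = ∅ := Finset.eq_empty_of_forall_notMem fun v => hV.elim v.1
    have := hK.card_eq
    rw [h0, Finset.card_empty] at this
    omega
  have hn' : (3 : ℝ) ≤ n := by exact_mod_cast hn
  have hnpos : (0 : ℝ) < n := by linarith
  -- An odd cycle of length ℓ ≥ 3 has slack ℓ(1 - 2/n), which is at least 1 because n ≥ 3.
  have hmem : (fun _ => 1 / (n : ℝ)) ∈ G.stableSetPolytope := by
    refine hG ⟨fun _ => by positivity, fun K hK => ?_, fun w c hc ho => ?_⟩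
    · have hcard : K.card ≤ n := by
        by_contra hcon
        obtain ⟨K', hK', hc⟩ := Finset.exists_subset_card_eq (Nat.lt_of_not_le hcon)
        exact hfree K' ⟨hK.subset (by exact_mod_cast hK'), hc⟩
      rw [Finset.sum_const, nsmul_eq_mul, mul_one_div, div_le_one hnpos]
      exact_mod_cast hcard
    · have h1 : 1 ≤ walkSlack (fun _ => 1 / (n : ℝ)) c := by
        rw [walkSlack_const]
        have h3 : (3 : ℝ) ≤ c.length := by exact_mod_cast hc.three_le_length
        have h4 : 1 / (n : ℝ) ≤ 1 / 3 := one_div_le_one_div_of_le (by norm_num) hn'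
        nlinarith
      rw [walkSlack_cycle hc] at h1
      linarith
  obtain ⟨S, hS, -, hl⟩ := exists_tight_indepSet hmem (d := d) (by positivity)
  refine ⟨S, hS, fun K hK => ?_⟩
  set K' : Finset V := K.map (Function.Embedding.subtype _) with hK'
  have hclique : G.IsClique (K' : Set V) := by
    intro a ha b hb hab
    rw [Finset.mem_coe, hK', Finset.mem_map] at ha hb
    obtain ⟨a', ha', rfl⟩ := ha
    obtain ⟨b', hb', rfl⟩ := hb
    exact hK.isClique ha' hb' fun h => hab (by rw [h])
  have hcard : K'.card = n := by rw [hK', Finset.card_map, hK.card_eq]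
  have hsum : ∀ y : V → ℝ, (∑ v ∈ K', coordMap v) y = ∑ v ∈ K', y v := fun y => by
    simp [LinearMap.sum_apply]
  have h1 := hl (∑ v ∈ K', coordMap v) 1 (fun S' hS' => by
    rw [hsum]
    have hle : ((K'.filter (· ∈ S')).card : ℝ) ≤ 1 := by
      have : (K'.filter (· ∈ S')).card ≤ 1 := by
        rw [Finset.card_le_one]
        intro a ha b hb
        rw [Finset.mem_filter] at ha hb
        by_contra hab
        exact hS' ha.2 hb.2 hab (hclique ha.1 hb.1 hab)
      exact_mod_cast this
    refine le_of_eq_of_le ?_ hle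
    simp [Set.indicator_apply]) (by
    rw [hsum, Finset.sum_const, hcard, nsmul_eq_mul]
    field_simp)
  -- A clique of size n is tight at 1/n, so S must meet it; a clique in the complement of S would
  -- have sum 0.
  rw [hsum, Finset.sum_eq_zero] at h1
  · norm_num at h1
  · intro v hv
    rw [hK', Finset.mem_map] at hv
    obtain ⟨v', -, rfl⟩ := hv
    exact Set.indicator_of_notMem v'.2 _

theorem colorable_of_cliqueFree (j : ℕ) : ∀ {V : Type u} {G : SimpleGraph V},
    G.hstab ⊆ G.stableSetPolytope → G.CliqueFree (j + 3) → G.Colorable (j + 2280) := by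
  induction j with
  | zero => exact fun hG h3 => by simpa using colorable_of_cliqueFree_three hG h3
  | succ j ih =>
    intro V G hG hfree
    obtain ⟨S, hS, hfreeS⟩ := exists_indepSet_cliqueFree hG (n := j + 3) (by omega)
      (by rwa [show j + 3 + 1 = j + 1 + 3 by omega])
    have := colorable_succ_of_indepSet hS (ih (hstab_subset_induce hG _) hfreeS)
    rwa [show j + 2280 + 1 = j + 1 + 2280 by omega] at this

/-- The chromatic number of an h-perfect graph exceeds its clique number by a bounded amount. -/
theorem colorable_cliqueNum_add {V : Type u} [Finite V] {G : SimpleGraph V}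
    (hG : G.hstab ⊆ G.stableSetPolytope) : G.Colorable (G.cliqueNum + 2280) := by
  have : Fintype V := Fintype.ofFinite V
  have hfree : G.CliqueFree (G.cliqueNum + 1) := fun K hK => by
    have := hK.isClique.card_le_cliqueNum
    have := hK.card_eq
    omega
  -- For clique number below 2 the truncated subtraction gives index 0, that is, the triangle-free
  -- case.
  exact (colorable_of_cliqueFree (G.cliqueNum - 2) hG (hfree.mono (by omega))).mono (by omega)

end cliques

end SimpleGraph

theorem theorem1p2 :
    (∀ (V : Type u) [Finite V] (G : SimpleGraph V), G.IsHPerfect →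
      G.Colorable (G.cliqueNum + 199050)) ∧
    SimpleGraph.IsLinearlyChiBounded.{u} (fun _ G => G.IsHPerfect) := by
  -- The argument gives ω + 2280, well within the stated constant. Induced subgraphs inherit the
  -- inclusion HSTAB ⊆ SSP, which is all the bound needs.
  refine ⟨fun V _ G hG => ?_, 1, 199050, fun V _ G hG s => ?_⟩
  · exact (SimpleGraph.colorable_cliqueNum_add hG.symm.subset).mono (by omega)
  · simp only [one_mul]
    exact ((SimpleGraph.colorable_cliqueNum_add
      (SimpleGraph.hstab_subset_induce hG.symm.subset s)).mono (by omega)).chromaticNumber_le
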